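/- Let $a_+,a_->0$, and put $\alpha=2\pi/(a_+a_-)$, $a=(a_++a_-)/2$. For $|\mathrm{Im}\,z|<a$ let $$g(z)=\int_0^\infty\Big(\frac{\sin 2tz}{2\sinh(a_+t)\sinh(a_-t)}-\frac{z}{a_+a_-t}\Big)\frac{dt}{t},\qquad G(z)=e^{ig(z)},$$ and let $G$ (the hyperbolic gamma function) be continued meromorphically to $\mathbb C$ through $G(z+ia_+/2)=2\cosh(\pi z/a_-)\,G(z-ia_+/2)$. Write $f(w\pm v)=f(w+v)f(w-v)$. For $0<\mathrm{Re}\,b<2a$ and $x,y\in\mathbb R$ let $$\mathcal R_r(b;x,y)=\frac{1}{\sqrt{a_+a_-}\,G(ib-ia)}\int_{\mathbb R}\frac{G(z\pm(x-y)/2-ib/2)}{G(z\pm(x+y)/2+ib/2)}\,dz$$ be the renormalized relativistic conical function, and for $\gamma\in\mathbb R$, $x,y>0$ let $$F(a-i\gamma;x,y)=w(a-i\gamma;x)^{1/2}\,w(a-i\gamma;y)^{1/2}\,\mathcal R_r(a-i\gamma;x,y),\qquad w(a-i\gamma;x)=\frac{G(x+ia)G(-x+ia)}{G(x-\gamma)G(-x-\gamma)},$$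 where the square roots are continuous in $\gamma$ and positive for $\gamma=0$. For $\eta\in\mathbb R$ and $y>0$ let $$u^T(\eta;y)=e^{-i\alpha\eta y}\frac{G(-y+ia)}{G(y+ia)},$$ with the same formula for $u^T(\eta;-y)$, and let $$u^T(\eta;\pm y)^{1/2}=\big(G(y+ia)G(-y+ia)\big)^{1/2}\,\frac{e^{\mp i\alpha\eta y/2}}{G(\pm y+ia)},$$ where $G(y+ia)G(-y+ia)=4\sinh(\pi y/a_+)\sinh(\pi y/a_-)>0$ and the positive square root is taken. Then for all $\eta\in\mathbb R$ and $y>0$ the following holds. 1. For every $x\in\mathbb R$ the limit $$F^T(\eta;x,y)=\lim_{\Lambda\to\infty}F(a-i\eta-i\Lambda;x+\Lambda,y)$$ (the relativistic Toda eigenfunction) exists. 2. $F^T(\eta;x,y)=O(\exp(\alpha ax/4))$ as $x\to-\infty$. 3. $(u^T(\eta;\pm y)^{1/2})^2=u^T(\eta;\pm y)$, and as $x\to\infty$ $$F^T(\eta;x,y)=u^T(\eta;y)^{1/2}e^{i\alpha xy/2}+u^T(\eta;-y)^{1/2}e^{-i\alpha xy/2}+o(1).$$ -/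

import Mathlib

open Filter Topology MeasureTheory

noncomputable section

namespace RelToda

/-- `α = 2π / (a₊ a₋)`. -/
def alpha (ap am : ℝ) : ℝ := 2 * Real.pi / (ap * am)

/-- `a = (a₊ + a₋) / 2`. -/
def mean (ap am : ℝ) : ℝ := (ap + am) / 2

/-- The holomorphic logarithm `g` of the hyperbolic gamma function on the strip `|Im z| < a`:
`g(z) = ∫₀^∞ (sin(2tz) / (2 sinh(a₊t) sinh(a₋t)) - z / (a₊a₋t)) dt/t`. -/
def gLog (ap am : ℝ) (z : ℂ) : ℂ :=
  ∫ t in Set.Ioi (0 : ℝ),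
    (Complex.sin (2 * t * z) / (2 * Complex.sinh (ap * t) * Complex.sinh (am * t))
      - z / (ap * am * t)) / t

/-- The hyperbolic gamma function `G(a₊, a₋; z)`. In the strip `|Im z| < a` it is `exp(i g(z))`.
Elsewhere it is the meromorphic continuation obtained by iterating the difference equation
`G(z + i a₊/2) = 2 cosh(π z / a₋) G(z - i a₊/2)`, starting from `w = z - i n a₊` with
`|Im w| ≤ a₊/2 < a` (the value at a pole is `0`). -/
def hypGamma (ap am : ℝ) (z : ℂ) : ℂ :=
  if |z.im| < mean ap am then Complex.exp (Complex.I * gLog ap am z)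
  else
    let n : ℤ := round (z.im / ap)
    let w : ℂ := z - Complex.I * (n * ap)
    if 0 ≤ n then
      Complex.exp (Complex.I * gLog ap am w) *
        ∏ j ∈ Finset.range n.toNat,
          2 * Complex.cosh (Real.pi * (w + Complex.I * ((j + 1 / 2) * ap)) / am)
    else
      Complex.exp (Complex.I * gLog ap am w) /
        ∏ j ∈ Finset.range (-n).toNat,
          2 * Complex.cosh (Real.pi * (w - Complex.I * ((j + 1 / 2) * ap)) / am)

/-- The renormalized relativistic conical function `ℛ_r(b; x, y)`, `0 < Re b < 2a`, through its
integral representation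
`(a₊a₋)^(-1/2) G(ib - ia)⁻¹ ∫ G(z ± (x - y)/2 - ib/2) / G(z ± (x + y)/2 + ib/2) dz`,
where `f(z ± w) = f(z + w) f(z - w)`. -/
def conicalR (ap am : ℝ) (b : ℂ) (x y : ℝ) : ℂ :=
  1 / (Real.sqrt (ap * am) * hypGamma ap am (Complex.I * b - Complex.I * mean ap am)) *
    ∫ z : ℝ,
      (hypGamma ap am (z + (x - y) / 2 - Complex.I * b / 2) *
        hypGamma ap am (z - (x - y) / 2 - Complex.I * b / 2)) /
      (hypGamma ap am (z + (x + y) / 2 + Complex.I * b / 2) *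
        hypGamma ap am (z - (x + y) / 2 + Complex.I * b / 2))

/-- For `x > 0` and `γ` real, the square root of the weight function
`w(a - iγ; x) = G(x + ia) G(-x + ia) / (G(x - γ) G(-x - γ))`
that is continuous in `γ` and positive at `γ = 0`: the numerator is positive, and
`G(±x - γ) = exp(i g(±x - γ))` with `g` odd. -/
def weightSqrt (ap am γ x : ℝ) : ℂ :=
  (hypGamma ap am (x + Complex.I * mean ap am) *
      hypGamma ap am (-x + Complex.I * mean ap am)) ^ (1 / 2 : ℂ) *
    Complex.exp (-(Complex.I / 2) *
      (gLog ap am ((x - γ : ℝ) : ℂ) + gLog ap am ((-x - γ : ℝ) : ℂ)))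

/-- `F(b; x, y) = w(b; x)^(1/2) w(b; y)^(1/2) ℛ_r(b; x, y)` at `b = a - iγ`, for `x, y > 0`. -/
def conicalF (ap am γ x y : ℝ) : ℂ :=
  weightSqrt ap am γ x * weightSqrt ap am γ y *
    conicalR ap am (mean ap am - Complex.I * γ) x y

/-- The relativistic Toda eigenfunction
`F^T(η; x, y) = lim_{Λ → ∞} F(a - iη - iΛ; x + Λ, y)`. -/
def todaF (ap am η x y : ℝ) : ℂ :=
  limUnder atTop (fun Λ : ℝ => conicalF ap am (η + Λ) (x + Λ) y)

/-- The Toda `u`-function `u^T(η; y) = exp(-iαηy) G(-y + ia) / G(y + ia)`. -/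
def todaU (ap am η y : ℝ) : ℂ :=
  Complex.exp (-(Complex.I * alpha ap am * η * y)) *
    hypGamma ap am (-y + Complex.I * mean ap am) / hypGamma ap am (y + Complex.I * mean ap am)

/-- The Toda `c`-function `c^T(η; y) = exp(-iαηy/2) / G(y + ia)`. -/
def todaC (ap am η y : ℝ) : ℂ :=
  Complex.exp (-(Complex.I * alpha ap am * η * y / 2)) /
    hypGamma ap am (y + Complex.I * mean ap am)

/-- The weight function `w^T(y) = G(y + ia) G(-y + ia) = 4 sinh(πy/a₊) sinh(πy/a₋)`. -/
def todaW (ap am y : ℝ) : ℂ :=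
  hypGamma ap am (y + Complex.I * mean ap am) * hypGamma ap am (-y + Complex.I * mean ap am)

/-- The branch `u^T(η; y)^(1/2) = w^T(y)^(1/2) c^T(η; y)` of the square root of `u^T`, for real
`y ≠ 0`, with the positive square root of `w^T(y) > 0`. -/
def todaUSqrt (ap am η y : ℝ) : ℂ :=
  todaW ap am y ^ (1 / 2 : ℂ) * todaC ap am η y

end RelToda

end

/-! Write g for `gLog`, and let χ be the constant in g(z) ~ -χ - αz²/4 as Re z → ∞. The normalized
function Φ(z) = G(z) exp(i(χ + αz²/4)), which is `gPhi`, tends to 1 exponentially fast at the right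
end of the strip |Im z| < a. Since g is odd, |Φ(z)| is comparable to exp(α|Re z| Im z) at the left
end. On a line Im z = s < 0 the function Φ is thus a smoothed step from 0 to 1.

Insert this normalization into the integral for the conical function at b = a - iγ. The Gaussian
factors of the four gamma functions collapse to a plane wave, all occurrences of χ cancel, and F
becomes (`conicalF_eq`) a product of explicit factors with ∫ Φ((x-γ)/2+s) Φ((x-γ)/2-s)
Ψ((x+γ)/2-s-y) Ψ((x+γ)/2+s+y) e^{iαsy} ds, where Φ is taken on Im z = -a/2 and Ψ = 1/Φ on Im z =
a/2. In the Toda limit X = x - γ = x - η is fixed and x + γ → ∞, so both Ψ tend to 1. Dominated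
convergence leaves ∫ Φ(X/2+s) Φ(X/2-s) e^{iαsy} ds (`todaInt`). One of the two arguments is X/2 -
|s|, so the integrand is O(exp(αa(X/2 - |s|)/2)). This is both the domination and the bound for x →
-∞.

For x → ∞, integrate by parts in s. The derivative Φ' is a bump, so each of the two resulting terms
is a plane wave exp(∓iαXy/2) times an integral that converges to the Fourier transform of Φ' at ±y
(`IsPhase.todaInt_eq`, `IsPhase.tendsto_lineConv`). The whole asymptotics therefore rests on
`IsPhase.ftInt_mul_ftMul`: this Fourier transform is again a hyperbolic gamma function, up to
elementary factors.

To prove that, note that Φ(z + ia₊)/Φ(z) is 1 plus an exponential in z. Fourier transformation turns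
this into a first-order difference equation in y with step ia₊. The function `ftMul` satisfies the
reciprocal equation, so the product of the two is ia₊-periodic. It grows more slowly than exp(2π|Re
y|/a₊), hence is constant by `eq_const_of_periodic_strip`, and at y = 0 it equals ∫ Φ' = 1.

The facts about G that feed this come from its defining integral: the difference equation
(`gExp_diff`), the asymptotics (`exists_isPhase`), and the compatibility of the steps ia₊ and ia₋
with the special value it yields (`sinh_mul_gExp`, `gExp_special`). -/

namespace RelToda

/-! ### Holomorphic parameter integrals and contour shifts. -/

/-- Local domination, uniform in the parameter, of a family of functions on the line. -/
def DominatedOn (μ : Measure ℝ) (U : Set ℂ) (F : ℂ → ℝ → ℂ) : Prop :=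
  ∀ z₀ ∈ U, ∃ r > 0, Metric.ball z₀ r ⊆ U ∧
    ∃ b : ℝ → ℝ, Integrable b μ ∧ ∀ᵐ t ∂μ, ∀ z ∈ Metric.ball z₀ r, ‖F z t‖ ≤ b t

lemma DominatedOn.integrable {μ : Measure ℝ} {U : Set ℂ} {F : ℂ → ℝ → ℂ} (h : DominatedOn μ U F)
    (hm : ∀ z ∈ U, AEStronglyMeasurable (F z) μ) {z : ℂ} (hz : z ∈ U) : Integrable (F z) μ := by
  obtain ⟨r, hr, -, b, hb, hbd⟩ := h z hz
  exact hb.mono' (hm z hz) (hbd.mono fun t ht => ht z (Metric.mem_ball_self hr))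

/-- Cauchy's estimate on circles of radius r/4 around points of the half ball costs only the
constant factor 4/r. Hence only the original integrand needs an explicit bound; all its parameter
derivatives inherit one. -/
lemma DominatedOn.deriv {μ : Measure ℝ} {U : Set ℂ} {F F' : ℂ → ℝ → ℂ} (h : DominatedOn μ U F)
    (hd : ∀ᵐ t ∂μ, ∀ z ∈ U, HasDerivAt (F · t) (F' z t) z) : DominatedOn μ U F' := by
  intro z₀ hz₀
  obtain ⟨r, hr, hU, b, hb, hbd⟩ := h z₀ hz₀
  refine ⟨r / 2, by positivity, (Metric.ball_subset_ball (by linarith)).trans hU,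
    fun t => b t / (r / 4), hb.div_const _, ?_⟩
  filter_upwards [hd, hbd] with t ht hbt z hz
  have hsub : Metric.closedBall z (r / 4) ⊆ Metric.ball z₀ r := by
    intro w hw
    rw [Metric.mem_ball] at hz ⊢
    rw [Metric.mem_closedBall] at hw
    linarith [dist_triangle w z z₀]
  have hzU : z ∈ U := hU (hsub (Metric.mem_closedBall_self (by positivity)))
  rw [← (ht z hzU).deriv]
  refine Complex.norm_deriv_le_of_forall_mem_sphere_norm_le (by positivity) ?_ ?_
  · refine DifferentiableOn.diffContOnCl fun w hw => ?_
    exact (ht w (hU (hsub (Metric.closure_ball_subset_closedBall hw)))).differentiableAt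
      |>.differentiableWithinAt
  · intro w hw
    exact hbt w (hsub (Metric.sphere_subset_closedBall hw))

lemma DominatedOn.hasDerivAt {μ : Measure ℝ} {U : Set ℂ} {F F' : ℂ → ℝ → ℂ}
    (h : DominatedOn μ U F) (hm : ∀ z ∈ U, AEStronglyMeasurable (F z) μ)
    (hm' : ∀ z ∈ U, AEStronglyMeasurable (F' z) μ)
    (hd : ∀ᵐ t ∂μ, ∀ z ∈ U, HasDerivAt (F · t) (F' z t) z) {z : ℂ} (hz : z ∈ U) :
    HasDerivAt (fun w => ∫ t, F w t ∂μ) (∫ t, F' z t ∂μ) z := by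
  obtain ⟨r, hr, hU, b, hb, hbd⟩ := h.deriv hd z hz
  refine (hasDerivAt_integral_of_dominated_loc_of_deriv_le (Metric.ball_mem_nhds z hr) ?_
    (h.integrable hm hz) (hm' z hz) hbd hb ?_).2
  · filter_upwards [Metric.ball_mem_nhds z hr] with w hw using hm w (hU hw)
  · exact hd.mono fun t ht w hw => ht w (hU hw)

open Complex in
/-- Shifting a horizontal contour of integration. -/
lemma integral_horizontal_shift {f : ℂ → ℂ} {s₁ s₂ : ℝ} {b : ℝ → ℝ}
    (hd : DifferentiableOn ℂ f (Complex.im ⁻¹' Set.uIcc s₁ s₂))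
    (hb : ∀ x : ℝ, ∀ s ∈ Set.uIcc s₁ s₂, ‖f (x + s * I)‖ ≤ b x)
    (htop : Tendsto b atTop (𝓝 0)) (hbot : Tendsto b atBot (𝓝 0))
    (h₁ : Integrable fun x : ℝ => f (x + s₁ * I)) (h₂ : Integrable fun x : ℝ => f (x + s₂ * I)) :
    ∫ x : ℝ, f (x + s₁ * I) = ∫ x : ℝ, f (x + s₂ * I) := by
  have key : ∀ N : ℝ, (∫ x in (-N)..N, f (x + s₁ * I)) - (∫ x in (-N)..N, f (x + s₂ * I)) =
      I • (∫ s in s₁..s₂, f (((-N : ℝ) : ℂ) + s * I)) - I • ∫ s in s₁..s₂, f ((N : ℂ) + s * I) := by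
    intro N
    have := integral_boundary_rect_eq_zero_of_differentiableOn f ((-N : ℝ) + s₁ * I)
      ((N : ℝ) + s₂ * I) (hd.mono fun z hz => by
        have := hz.2
        simpa using this)
    simp only [add_re, ofReal_re, mul_re, I_re, mul_zero, ofReal_im, I_im, mul_one, sub_self,
      add_zero, add_im, mul_im, zero_add] at this
    linear_combination this
  have vert : ∀ {N : ℝ → ℝ} {l : Filter ℝ}, Tendsto (fun x => b (N x)) l (𝓝 0) →
      Tendsto (fun x => ∫ s in s₁..s₂, f ((N x : ℂ) + s * I)) l (𝓝 0) := by
    intro N l hl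
    refine squeeze_zero_norm (a := fun x => b (N x) * |s₂ - s₁|) (fun x => ?_) ?_
    · exact intervalIntegral.norm_integral_le_of_norm_le_const fun s hs =>
        hb _ s (Set.uIoc_subset_uIcc hs)
    · simpa using hl.mul_const _
  have l1 := (intervalIntegral_tendsto_integral h₁ tendsto_neg_atTop_atBot tendsto_id).sub
    (intervalIntegral_tendsto_integral h₂ tendsto_neg_atTop_atBot tendsto_id)
  have l2 := ((vert (N := fun N => -N) (hbot.comp tendsto_neg_atTop_atBot)).const_smul I).sub
    ((vert (N := fun N => N) htop).const_smul I)
  have l3 := l1.congr key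
  have := tendsto_nhds_unique l3 l2
  simpa [sub_eq_zero] using this

/-! ### The entire function sinh z / z: zeros and bounds. -/

/-- The entire function `sinh z / z`. -/
noncomputable def sinhc : ℂ → ℂ := dslope Complex.sinh 0

lemma sinhc_zero : sinhc 0 = 1 := by
  simp [sinhc, dslope_same]

lemma sinhc_of_ne {z : ℂ} (hz : z ≠ 0) : sinhc z = Complex.sinh z / z := by
  rw [sinhc, dslope_of_ne _ hz, slope_def_field]; simp

lemma mul_sinhc (z : ℂ) : z * sinhc z = Complex.sinh z := by
  by_cases hz : z = 0
  · simp [hz]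
  · rw [sinhc_of_ne hz]; field_simp

lemma differentiable_sinhc : Differentiable ℂ sinhc := by
  have := (Complex.differentiableOn_dslope (f := Complex.sinh) (s := Set.univ) (c := 0)
    Filter.univ_mem).2 Complex.differentiable_sinh.differentiableOn
  exact differentiableOn_univ.1 this

lemma sinh_ne_zero_of_im {z : ℂ} (hz : z ≠ 0) (him : |z.im| < Real.pi) : Complex.sinh z ≠ 0 := by
  intro h
  have h1 : Complex.sin (z * Complex.I) = 0 := by rw [Complex.sin_mul_I, h, zero_mul]
  obtain ⟨k, hk⟩ := Complex.sin_eq_zero_iff.1 h1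
  have him' := congrArg Complex.re hk
  have hre := congrArg Complex.im hk
  simp at him' hre
  have hk0 : k = 0 := by
    by_contra hne
    have h2 : (1 : ℝ) ≤ |(k : ℝ)| := by exact_mod_cast Int.one_le_abs hne
    have h3 : |z.im| = |(k : ℝ)| * Real.pi := by
      rw [← abs_neg, him', abs_mul, abs_of_pos Real.pi_pos]
    nlinarith [Real.pi_pos]
  apply hz
  rw [hk0] at him'
  apply Complex.ext
  · simpa using hre
  · simp at him'; simpa using him'

lemma sinhc_ne_zero {z : ℂ} (him : |z.im| < Real.pi) : sinhc z ≠ 0 := by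
  by_cases hz : z = 0
  · simp [hz, sinhc_zero]
  · rw [sinhc_of_ne hz]
    exact div_ne_zero (sinh_ne_zero_of_im hz him) hz

lemma normSq_sinh (z : ℂ) : ‖Complex.sinh z‖ ^ 2 = Real.sinh z.re ^ 2 + Real.sin z.im ^ 2 := by
  have h : Complex.sinh z = ((Real.sinh z.re * Real.cos z.im : ℝ) : ℂ) +
      ((Real.cosh z.re * Real.sin z.im : ℝ) : ℂ) * Complex.I := by
    conv_lhs => rw [← Complex.re_add_im z, Complex.sinh_add, Complex.sinh_mul_I, Complex.cosh_mul_I]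
    push_cast; ring
  rw [h, ← Complex.normSq_eq_norm_sq, Complex.normSq_add_mul_I]
  have h1 := Real.cosh_sq z.re
  have h2 := Real.sin_sq_add_cos_sq z.im
  nlinarith [h1, h2]

lemma sinh_abs_le_norm_sinh (z : ℂ) : Real.sinh |z.re| ≤ ‖Complex.sinh z‖ := by
  refine abs_le_of_sq_le_sq' ?_ (norm_nonneg _) |>.2
  rw [normSq_sinh, ← Real.abs_sinh, sq_abs]
  nlinarith [sq_nonneg (Real.sin z.im)]

lemma norm_sinh_le (z : ℂ) : ‖Complex.sinh z‖ ≤ Real.exp |z.re| := by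
  rw [Complex.sinh]
  have h1 : ‖Complex.exp z‖ ≤ Real.exp |z.re| := by
    rw [Complex.norm_exp]; exact Real.exp_le_exp.2 (le_abs_self _)
  have h2 : ‖Complex.exp (-z)‖ ≤ Real.exp |z.re| := by
    rw [Complex.norm_exp]; exact Real.exp_le_exp.2 (by simpa using neg_le_abs z.re)
  rw [norm_div]
  have := norm_sub_le (Complex.exp z) (Complex.exp (-z))
  simp only [Complex.norm_ofNat]
  linarith

lemma exists_norm_sinhc_le : ∃ C > 0, ∀ z : ℂ, ‖sinhc z‖ ≤ C * Real.exp |z.re| := by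
  obtain ⟨C, hC⟩ := (isCompact_closedBall (0 : ℂ) 1).exists_bound_of_continuousOn
    differentiable_sinhc.continuous.continuousOn
  refine ⟨max C 1, by positivity, fun z => ?_⟩
  have h1 : (1 : ℝ) ≤ Real.exp |z.re| := Real.one_le_exp (abs_nonneg _)
  by_cases hz : ‖z‖ ≤ 1
  · have := hC z (by simpa using hz)
    calc ‖sinhc z‖ ≤ C := this
      _ ≤ max C 1 * 1 := by simp
      _ ≤ _ := by gcongr
  · push Not at hz
    have hz0 : z ≠ 0 := by rintro rfl; simp at hz; linarith
    rw [sinhc_of_ne hz0, norm_div, div_le_iff₀ (by linarith)]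
    calc ‖Complex.sinh z‖ ≤ 1 * Real.exp |z.re| * 1 := by simpa using norm_sinh_le z
      _ ≤ max C 1 * Real.exp |z.re| * ‖z‖ := by gcongr; exact le_max_right _ _

/-- Exponential decay of `z / sinh z` in a horizontal strip. -/
lemma exists_norm_inv_sinhc_le {θ : ℝ} (hθ : θ < 1) :
    ∃ C > 0, ∀ z : ℂ, |z.im| ≤ Real.pi / 2 → ‖(sinhc z)⁻¹‖ ≤ C * Real.exp (-θ * |z.re|) := by
  have hK : IsCompact (Set.Icc (-1 : ℝ) 1 ×ℂ Set.Icc (-(Real.pi / 2)) (Real.pi / 2)) :=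
    isCompact_Icc.reProdIm isCompact_Icc
  obtain ⟨C, hC⟩ := hK.exists_bound_of_continuousOn (f := fun z => (sinhc z)⁻¹)
    (differentiable_sinhc.continuous.continuousOn.inv₀ fun z hz => sinhc_ne_zero (by
      have := abs_le.2 (Set.mem_Icc.1 hz.2)
      linarith [Real.pi_pos]))
  have hδ : 0 < 1 - θ := by linarith
  -- The numerator of z / sinh z is linear in Re z; the margin 1 - θ in the exponent absorbs it.
  obtain ⟨M, hM⟩ : ∃ M > 0, ∀ x : ℝ, 0 ≤ x → x + 2 ≤ M * Real.exp ((1 - θ) * x) := by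
    refine ⟨2 + 1 / (1 - θ), by positivity, fun x hx => ?_⟩
    have h1 := Real.add_one_le_exp ((1 - θ) * x)
    have h2 : (1 : ℝ) ≤ Real.exp ((1 - θ) * x) := Real.one_le_exp (by positivity)
    have h3 : x ≤ 1 / (1 - θ) * Real.exp ((1 - θ) * x) := by
      rw [one_div, inv_mul_eq_div, le_div_iff₀ hδ]; nlinarith
    nlinarith
  refine ⟨max (C * Real.exp |θ|) (4 * M), lt_max_of_lt_right (by linarith [hM.1]), fun z hz => ?_⟩
  by_cases hre : |z.re| ≤ 1
  · have h1 := hC z ⟨by simpa [abs_le] using hre, by simpa [abs_le] using hz⟩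
    have hC0 : 0 ≤ C := (norm_nonneg _).trans h1
    have h2 : 1 ≤ Real.exp |θ| * Real.exp (-θ * |z.re|) := by
      rw [← Real.exp_add]
      apply Real.one_le_exp
      have : θ * |z.re| ≤ |θ| * 1 :=
        mul_le_mul (le_abs_self _) hre (abs_nonneg _) (abs_nonneg _)
      linarith
    calc ‖(sinhc z)⁻¹‖ ≤ C * 1 := by simpa using h1
      _ ≤ C * (Real.exp |θ| * Real.exp (-θ * |z.re|)) := by gcongr
      _ = C * Real.exp |θ| * Real.exp (-θ * |z.re|) := by ring
      _ ≤ _ := by gcongr; exact le_max_left _ _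
  · push Not at hre
    have hz0 : z ≠ 0 := by rintro rfl; simp at hre; linarith
    have hs : Real.exp |z.re| / 4 ≤ ‖Complex.sinh z‖ := by
      refine le_trans ?_ (sinh_abs_le_norm_sinh z)
      rw [Real.sinh_eq]
      have h1 : Real.exp (-|z.re|) ≤ 1 := Real.exp_le_one_iff.2 (by simp)
      have h2 := Real.add_one_le_exp |z.re|
      linarith
    have hn : ‖z‖ ≤ |z.re| + 2 := by
      have := Complex.norm_le_abs_re_add_abs_im z
      have := Real.pi_lt_four
      linarith
    rw [sinhc_of_ne hz0, inv_div, norm_div, div_le_iff₀ (lt_of_lt_of_le (by positivity) hs)]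
    have h4 := hM.2 |z.re| (abs_nonneg _)
    calc ‖z‖ ≤ M * Real.exp ((1 - θ) * |z.re|) := hn.trans h4
      _ = 4 * M * Real.exp (-θ * |z.re|) * (Real.exp |z.re| / 4) := by
        rw [show (1 - θ) * |z.re| = -θ * |z.re| + |z.re| by ring, Real.exp_add]; ring
      _ ≤ _ := by
        have := hM.1
        gcongr
        exact le_max_right _ _


/-! ### A Liouville theorem for periodic functions on a strip. -/

-- In Cauchy's theorem on the rectangle between abscissas x₁ and x₂, the two horizontal sides cancel
-- by periodicity.
open Complex in
lemma integral_vertical_eq_of_periodic {h : ℂ → ℂ} {c p : ℝ} (hp : 0 < p)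
    (hd : DifferentiableOn ℂ h (Complex.im ⁻¹' Set.Icc c (c + p)))
    (hper : ∀ x : ℝ, h (x + (c + p : ℝ) * I) = h (x + c * I)) (x₁ x₂ : ℝ) :
    ∫ s in c..c + p, h (x₁ + s * I) = ∫ s in c..c + p, h (x₂ + s * I) := by
  have := integral_boundary_rect_eq_zero_of_differentiableOn h ((x₁ : ℝ) + c * I)
    ((x₂ : ℝ) + (c + p : ℝ) * I) (hd.mono fun z hz => by
      have := hz.2
      rw [Set.uIcc_of_le (by simp [hp.le])] at this
      simpa using this)
  simp only [add_re, ofReal_re, mul_re, I_re, mul_zero, ofReal_im, I_im, mul_one, sub_self,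
    add_zero, add_im, mul_im, zero_add, hper, smul_eq_mul] at this
  have h2 : I * ((∫ s in c..c + p, h (x₂ + s * I)) - ∫ s in c..c + p, h (x₁ + s * I)) = 0 := by
    linear_combination this
  have := (mul_eq_zero.1 h2).resolve_left I_ne_zero
  exact (sub_eq_zero.1 this).symm

/-- The difference cosh w ∓ sinh w is an exponential of modulus exactly e^{-|Re w|}, and |sinh w| ≥
e^{|Re w|}/4 here. The doubled rate in the bound is what allows growth up to 2π/p in
`eq_const_of_periodic_strip`. -/
lemma norm_coth_sub_sign_le {w : ℂ} (hw : 1 ≤ |w.re|) :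
    ‖Complex.cosh w / Complex.sinh w - (SignType.sign w.re : ℂ)‖ ≤
      4 * Real.exp (-(2 * |w.re|)) := by
  have hs : Real.exp |w.re| / 4 ≤ ‖Complex.sinh w‖ := by
    refine le_trans ?_ (sinh_abs_le_norm_sinh w)
    rw [Real.sinh_eq]
    have h1 : Real.exp (-|w.re|) ≤ 1 := Real.exp_le_one_iff.2 (by simp)
    have h2 := Real.add_one_le_exp |w.re|
    linarith
  have hs0 : 0 < ‖Complex.sinh w‖ := lt_of_lt_of_le (by positivity) hs
  have hne : Complex.sinh w ≠ 0 := norm_pos_iff.1 hs0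
  have key : ‖Complex.cosh w - (SignType.sign w.re : ℂ) * Complex.sinh w‖ =
      Real.exp (-|w.re|) := by
    rcases lt_or_gt_of_ne (a := w.re) (b := 0) (by rintro h; simp [h] at hw; linarith) with h | h
    · rw [sign_neg h, abs_of_neg h]
      simp only [SignType.coe_neg, SignType.coe_one, neg_mul, one_mul,
        sub_neg_eq_add, Complex.cosh_add_sinh, neg_neg, Complex.norm_exp]
    · rw [sign_pos h, abs_of_pos h]
      simp only [SignType.coe_one, one_mul, Complex.cosh_sub_sinh, Complex.norm_exp,
        Complex.neg_re]
  rw [div_sub' hne, norm_div, mul_comm (Complex.sinh w), key, div_le_iff₀ hs0]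
  calc Real.exp (-|w.re|) = 4 * Real.exp (-(2 * |w.re|)) * (Real.exp |w.re| / 4) := by
        rw [show -|w.re| = -(2 * |w.re|) + |w.re| by ring, Real.exp_add]; ring
    _ ≤ _ := by gcongr

open Complex in
/-- A holomorphic function on a strip with matching values on two parallel lines and moderate
growth is constant. -/
theorem eq_const_of_periodic_strip {f : ℂ → ℂ} {c p θ C : ℝ} (hp : 0 < p) (hθ0 : 0 ≤ θ)
    (hθ : θ < 2 * Real.pi / p) {U : Set ℂ} (hU : IsOpen U)
    (hsub : Complex.im ⁻¹' Set.Icc c (c + p) ⊆ U) (hd : DifferentiableOn ℂ f U)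
    (hper : ∀ x : ℝ, f (x + (c + p : ℝ) * I) = f (x + c * I))
    (hgrow : ∀ z : ℂ, c ≤ z.im → z.im ≤ c + p → ‖f z‖ ≤ C * Real.exp (θ * |z.re|)) :
    ∃ L, ∀ z : ℂ, c < z.im → z.im < c + p → f z = L := by
  -- The constant is the mean of f over any vertical segment crossing the strip.
  refine ⟨(∫ s in c..c + p, f ((0 : ℝ) + s * I)) / p, fun y₀ hy₁ hy₂ => ?_⟩
  set κ : ℝ := Real.pi / p with hκ
  have hκ0 : 0 < κ := div_pos Real.pi_pos hp
  have hκp : κ * p = Real.pi := by rw [hκ]; field_simp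
  have hC : 0 ≤ C := by
    have := (norm_nonneg _).trans (hgrow y₀ hy₁.le hy₂.le)
    exact nonneg_of_mul_nonneg_left this (Real.exp_pos _)
  -- B is (f - f(y₀)) coth(κ(y - y₀)) with the singularity at y₀ removed. With κ = π/p the
  -- hyperbolic cotangent has period ip, so B is holomorphic and periodic like f. The integrals W of
  -- B and V of f over vertical segments do not depend on the abscissa. Since coth → ±1, letting the
  -- abscissa tend to ±∞ gives W = ±(V - p f(y₀)), and therefore p f(y₀) = V.
  set B : ℂ → ℂ := fun y =>
    dslope f y₀ y * cosh (κ * (y - y₀)) * (sinhc (κ * (y - y₀)))⁻¹ / κ with hB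
  have hBne : ∀ y, y ≠ y₀ →
      B y = (f y - f y₀) * (cosh (κ * (y - y₀)) / sinh (κ * (y - y₀))) := by
    intro y hy
    have h1 : y - y₀ ≠ 0 := sub_ne_zero.2 hy
    have h2 : (κ : ℂ) ≠ 0 := by exact_mod_cast hκ0.ne'
    simp only [hB]
    rw [dslope_of_ne _ hy, slope_def_field, sinhc_of_ne (mul_ne_zero h2 h1), inv_div]
    field_simp
  have hBd : DifferentiableOn ℂ B (Complex.im ⁻¹' Set.Icc c (c + p)) := by
    have h0 : U ∈ 𝓝 y₀ := hU.mem_nhds (hsub ⟨hy₁.le, hy₂.le⟩)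
    have h1 : DifferentiableOn ℂ (dslope f y₀) (Complex.im ⁻¹' Set.Icc c (c + p)) :=
      ((Complex.differentiableOn_dslope h0).2 hd).mono hsub
    have h2 : Differentiable ℂ fun y : ℂ => sinhc (κ * (y - y₀)) :=
      differentiable_sinhc.comp (by fun_prop)
    refine ((h1.mul (Differentiable.differentiableOn (by fun_prop))).mul
      (h2.differentiableOn.inv fun z hz => sinhc_ne_zero ?_)).div_const _
    have hz' := Set.mem_Icc.1 hz
    rw [← hκp]
    simp only [im_ofReal_mul, sub_im, abs_mul, abs_of_pos hκ0]
    refine mul_lt_mul_of_pos_left ?_ hκ0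
    rw [abs_lt]; constructor <;> linarith [hz'.1, hz'.2]
  have hBper : ∀ x : ℝ, B (x + (c + p : ℝ) * I) = B (x + c * I) := by
    intro x
    rw [hBne, hBne, hper]
    · have : (κ : ℂ) * (x + (c + p : ℝ) * I - y₀) = κ * (x + c * I - y₀) + Real.pi * I := by
        rw [← hκp]; push_cast; ring
      rw [this, cosh_add, sinh_add, cosh_mul_I, sinh_mul_I]
      simp [neg_div_neg_eq]
    · intro h; rw [← h] at hy₁; simp at hy₁
    · intro h; rw [← h] at hy₂; simp at hy₂
  set V := ∫ s in c..c + p, f ((0 : ℝ) + s * I)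
  set W := ∫ s in c..c + p, B ((0 : ℝ) + s * I)
  have hline : ∀ (x : ℝ), Set.MapsTo (fun s : ℝ => (x : ℂ) + s * I) (Set.uIcc c (c + p))
      (Complex.im ⁻¹' Set.Icc c (c + p)) := by
    intro x s hs
    rw [Set.uIcc_of_le (by linarith)] at hs
    simpa using hs
  have hlinec : ∀ x : ℝ, Continuous fun s : ℝ => (x : ℂ) + s * I := by intro x; fun_prop
  set K : ℝ := 8 * C * Real.exp ((θ + 2 * κ) * |y₀.re|) with hK
  have bound : ∀ x : ℝ, 1 ≤ κ * |x - y₀.re| → ∀ s ∈ Set.uIcc c (c + p),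
      ‖B (x + s * I) - (SignType.sign (x - y₀.re) : ℂ) * (f (x + s * I) - f y₀)‖ ≤
        K * Real.exp (-(2 * κ - θ) * |x|) := by
    intro x hx s hs
    have hw : |((κ : ℂ) * (x + s * I - y₀)).re| = κ * |x - y₀.re| := by
      simp [abs_mul, abs_of_pos hκ0]
    have hsg : SignType.sign ((κ : ℂ) * (x + s * I - y₀)).re = SignType.sign (x - y₀.re) := by
      have : ((κ : ℂ) * (x + s * I - y₀)).re = κ * (x - y₀.re) := by simp
      rw [this, sign_mul, sign_pos hκ0, one_mul]
    have hne : (x : ℂ) + s * I ≠ y₀ := by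
      rintro h; rw [← h] at hx; simp at hx; linarith
    have h1 := norm_coth_sub_sign_le (w := (κ : ℂ) * (x + s * I - y₀)) (by rw [hw]; exact hx)
    rw [hw, hsg] at h1
    rw [Set.uIcc_of_le (by linarith)] at hs
    have h2 := hgrow (x + s * I) (by simpa using hs.1) (by simpa using hs.2)
    have h3 := hgrow y₀ hy₁.le hy₂.le
    simp only [add_re, ofReal_re, mul_re, I_re, mul_zero, ofReal_im, I_im, mul_one, sub_self,
      add_zero] at h2
    have e1 : Real.exp (θ * |x|) ≤ Real.exp (θ * |x|) * Real.exp (θ * |y₀.re|) :=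
      le_mul_of_one_le_right (Real.exp_pos _).le (Real.one_le_exp (by positivity))
    have e2 : Real.exp (θ * |y₀.re|) ≤ Real.exp (θ * |x|) * Real.exp (θ * |y₀.re|) :=
      le_mul_of_one_le_left (Real.exp_pos _).le (Real.one_le_exp (by positivity))
    have h4 : ‖f (x + s * I) - f y₀‖ ≤
        2 * C * (Real.exp (θ * |x|) * Real.exp (θ * |y₀.re|)) := by
      refine (norm_sub_le _ _).trans ?_
      nlinarith [mul_le_mul_of_nonneg_left e1 hC, mul_le_mul_of_nonneg_left e2 hC]
    have h5 : |x| - |y₀.re| ≤ |x - y₀.re| := abs_sub_abs_le_abs_sub _ _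
    rw [hBne _ hne, mul_comm (SignType.sign _ : ℂ), ← mul_sub, norm_mul]
    calc _ ≤ 2 * C * (Real.exp (θ * |x|) * Real.exp (θ * |y₀.re|)) *
          (4 * Real.exp (-(2 * (κ * |x - y₀.re|)))) := by gcongr
      _ ≤ 2 * C * (Real.exp (θ * |x|) * Real.exp (θ * |y₀.re|)) *
          (4 * Real.exp (-(2 * (κ * (|x| - |y₀.re|))))) := by gcongr
      _ = K * Real.exp (-(2 * κ - θ) * |x|) := by
        rw [hK, show 2 * C * (Real.exp (θ * |x|) * Real.exp (θ * |y₀.re|)) *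
          (4 * Real.exp (-(2 * (κ * (|x| - |y₀.re|))))) = 8 * C * (Real.exp (θ * |x|) *
          Real.exp (θ * |y₀.re|) * Real.exp (-(2 * (κ * (|x| - |y₀.re|))))) by ring,
          mul_assoc (8 * C), ← Real.exp_add, ← Real.exp_add, ← Real.exp_add]
        ring_nf
  have hfint : ∀ x : ℝ, IntervalIntegrable (fun s : ℝ => f (x + s * I)) volume c (c + p) :=
    fun x => (((hd.mono hsub).continuousOn.comp (hlinec x).continuousOn
      (hline x))).intervalIntegrable
  have hBint : ∀ x : ℝ, IntervalIntegrable (fun s : ℝ => B (x + s * I)) volume c (c + p) :=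
    fun x => ((hBd.continuousOn.comp (hlinec x).continuousOn (hline x))).intervalIntegrable
  have est : ∀ x : ℝ, 1 ≤ κ * |x - y₀.re| →
      ‖W - (SignType.sign (x - y₀.re) : ℂ) * (V - p * f y₀)‖ ≤
        K * Real.exp (-(2 * κ - θ) * |x|) * p := by
    intro x hx
    have h1 := intervalIntegral.norm_integral_le_of_norm_le_const (a := c) (b := c + p)
      fun s hs => bound x hx s (Set.uIoc_subset_uIcc hs)
    rw [intervalIntegral.integral_sub (hBint x) (((hfint x).sub (by simp)).const_mul _),
      intervalIntegral.integral_const_mul, intervalIntegral.integral_sub (hfint x) (by simp),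
      integral_vertical_eq_of_periodic hp hBd hBper x 0,
      integral_vertical_eq_of_periodic hp (hd.mono hsub) hper x 0] at h1
    rwa [add_sub_cancel_left, abs_of_pos hp, show ∫ _ in c..c + p, f y₀ = p * f y₀ by simp] at h1
  -- Here 2κ = 2π/p, so the growth condition θ < 2π/p is exactly what makes the error vanish.
  have lim0 : Tendsto (fun x : ℝ => K * Real.exp (-(2 * κ - θ) * x) * p) atTop (𝓝 0) := by
    have hpos : 0 < 2 * κ - θ := by
      have : 2 * Real.pi / p = 2 * κ := by rw [hκ]; ring
      linarith
    have : Tendsto (fun x : ℝ => Real.exp (-(2 * κ - θ) * x)) atTop (𝓝 0) :=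
      Real.tendsto_exp_atBot.comp (tendsto_id.const_mul_atTop_of_neg (by linarith))
    simpa using (this.const_mul K).mul_const p
  have hlarge : ∀ᶠ x : ℝ in atTop, 0 < x ∧ |y₀.re| + 1 / κ ≤ x :=
    (eventually_gt_atTop 0).and (eventually_ge_atTop _)
  have e1 : W - (V - p * f y₀) = 0 := by
    rw [← norm_le_zero_iff]
    refine ge_of_tendsto lim0 ?_
    filter_upwards [hlarge] with x hx
    have h1 := le_abs_self y₀.re
    have hk : 0 < 1 / κ := by positivity
    have h2 : 0 < x - y₀.re := by linarith [hx.2]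
    have h3 := est x (by
      rw [abs_of_pos h2, ← div_le_iff₀' hκ0]; linarith [hx.2])
    rw [sign_pos h2, abs_of_pos hx.1] at h3
    simpa using h3
  have e2 : W + (V - p * f y₀) = 0 := by
    rw [← norm_le_zero_iff]
    refine ge_of_tendsto lim0 ?_
    filter_upwards [hlarge] with x hx
    have h1 := neg_abs_le y₀.re
    have hk : 0 < 1 / κ := by positivity
    have h2 : -x - y₀.re < 0 := by linarith [hx.2]
    have h3 := est (-x) (by
      rw [abs_of_neg h2, ← div_le_iff₀' hκ0]; linarith [hx.2])
    rw [sign_neg h2, abs_neg, abs_of_pos hx.1] at h3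
    simpa only [SignType.coe_neg, SignType.coe_one, neg_mul, one_mul, sub_neg_eq_add] using h3
  have hp' : (p : ℂ) ≠ 0 := by exact_mod_cast hp.ne'
  rw [eq_div_iff hp']
  linear_combination (e1 - e2) / 2

/-! ### Limits of primitives on a half strip. -/

open Complex in
/-- A primitive of an exponentially decaying function on a half strip has a limit, approached
exponentially fast. -/
lemma exists_limit_of_deriv_decay {f f' : ℂ → ℂ} {A r : ℝ} (hA : 0 < A) (hr : 0 < r)
    (hd : ∀ z : ℂ, |z.im| < A → HasDerivAt f (f' z) z)
    (hb : ∀ B < A, ∃ C, ∀ z : ℂ, 0 ≤ z.re → |z.im| ≤ B → ‖f' z‖ ≤ C * Real.exp (-r * z.re)) :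
    ∃ L, ∀ B < A, ∃ C, ∀ z : ℂ, 0 ≤ z.re → |z.im| ≤ B →
      ‖f z - L‖ ≤ C * Real.exp (-r * z.re) := by
  have hc : ContinuousOn f' {z | |z.im| < A} := by
    have ho : IsOpen {z : ℂ | |z.im| < A} :=
      isOpen_lt (continuous_abs.comp Complex.continuous_im) continuous_const
    have h1 : DifferentiableOn ℂ f {z : ℂ | |z.im| < A} := fun z hz =>
      (hd z hz).differentiableAt.differentiableWithinAt
    exact (h1.deriv ho).continuousOn.congr fun z hz => (hd z hz).deriv.symm
  have hline : ∀ z : ℂ, |z.im| < A → ∀ s : ℝ,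
      HasDerivAt (fun s : ℝ => f (z + s)) (f' (z + s)) s := by
    intro z hz s
    have := (hd (z + s) (by simpa using hz)).comp_const_add z (s : ℂ) |>.comp_ofReal
    simpa using this
  have hint : ∀ z : ℂ, 0 ≤ z.re → |z.im| < A →
      IntegrableOn (fun s : ℝ => f' (z + s)) (Set.Ioi 0) := by
    intro z hz0 hz
    obtain ⟨C, hC⟩ := hb |z.im| hz
    refine Integrable.mono' (g := fun s => C * Real.exp (-r * z.re) * Real.exp (-r * s))
      ((integrableOn_exp_mul_Ioi (by linarith) 0).const_mul _) ?_ ?_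
    · refine (ContinuousOn.comp_continuous hc (by fun_prop) fun s => ?_).aestronglyMeasurable
      simpa using hz
    · refine (ae_restrict_iff' measurableSet_Ioi).2 (ae_of_all _ fun s hs => ?_)
      have h1 := hC (z + s) (by simpa using add_nonneg hz0 (le_of_lt hs)) (by simp)
      refine h1.trans_eq ?_
      rw [mul_assoc, ← Real.exp_add, Complex.add_re, Complex.ofReal_re]
      ring_nf
  have hlim : ∀ z : ℂ, 0 ≤ z.re → |z.im| < A →
      ∃ L, Tendsto (fun s : ℝ => f (z + s)) atTop (𝓝 L) := fun z hz0 hz =>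
    ⟨_, tendsto_limUnder_of_hasDerivAt_of_integrableOn_Ioi (fun s _ => hline z hz s)
      (hint z hz0 hz)⟩
  have hest : ∀ z : ℂ, 0 ≤ z.re → |z.im| < A → ∀ L,
      Tendsto (fun s : ℝ => f (z + s)) atTop (𝓝 L) → ∀ C,
      (∀ w : ℂ, 0 ≤ w.re → |w.im| ≤ |z.im| → ‖f' w‖ ≤ C * Real.exp (-r * w.re)) →
      ‖f z - L‖ ≤ C / r * Real.exp (-r * z.re) := by
    intro z hz0 hz L hL C hC
    have h1 := integral_Ioi_of_hasDerivAt_of_tendsto' (fun s _ => hline z hz s)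
      (hint z hz0 hz) hL
    simp only [ofReal_zero, add_zero] at h1
    rw [norm_sub_rev, ← h1]
    have h2 : ∫ s in Set.Ioi (0 : ℝ), C * Real.exp (-r * z.re) * Real.exp (-r * s) =
        C / r * Real.exp (-r * z.re) := by
      rw [integral_const_mul, integral_exp_mul_Ioi (by linarith)]
      simp; field_simp
    rw [← h2]
    refine norm_integral_le_of_norm_le
      ((integrableOn_exp_mul_Ioi (by linarith) 0).const_mul _) ?_
    refine (ae_restrict_iff' measurableSet_Ioi).2 (ae_of_all _ fun s hs => ?_)
    have h1 := hC (z + s) (by simpa using add_nonneg hz0 (le_of_lt hs)) (by simp)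
    refine h1.trans_eq ?_
    rw [mul_assoc, ← Real.exp_add, Complex.add_re, Complex.ofReal_re]
    ring_nf
  obtain ⟨L, hL⟩ := hlim 0 (by simp) (by simpa using hA)
  have hexp : Tendsto (fun s : ℝ => Real.exp (-r * s)) atTop (𝓝 0) :=
    Real.tendsto_exp_atBot.comp (tendsto_id.const_mul_atTop_of_neg (by linarith))
  refine ⟨L, fun B hB => ?_⟩
  obtain ⟨C, hC⟩ := hb B hB
  refine ⟨C / r, fun z hz0 hz => ?_⟩
  have hzA : |z.im| < A := by linarith
  refine hest z hz0 hzA L ?_ C fun w hw hw' => hC w hw (hw'.trans hz)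
  obtain ⟨L', hL'⟩ := hlim z hz0 hzA
  -- The limits along two horizontal rays agree: the derivative tends to 0 uniformly on the vertical
  -- segments joining the rays, which have fixed length.
  suffices h : L' = L by rwa [h] at hL'
  have hL2 : Tendsto (fun s : ℝ => f (z.re + s : ℝ)) atTop (𝓝 L) := by
    have := hL.comp (tendsto_atTop_add_const_left atTop z.re tendsto_id)
    simpa [Function.comp_def] using this
  have hdiff : Tendsto (fun s : ℝ => f (z + s) - f (z.re + s : ℝ)) atTop (𝓝 0) := by
    refine squeeze_zero_norm' (a := fun s => C * Real.exp (-r * s) * |z.im|) ?_ ?_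
    · filter_upwards [eventually_ge_atTop 0] with s hs
      have hconv : Convex ℝ {w : ℂ | w.re = z.re + s ∧ |w.im| ≤ |z.im|} := by
        have h1 : Convex ℝ {w : ℂ | w.re = z.re + s} :=
          (convex_singleton (z.re + s)).linear_preimage Complex.reLm
        have h2 : Convex ℝ {w : ℂ | |w.im| ≤ |z.im|} := by
          have e : {w : ℂ | |w.im| ≤ |z.im|} = Complex.imLm ⁻¹' Set.Icc (-|z.im|) |z.im| := by
            apply Set.ext; intro v
            change |v.im| ≤ |z.im| ↔ -|z.im| ≤ v.im ∧ v.im ≤ |z.im|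
            exact abs_le
          rw [e]
          exact (convex_Icc (-|z.im|) (|z.im|)).linear_preimage Complex.imLm
        exact h1.inter h2
      have := hconv.norm_image_sub_le_of_norm_hasDerivWithin_le (f := f) (f' := f')
        (C := C * Real.exp (-r * s)) (x := ((z.re + s : ℝ) : ℂ)) (y := z + s)
        (fun w hw => (hd w (hw.2.trans_lt hzA)).hasDerivWithinAt) (fun w hw => by
          have hC0 : 0 ≤ C := by
            have := (norm_nonneg _).trans (hC z hz0 hz)
            exact nonneg_of_mul_nonneg_left this (Real.exp_pos _)
          refine (hC w (by rw [hw.1]; positivity) (hw.2.trans hz)).trans ?_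
          rw [hw.1]
          gcongr C * Real.exp ?_
          nlinarith) (by simp) (by simp)
      refine this.trans_eq ?_
      congr 1
      have : z + s - ((z.re + s : ℝ) : ℂ) = (z.im : ℂ) * I := by
        apply Complex.ext <;> simp
      rw [this]; simp
    · simpa using (hexp.const_mul C).mul_const |z.im|
  have := hL'.sub hL2
  exact sub_eq_zero.1 (tendsto_nhds_unique this hdiff)


/-! ### The integral defining g: domination, derivatives, symmetries. -/

/-- The integrand of `gLog`. -/
noncomputable def gKer (ap am : ℝ) (z : ℂ) (t : ℝ) : ℂ :=
  (Complex.sin (2 * t * z) / (2 * Complex.sinh (ap * t) * Complex.sinh (am * t))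
      - z / (ap * am * t)) / t

/-- `gKer₁`, `gKer₂` and `gKer₃` are the first three z-derivatives of `gKer` for t > 0. -/
noncomputable def gKer₁ (ap am : ℝ) (z : ℂ) (t : ℝ) : ℂ :=
  Complex.cos (2 * t * z) / (Complex.sinh (ap * t) * Complex.sinh (am * t)) - 1 / (ap * am * t ^ 2)

noncomputable def gKer₂ (ap am : ℝ) (z : ℂ) (t : ℝ) : ℂ :=
  -(2 * t * Complex.sin (2 * t * z)) / (Complex.sinh (ap * t) * Complex.sinh (am * t))

noncomputable def gKer₃ (ap am : ℝ) (z : ℂ) (t : ℝ) : ℂ :=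
  -(4 * t ^ 2 * Complex.cos (2 * t * z)) / (Complex.sinh (ap * t) * Complex.sinh (am * t))

/-- The strip `|Im z| < a`. -/
def strip (ap am : ℝ) : Set ℂ := {z | |z.im| < mean ap am}

lemma norm_sin_le (w : ℂ) : ‖Complex.sin w‖ ≤ Real.exp |w.im| := by
  have := norm_sinh_le (w * Complex.I)
  rw [Complex.sinh_mul_I] at this
  simpa using this

/-- The quadratic Taylor terms of the two exponentials in sin w cancel, which makes the error cubic.
The third power is needed against a denominator of order t³ in `dominatedOn_gKer`. -/
lemma norm_sin_sub_self_le (w : ℂ) : ‖Complex.sin w - w‖ ≤ ‖w‖ ^ 3 * Real.exp ‖w‖ := by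
  have h1 := Complex.norm_exp_sub_sum_le_norm_mul_exp (-w * Complex.I) 3
  have h2 := Complex.norm_exp_sub_sum_le_norm_mul_exp (w * Complex.I) 3
  have e : Complex.sin w - w = ((Complex.exp (-w * Complex.I) -
      ∑ m ∈ Finset.range 3, (-w * Complex.I) ^ m / (m.factorial : ℂ)) -
      (Complex.exp (w * Complex.I) -
      ∑ m ∈ Finset.range 3, (w * Complex.I) ^ m / (m.factorial : ℂ))) * Complex.I / 2 := by
    rw [Complex.sin]
    simp only [Finset.sum_range_succ, Finset.sum_range_zero, Nat.factorial]
    push_cast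
    linear_combination (-w) * Complex.I_sq
  have h3 := norm_sub_le (Complex.exp (-w * Complex.I) -
      ∑ m ∈ Finset.range 3, (-w * Complex.I) ^ m / (m.factorial : ℂ))
      (Complex.exp (w * Complex.I) - ∑ m ∈ Finset.range 3, (w * Complex.I) ^ m / (m.factorial : ℂ))
  rw [e, norm_div, norm_mul]
  simp only [norm_mul, norm_neg, Complex.norm_I, mul_one, Complex.norm_ofNat] at *
  linarith

lemma sinh_le_mul_cosh {x : ℝ} (hx : 0 ≤ x) : Real.sinh x ≤ x * Real.cosh x := by
  have hd : ∀ y : ℝ, HasDerivAt (fun y => y * Real.cosh y - Real.sinh y) (y * Real.sinh y) y := by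
    intro y
    have := ((hasDerivAt_id y).mul (Real.hasDerivAt_cosh y)).sub (Real.hasDerivAt_sinh y)
    refine this.congr_deriv ?_
    simp
  have hm : MonotoneOn (fun y => y * Real.cosh y - Real.sinh y) (Set.Ici 0) := by
    refine monotoneOn_of_deriv_nonneg (convex_Ici 0) (by fun_prop) (by fun_prop) fun y hy => ?_
    rw [interior_Ici] at hy
    rw [(hd y).deriv]
    exact mul_nonneg (le_of_lt hy) (Real.sinh_nonneg_iff.2 (le_of_lt hy))
  have := hm (Set.self_mem_Ici) hx hx
  simpa using this

lemma sinh_lower {x c : ℝ} (hc : c ≤ x) :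
    Real.exp x * ((1 - Real.exp (-(2 * c))) / 2) ≤ Real.sinh x := by
  rw [Real.sinh_eq]
  have h : Real.exp (-x) = Real.exp x * Real.exp (-(2 * x)) := by rw [← Real.exp_add]; ring_nf
  have h2 : Real.exp (-(2 * x)) ≤ Real.exp (-(2 * c)) := Real.exp_le_exp.2 (by linarith)
  rw [h]
  nlinarith [Real.exp_pos x]

section
variable {ap am : ℝ}

lemma mean_pos (hap : 0 < ap) (ham : 0 < am) : 0 < mean ap am := by
  unfold mean; positivity

lemma alpha_pos (hap : 0 < ap) (ham : 0 < am) : 0 < alpha ap am := by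
  unfold alpha; positivity

lemma isOpen_strip : IsOpen (strip ap am) :=
  isOpen_lt (continuous_abs.comp Complex.continuous_im) continuous_const

/-- The chain x ≤ sinh x ≤ x cosh x ≤ x e^{x²/2} traps the product of the two hyperbolic sines
between a₊a₋t² and a₊a₋t² e^{(a₊²+a₋²)t²/2}. Together with e^{-u} ≥ 1 - u, this shows that the
double poles at t = 0 cancel up to a bounded error. -/
lemma inv_sub_inv_sinh_mul_sinh (hap : 0 < ap) (ham : 0 < am) {t : ℝ} (ht : 0 < t) :
    |1 / (Real.sinh (ap * t) * Real.sinh (am * t)) - 1 / (ap * am * t ^ 2)| ≤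
      (ap ^ 2 + am ^ 2) / (2 * (ap * am)) := by
  have hpt : 0 < ap * t := by positivity
  have hmt : 0 < am * t := by positivity
  have h1 : ap * t ≤ Real.sinh (ap * t) := Real.self_le_sinh_iff.2 hpt.le
  have h2 : am * t ≤ Real.sinh (am * t) := Real.self_le_sinh_iff.2 hmt.le
  have h3 := (sinh_le_mul_cosh hpt.le).trans
    (mul_le_mul_of_nonneg_left (Real.cosh_le_exp_half_sq _) hpt.le)
  have h4 := (sinh_le_mul_cosh hmt.le).trans
    (mul_le_mul_of_nonneg_left (Real.cosh_le_exp_half_sq _) hmt.le)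
  set D := Real.sinh (ap * t) * Real.sinh (am * t) with hD
  have hE : 0 < ap * am * t ^ 2 := by positivity
  have hlow : ap * am * t ^ 2 ≤ D := by
    calc ap * am * t ^ 2 = (ap * t) * (am * t) := by ring
      _ ≤ D := by rw [hD]; gcongr
  have hup : D ≤ ap * am * t ^ 2 * Real.exp ((ap ^ 2 + am ^ 2) / 2 * t ^ 2) := by
    calc D ≤ (ap * t * Real.exp ((ap * t) ^ 2 / 2)) * (am * t * Real.exp ((am * t) ^ 2 / 2)) := by
          rw [hD]; gcongr
      _ = ap * am * t ^ 2 * (Real.exp ((ap * t) ^ 2 / 2) * Real.exp ((am * t) ^ 2 / 2)) := by ring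
      _ = _ := by rw [← Real.exp_add]; ring_nf
  have hD0 : 0 < D := by linarith
  rw [abs_sub_comm, abs_of_nonneg (sub_nonneg.2 (one_div_le_one_div_of_le hE hlow))]
  have h5 : Real.exp (-((ap ^ 2 + am ^ 2) / 2 * t ^ 2)) / (ap * am * t ^ 2) ≤ 1 / D := by
    rw [div_le_div_iff₀ hE hD0, Real.exp_neg, one_mul, inv_mul_le_iff₀ (Real.exp_pos _)]
    linarith
  have h6 := Real.add_one_le_exp (-((ap ^ 2 + am ^ 2) / 2 * t ^ 2))
  have h7 : (1 - (ap ^ 2 + am ^ 2) / 2 * t ^ 2) / (ap * am * t ^ 2) ≤ 1 / D :=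
    le_trans (div_le_div_of_nonneg_right (by linarith) hE.le) h5
  have h8 : 1 / (ap * am * t ^ 2) - (1 - (ap ^ 2 + am ^ 2) / 2 * t ^ 2) / (ap * am * t ^ 2) =
      (ap ^ 2 + am ^ 2) / (2 * (ap * am)) := by
    field_simp; ring
  linarith

lemma ofReal_sinh_mul_sinh (t : ℝ) : Complex.sinh (ap * t) * Complex.sinh (am * t) =
    ((Real.sinh (ap * t) * Real.sinh (am * t) : ℝ) : ℂ) := by push_cast; rfl

-- For t ≤ 1 the two singular terms cancel and the kernel is bounded. For t > 1 the denominator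
-- grows like e^{2at} and beats |sin 2tz| ≤ e^{2t|Im z|} by the distance of z to the boundary of the
-- strip, while the counterterm is O(1/t²).
set_option maxHeartbeats 800000 in
lemma dominatedOn_gKer (hap : 0 < ap) (ham : 0 < am) :
    DominatedOn (volume.restrict (Set.Ioi 0)) (strip ap am) (gKer ap am) := by
  intro z₀ hz₀
  have hz₀' : |z₀.im| < mean ap am := hz₀
  set r := (mean ap am - |z₀.im|) / 2 with hr
  set M := ‖z₀‖ + r with hM
  have hr0 : 0 < r := by rw [hr]; linarith
  have hM0 : 0 < M := by positivity
  have hball : ∀ z ∈ Metric.ball z₀ r, |z.im| ≤ mean ap am - r ∧ ‖z‖ ≤ M := by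
    intro z hz
    rw [Metric.mem_ball, dist_eq_norm] at hz
    have h1 := Complex.abs_im_le_norm (z - z₀)
    have h2 : |z.im| ≤ |z₀.im| + |(z - z₀).im| := by
      have := abs_add_le z₀.im (z - z₀).im
      simpa using this
    have h3 : ‖z‖ ≤ ‖z₀‖ + ‖z - z₀‖ := by
      have := norm_add_le z₀ (z - z₀)
      simpa using this
    constructor
    · linarith
    · linarith
  have hsub : Metric.ball z₀ r ⊆ strip ap am := fun z hz => by
    have := (hball z hz).1
    change |z.im| < _
    linarith
  set cp := (1 - Real.exp (-(2 * ap))) / 2 with hcp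
  set cm := (1 - Real.exp (-(2 * am))) / 2 with hcm
  have hcp0 : 0 < cp := by
    have : Real.exp (-(2 * ap)) < 1 := Real.exp_zero ▸ Real.exp_lt_exp.2 (by linarith)
    rw [hcp]; linarith
  have hcm0 : 0 < cm := by
    have : Real.exp (-(2 * am)) < 1 := Real.exp_zero ▸ Real.exp_lt_exp.2 (by linarith)
    rw [hcm]; linarith
  -- The three summands bound, in order, the Taylor remainder of the sine, the deviation of 1/(sinh
  -- sinh) from 1/(a₊a₋t²), and the coefficient of the counterterm for t > 1.
  set C₁ := 4 * M ^ 3 * Real.exp (2 * M) / (ap * am) +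
    M * ((ap ^ 2 + am ^ 2) / (2 * (ap * am))) + M / (ap * am) with hC₁
  have hC₁0 : 0 ≤ C₁ := by positivity
  refine ⟨r, hr0, hsub, fun t => 1 / (2 * (cp * cm)) * Real.exp (-(2 * r) * t) +
    2 * C₁ * (1 + t ^ 2)⁻¹, ?_, ?_⟩
  · exact ((integrableOn_exp_mul_Ioi (by linarith) 0).const_mul _).add
      (integrable_inv_one_add_sq.integrableOn.const_mul _)
  refine (ae_restrict_iff' measurableSet_Ioi).2 (ae_of_all _ fun t ht z hz => ?_)
  have ht0 : 0 < t := ht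
  obtain ⟨hzim, hzn⟩ := hball z hz
  have hpt : 0 < ap * t := by positivity
  have hmt : 0 < am * t := by positivity
  set D := Real.sinh (ap * t) * Real.sinh (am * t) with hD
  have hlow : ap * am * t ^ 2 ≤ D := by
    calc ap * am * t ^ 2 = (ap * t) * (am * t) := by ring
      _ ≤ D := by
        rw [hD]
        exact mul_le_mul (Real.self_le_sinh_iff.2 hpt.le) (Real.self_le_sinh_iff.2 hmt.le) hmt.le
          (Real.sinh_nonneg_iff.2 hpt.le)
  have hE : 0 < ap * am * t ^ 2 := by positivity
  have hD0 : 0 < D := hE.trans_le hlow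
  have htc : (t : ℂ) ≠ 0 := by exact_mod_cast ht0.ne'
  have hDc : (D : ℂ) ≠ 0 := by exact_mod_cast hD0.ne'
  have hpc : (ap : ℂ) ≠ 0 := by exact_mod_cast hap.ne'
  have hmc : (am : ℂ) ≠ 0 := by exact_mod_cast ham.ne'
  have hker : gKer ap am z t = (Complex.sin (2 * t * z) / (2 * D) - z / (ap * am * t)) / t := by
    rw [gKer, mul_assoc 2 (Complex.sinh _), ofReal_sinh_mul_sinh]
  rcases le_or_gt t 1 with ht1 | ht1
  · have e : gKer ap am z t = (Complex.sin (2 * t * z) - 2 * t * z) / ((2 * t * D : ℝ) : ℂ) +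
        z * ((1 / D - 1 / (ap * am * t ^ 2) : ℝ) : ℂ) := by
      rw [hker]; push_cast; field_simp; ring
    have h1 : ‖(2 * t * z : ℂ)‖ ≤ 2 * t * M := by
      rw [norm_mul, norm_mul]
      simp only [Complex.norm_ofNat, Complex.norm_real, Real.norm_of_nonneg ht0.le]
      gcongr
    have h2 : ‖(Complex.sin (2 * t * z) - 2 * t * z) / ((2 * t * D : ℝ) : ℂ)‖ ≤
        4 * M ^ 3 * Real.exp (2 * M) / (ap * am) := by
      rw [norm_div, Complex.norm_real, Real.norm_of_nonneg (by positivity),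
        div_le_div_iff₀ (by positivity) (by positivity)]
      calc _ ≤ (‖(2 * t * z : ℂ)‖ ^ 3 * Real.exp ‖(2 * t * z : ℂ)‖) * (ap * am) := by
            gcongr; exact norm_sin_sub_self_le _
        _ ≤ ((2 * t * M) ^ 3 * Real.exp (2 * 1 * M)) * (ap * am) := by
            gcongr
            exact h1.trans (by gcongr)
        _ = 4 * M ^ 3 * Real.exp (2 * M) * (2 * t * (ap * am * t ^ 2)) := by ring_nf
        _ ≤ _ := by gcongr
    have h3 : ‖z * ((1 / D - 1 / (ap * am * t ^ 2) : ℝ) : ℂ)‖ ≤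
        M * ((ap ^ 2 + am ^ 2) / (2 * (ap * am))) := by
      rw [norm_mul, Complex.norm_real]
      exact mul_le_mul hzn (inv_sub_inv_sinh_mul_sinh hap ham ht0) (norm_nonneg _) hM0.le
    have h4 : ‖gKer ap am z t‖ ≤ C₁ := by
      rw [e]
      refine (norm_add_le _ _).trans ?_
      have : 0 ≤ M / (ap * am) := by positivity
      rw [hC₁]; linarith
    have h5 : (1 : ℝ) / 2 ≤ (1 + t ^ 2)⁻¹ := by
      rw [one_div]; apply inv_anti₀ (by positivity); nlinarith
    have h6 : 0 ≤ 1 / (2 * (cp * cm)) * Real.exp (-(2 * r) * t) := by positivity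
    calc ‖gKer ap am z t‖ ≤ 2 * C₁ * (1 / 2) := by linarith
      _ ≤ 2 * C₁ * (1 + t ^ 2)⁻¹ := by gcongr
      _ ≤ _ := by linarith
  · have h1 : ‖Complex.sin (2 * t * z)‖ ≤ Real.exp (2 * t * (mean ap am - r)) := by
      refine (norm_sin_le _).trans (Real.exp_le_exp.2 ?_)
      have : (2 * t * z : ℂ).im = 2 * t * z.im := by
        have : (2 * t * z : ℂ) = ((2 * t : ℝ) : ℂ) * z := by push_cast; ring
        rw [this, Complex.im_ofReal_mul]
      rw [this, abs_mul, abs_of_pos (by positivity)]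
      gcongr
    have h2 : Real.exp (2 * mean ap am * t) * (cp * cm) ≤ D := by
      calc Real.exp (2 * mean ap am * t) * (cp * cm)
          = (Real.exp (ap * t) * cp) * (Real.exp (am * t) * cm) := by
            rw [show 2 * mean ap am * t = ap * t + am * t by rw [mean]; ring, Real.exp_add]; ring
        _ ≤ D := by
          rw [hD]
          exact mul_le_mul (sinh_lower (le_mul_of_one_le_right hap.le ht1.le))
            (sinh_lower (le_mul_of_one_le_right ham.le ht1.le)) (by positivity)
            (Real.sinh_nonneg_iff.2 hpt.le)
    have e : gKer ap am z t = Complex.sin (2 * t * z) / ((2 * D * t : ℝ) : ℂ) -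
        z / ((ap * am * t ^ 2 : ℝ) : ℂ) := by
      rw [hker]; push_cast; field_simp
    have h3 : ‖Complex.sin (2 * t * z) / ((2 * D * t : ℝ) : ℂ)‖ ≤
        1 / (2 * (cp * cm)) * Real.exp (-(2 * r) * t) := by
      rw [norm_div, Complex.norm_real, Real.norm_of_nonneg (by positivity), div_le_iff₀
        (by positivity)]
      refine h1.trans ?_
      calc Real.exp (2 * t * (mean ap am - r))
          = 1 / (2 * (cp * cm)) * Real.exp (-(2 * r) * t) *
            (2 * (Real.exp (2 * mean ap am * t) * (cp * cm)) * 1) := by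
            rw [show 2 * t * (mean ap am - r) = -(2 * r) * t + 2 * mean ap am * t by ring,
              Real.exp_add]
            field_simp
        _ ≤ _ := by gcongr
    have h4 : ‖z / ((ap * am * t ^ 2 : ℝ) : ℂ)‖ ≤ 2 * C₁ * (1 + t ^ 2)⁻¹ := by
      rw [norm_div, Complex.norm_real, Real.norm_of_nonneg hE.le]
      have h5 : (t ^ 2)⁻¹ ≤ 2 * (1 + t ^ 2)⁻¹ := by
        rw [← div_eq_mul_inv, inv_eq_one_div, div_le_div_iff₀ (by positivity) (by positivity)]
        nlinarith
      have h6 : M / (ap * am) ≤ C₁ := by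
        rw [hC₁]
        have : 0 ≤ 4 * M ^ 3 * Real.exp (2 * M) / (ap * am) +
          M * ((ap ^ 2 + am ^ 2) / (2 * (ap * am))) := by positivity
        linarith
      calc ‖z‖ / (ap * am * t ^ 2) ≤ M / (ap * am * t ^ 2) := by gcongr
        _ = M / (ap * am) * (t ^ 2)⁻¹ := by field_simp
        _ ≤ C₁ * (2 * (1 + t ^ 2)⁻¹) := by gcongr
        _ = _ := by ring
    rw [e]
    exact (norm_sub_le _ _).trans (add_le_add h3 h4)

lemma measurable_gKer (z : ℂ) : Measurable (gKer ap am z) := by unfold gKer; fun_prop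
lemma measurable_gKer₁ (z : ℂ) : Measurable (gKer₁ ap am z) := by unfold gKer₁; fun_prop
lemma measurable_gKer₂ (z : ℂ) : Measurable (gKer₂ ap am z) := by unfold gKer₂; fun_prop
lemma measurable_gKer₃ (z : ℂ) : Measurable (gKer₃ ap am z) := by unfold gKer₃; fun_prop

lemma sinh_ofReal_mul_ne_zero {c t : ℝ} (hc : 0 < c) (ht : 0 < t) :
    Complex.sinh (c * t) ≠ 0 := by
  rw [← Complex.ofReal_mul, ← Complex.ofReal_sinh]
  exact_mod_cast (Real.sinh_pos_iff.2 (mul_pos hc ht)).ne'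

lemma hasDerivAt_sin_mul (t : ℝ) (z : ℂ) :
    HasDerivAt (fun w : ℂ => Complex.sin (2 * t * w)) (2 * t * Complex.cos (2 * t * z)) z := by
  have := ((hasDerivAt_id z).const_mul (2 * t : ℂ)).csin
  simpa [mul_comm] using this

lemma hasDerivAt_cos_mul (t : ℝ) (z : ℂ) :
    HasDerivAt (fun w : ℂ => Complex.cos (2 * t * w)) (-(2 * t * Complex.sin (2 * t * z))) z := by
  have := ((hasDerivAt_id z).const_mul (2 * t : ℂ)).ccos
  simpa [mul_comm] using this

lemma hasDerivAt_gKer (hap : 0 < ap) (ham : 0 < am) {t : ℝ} (ht : 0 < t) (z : ℂ) :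
    HasDerivAt (fun w => gKer ap am w t) (gKer₁ ap am z t) z := by
  have h1 := sinh_ofReal_mul_ne_zero hap ht
  have h2 := sinh_ofReal_mul_ne_zero ham ht
  have h3 : (t : ℂ) ≠ 0 := by exact_mod_cast ht.ne'
  have h4 : (ap : ℂ) ≠ 0 := by exact_mod_cast hap.ne'
  have h5 : (am : ℂ) ≠ 0 := by exact_mod_cast ham.ne'
  have := (((hasDerivAt_sin_mul t z).div_const
    (2 * Complex.sinh (ap * t) * Complex.sinh (am * t))).sub
      ((hasDerivAt_id z).div_const (ap * am * t : ℂ))).div_const (t : ℂ)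
  refine this.congr_deriv ?_
  rw [gKer₁]; field_simp

lemma hasDerivAt_gKer₁ (t : ℝ) (z : ℂ) :
    HasDerivAt (fun w => gKer₁ ap am w t) (gKer₂ ap am z t) z := by
  have := ((hasDerivAt_cos_mul t z).div_const
    (Complex.sinh (ap * t) * Complex.sinh (am * t))).sub_const (1 / (ap * am * t ^ 2) : ℂ)
  exact this

lemma hasDerivAt_gKer₂ (t : ℝ) (z : ℂ) :
    HasDerivAt (fun w => gKer₂ ap am w t) (gKer₃ ap am z t) z := by
  have := (((hasDerivAt_sin_mul t z).const_mul (2 * t : ℂ)).neg.div_const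
    (Complex.sinh (ap * t) * Complex.sinh (am * t)))
  refine this.congr_deriv ?_
  rw [gKer₃]; ring

lemma ae_hasDerivAt_gKer (hap : 0 < ap) (ham : 0 < am) :
    ∀ᵐ t ∂(volume.restrict (Set.Ioi (0 : ℝ))), ∀ z ∈ strip ap am,
      HasDerivAt (fun w => gKer ap am w t) (gKer₁ ap am z t) z :=
  (ae_restrict_iff' measurableSet_Ioi).2 (ae_of_all _ fun _ ht z _ => hasDerivAt_gKer hap ham ht z)

lemma dominatedOn_gKer₁ (hap : 0 < ap) (ham : 0 < am) :
    DominatedOn (volume.restrict (Set.Ioi 0)) (strip ap am) (gKer₁ ap am) :=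
  (dominatedOn_gKer hap ham).deriv (ae_hasDerivAt_gKer hap ham)

lemma dominatedOn_gKer₂ (hap : 0 < ap) (ham : 0 < am) :
    DominatedOn (volume.restrict (Set.Ioi 0)) (strip ap am) (gKer₂ ap am) :=
  (dominatedOn_gKer₁ hap ham).deriv (ae_of_all _ fun t z _ => hasDerivAt_gKer₁ t z)

noncomputable def gLog₁ (ap am : ℝ) (z : ℂ) : ℂ := ∫ t in Set.Ioi (0 : ℝ), gKer₁ ap am z t
noncomputable def gLog₂ (ap am : ℝ) (z : ℂ) : ℂ := ∫ t in Set.Ioi (0 : ℝ), gKer₂ ap am z t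
noncomputable def gLog₃ (ap am : ℝ) (z : ℂ) : ℂ := ∫ t in Set.Ioi (0 : ℝ), gKer₃ ap am z t

lemma gLog_eq (z : ℂ) : gLog ap am z = ∫ t in Set.Ioi (0 : ℝ), gKer ap am z t := rfl

lemma hasDerivAt_gLog (hap : 0 < ap) (ham : 0 < am) {z : ℂ} (hz : z ∈ strip ap am) :
    HasDerivAt (gLog ap am) (gLog₁ ap am z) z :=
  (dominatedOn_gKer hap ham).hasDerivAt (fun z _ => (measurable_gKer z).aestronglyMeasurable)
    (fun z _ => (measurable_gKer₁ z).aestronglyMeasurable) (ae_hasDerivAt_gKer hap ham) hz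

lemma hasDerivAt_gLog₁ (hap : 0 < ap) (ham : 0 < am) {z : ℂ} (hz : z ∈ strip ap am) :
    HasDerivAt (gLog₁ ap am) (gLog₂ ap am z) z :=
  (dominatedOn_gKer₁ hap ham).hasDerivAt (fun z _ => (measurable_gKer₁ z).aestronglyMeasurable)
    (fun z _ => (measurable_gKer₂ z).aestronglyMeasurable)
    (ae_of_all _ fun t z _ => hasDerivAt_gKer₁ t z) hz

lemma hasDerivAt_gLog₂ (hap : 0 < ap) (ham : 0 < am) {z : ℂ} (hz : z ∈ strip ap am) :
    HasDerivAt (gLog₂ ap am) (gLog₃ ap am z) z :=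
  (dominatedOn_gKer₂ hap ham).hasDerivAt (fun z _ => (measurable_gKer₂ z).aestronglyMeasurable)
    (fun z _ => (measurable_gKer₃ z).aestronglyMeasurable)
    (ae_of_all _ fun t z _ => hasDerivAt_gKer₂ t z) hz

lemma differentiableOn_gLog (hap : 0 < ap) (ham : 0 < am) :
    DifferentiableOn ℂ (gLog ap am) (strip ap am) := fun _ hz =>
  (hasDerivAt_gLog hap ham hz).differentiableAt.differentiableWithinAt

lemma integrable_gKer (hap : 0 < ap) (ham : 0 < am) {z : ℂ} (hz : z ∈ strip ap am) :
    IntegrableOn (gKer ap am z) (Set.Ioi 0) :=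
  (dominatedOn_gKer hap ham).integrable (fun z _ => (measurable_gKer z).aestronglyMeasurable) hz

lemma integrable_gKer₁ (hap : 0 < ap) (ham : 0 < am) {z : ℂ} (hz : z ∈ strip ap am) :
    IntegrableOn (gKer₁ ap am z) (Set.Ioi 0) :=
  (dominatedOn_gKer₁ hap ham).integrable (fun z _ => (measurable_gKer₁ z).aestronglyMeasurable) hz

lemma gLog_neg (z : ℂ) : gLog ap am (-z) = -gLog ap am z := by
  rw [gLog, gLog, ← integral_neg]
  congr 1; ext t
  rw [mul_neg, Complex.sin_neg]; ring

lemma gLog_comm (ap am : ℝ) (z : ℂ) : gLog ap am z = gLog am ap z := by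
  rw [gLog, gLog]
  congr 1; ext t
  ring_nf

lemma gLog_ofReal (x : ℝ) : ∃ r : ℝ, gLog ap am x = r := by
  refine ⟨∫ t in Set.Ioi (0 : ℝ), (Real.sin (2 * t * x) / (2 * Real.sinh (ap * t) *
    Real.sinh (am * t)) - x / (ap * am * t)) / t, ?_⟩
  rw [← integral_complex_ofReal, gLog]
  congr 1; ext t
  push_cast; rfl

/-- On the imaginary axis the sine becomes i times a hyperbolic sine. Hence G = e^{ig} is positive
there, which fixes the sign of a square root in `gExp_special`. -/
lemma gLog_I_mul (x : ℝ) : ∃ r : ℝ, gLog ap am (Complex.I * x) = Complex.I * r := by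
  refine ⟨∫ t in Set.Ioi (0 : ℝ), (Real.sinh (2 * t * x) / (2 * Real.sinh (ap * t) *
    Real.sinh (am * t)) - x / (ap * am * t)) / t, ?_⟩
  rw [← integral_complex_ofReal, gLog, ← integral_const_mul]
  congr 1; ext t
  rw [show 2 * (t : ℂ) * (Complex.I * x) = (2 * t * x) * Complex.I by ring, Complex.sin_mul_I]
  push_cast; ring

end


/-! ### The difference equation of the hyperbolic gamma function. -/

/-- The hyperbolic gamma function on the strip. -/
noncomputable def gExp (ap am : ℝ) (z : ℂ) : ℂ := Complex.exp (Complex.I * gLog ap am z)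

/-- The integrand of an integral representation of `log (2 cosh (π z / c))`. -/
noncomputable def lcKer (c : ℝ) (z : ℂ) (t : ℝ) : ℂ :=
  (1 / (c * t) - Complex.cos (2 * t * z) / Complex.sinh (c * t)) / t

noncomputable def lcInt (c : ℝ) (z : ℂ) : ℂ := ∫ t in Set.Ioi (0 : ℝ), lcKer c z t

lemma convex_abs_im_lt (c : ℝ) : Convex ℝ {z : ℂ | |z.im| < c} := by
  have e : {w : ℂ | |w.im| < c} = Complex.imLm ⁻¹' Set.Ioo (-c) c := by
    apply Set.ext; intro v
    change |v.im| < c ↔ -c < v.im ∧ v.im < c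
    exact abs_lt
  rw [e]
  exact (convex_Ioo (-c) c).linear_preimage Complex.imLm

section
variable {ap am : ℝ}

lemma add_mem_strip {z : ℂ} (hap : 0 < ap) (hz : |z.im| < am / 2) :
    z + Complex.I * (ap / 2) ∈ strip ap am := by
  change |(z + Complex.I * (ap / 2)).im| < mean ap am
  have e : (z + Complex.I * (ap / 2)).im = z.im + ap / 2 := by
    rw [show (ap / 2 : ℂ) = ((ap / 2 : ℝ) : ℂ) by push_cast; rfl]; simp
  rw [e, mean, abs_lt]
  rw [abs_lt] at hz
  constructor <;> linarith [hz.1, hz.2]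

lemma sub_mem_strip {z : ℂ} (hap : 0 < ap) (hz : |z.im| < am / 2) :
    z - Complex.I * (ap / 2) ∈ strip ap am := by
  change |(z - Complex.I * (ap / 2)).im| < mean ap am
  have e : (z - Complex.I * (ap / 2)).im = z.im - ap / 2 := by
    rw [show (ap / 2 : ℂ) = ((ap / 2 : ℝ) : ℂ) by push_cast; rfl]; simp
  rw [e, mean, abs_lt]
  rw [abs_lt] at hz
  constructor <;> linarith [hz.1, hz.2]

/-- The two values of sin(2tz ± ia₊t) differ by 2i cos(2tz) sinh(a₊t), which cancels one hyperbolic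
sine in the denominator, so only a₋ survives. -/
lemma gKer_diff (hap : 0 < ap) (ham : 0 < am) {t : ℝ} (ht : 0 < t) (z : ℂ) :
    Complex.I * (gKer ap am (z + Complex.I * (ap / 2)) t - gKer ap am (z - Complex.I * (ap / 2)) t)
      = lcKer am z t := by
  have h1 := sinh_ofReal_mul_ne_zero hap ht
  have h2 := sinh_ofReal_mul_ne_zero ham ht
  have h3 : (t : ℂ) ≠ 0 := by exact_mod_cast ht.ne'
  have h4 : (ap : ℂ) ≠ 0 := by exact_mod_cast hap.ne'
  have h5 : (am : ℂ) ≠ 0 := by exact_mod_cast ham.ne'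
  have e1 : 2 * (t : ℂ) * (z + Complex.I * (ap / 2)) = 2 * t * z + ap * t * Complex.I := by ring
  have e2 : 2 * (t : ℂ) * (z - Complex.I * (ap / 2)) = 2 * t * z - ap * t * Complex.I := by ring
  rw [gKer, gKer, lcKer, e1, e2, Complex.sin_add, Complex.sin_sub, Complex.sin_mul_I]
  generalize Complex.sinh (ap * t) = s₁ at *
  generalize Complex.sinh (am * t) = s₂ at *
  field_simp
  ring_nf
  rw [Complex.I_sq]
  ring

/-- Taking both parameters equal to c presents `lcInt c` as a difference of values of `gLog c c`.
Integrability and differentiation under the integral sign then come for free. -/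
lemma gKer₁_diff {c : ℝ} (hc : 0 < c) {t : ℝ} (ht : 0 < t) (z : ℂ) :
    Complex.I * (gKer₁ c c (z + Complex.I * (c / 2)) t - gKer₁ c c (z - Complex.I * (c / 2)) t)
      = 2 * Complex.sin (2 * t * z) / Complex.sinh (c * t) := by
  have h1 := sinh_ofReal_mul_ne_zero hc ht
  have e1 : 2 * (t : ℂ) * (z + Complex.I * (c / 2)) = 2 * t * z + c * t * Complex.I := by ring
  have e2 : 2 * (t : ℂ) * (z - Complex.I * (c / 2)) = 2 * t * z - c * t * Complex.I := by ring
  rw [gKer₁, gKer₁, e1, e2, Complex.cos_add, Complex.cos_sub, Complex.sin_mul_I]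
  rw [sub_sub_sub_cancel_right, ← sub_div, mul_div_assoc', div_eq_div_iff (mul_ne_zero h1 h1) h1]
  linear_combination (-2 * Complex.sin (2 * t * z) * Complex.sinh (c * t) ^ 2) * Complex.I_sq

lemma I_mul_gLog_diff (hap : 0 < ap) (ham : 0 < am) {z : ℂ} (hz : |z.im| < am / 2) :
    Complex.I * (gLog ap am (z + Complex.I * (ap / 2)) - gLog ap am (z - Complex.I * (ap / 2)))
      = lcInt am z := by
  rw [gLog_eq, gLog_eq, ← integral_sub (integrable_gKer hap ham (add_mem_strip hap hz))
    (integrable_gKer hap ham (sub_mem_strip hap hz)), ← integral_const_mul, lcInt]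
  exact setIntegral_congr_fun measurableSet_Ioi fun t ht => gKer_diff hap ham ht z

lemma integrable_sin_div_sinh {c : ℝ} (hc : 0 < c) {z : ℂ} (hz : |z.im| < c / 2) :
    IntegrableOn (fun t : ℝ => 2 * Complex.sin (2 * t * z) / Complex.sinh (c * t))
      (Set.Ioi 0) := by
  have h := ((integrable_gKer₁ hc hc (add_mem_strip hc hz)).sub
    (integrable_gKer₁ hc hc (sub_mem_strip hc hz))).const_mul Complex.I
  refine h.congr ?_
  refine (ae_restrict_iff' measurableSet_Ioi).2 (ae_of_all _ fun t ht => ?_)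
  exact gKer₁_diff hc ht z

lemma hasDerivAt_lcInt {c : ℝ} (hc : 0 < c) {z : ℂ} (hz : |z.im| < c / 2) :
    HasDerivAt (lcInt c)
      (∫ t in Set.Ioi (0 : ℝ), 2 * Complex.sin (2 * t * z) / Complex.sinh (c * t)) z := by
  have h1 := ((hasDerivAt_gLog hc hc (add_mem_strip hc hz)).comp_add_const z _).sub
    ((hasDerivAt_gLog hc hc (sub_mem_strip hc hz)).comp_sub_const z _)
  have h2 := h1.const_mul Complex.I
  have e : Complex.I * (gLog₁ c c (z + Complex.I * (c / 2)) - gLog₁ c c (z - Complex.I * (c / 2)))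
      = ∫ t in Set.Ioi (0 : ℝ), 2 * Complex.sin (2 * t * z) / Complex.sinh (c * t) := by
    rw [gLog₁, gLog₁, ← integral_sub (integrable_gKer₁ hc hc (add_mem_strip hc hz))
      (integrable_gKer₁ hc hc (sub_mem_strip hc hz)), ← integral_const_mul]
    exact setIntegral_congr_fun measurableSet_Ioi fun t ht => gKer₁_diff hc ht z
  rw [e] at h2
  refine h2.congr_of_eventuallyEq ?_
  have ho : {w : ℂ | |w.im| < c / 2} ∈ 𝓝 z :=
    (isOpen_lt (continuous_abs.comp Complex.continuous_im) continuous_const).mem_nhds hz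
  filter_upwards [ho] with w hw
  exact (I_mul_gLog_diff hc hc hw).symm

lemma lcInt_scale {c : ℝ} (hc : 0 < c) (z : ℂ) : lcInt c z = lcInt 1 (z / c) := by
  have hcc : (c : ℂ) ≠ 0 := by exact_mod_cast hc.ne'
  have h := integral_comp_mul_left_Ioi (fun t => lcKer 1 (z / c) t) 0 hc
  rw [mul_zero] at h
  have h2 : ∀ t : ℝ, lcKer 1 (z / c) (c * t) = (c⁻¹ : ℝ) • lcKer c z t := by
    intro t
    rw [lcKer, lcKer, Complex.real_smul]
    push_cast
    rw [show 2 * ((c : ℂ) * t) * (z / c) = 2 * t * z by field_simp, one_mul]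
    field_simp
  simp only [h2, integral_smul] at h
  rw [lcInt, lcInt]
  exact smul_right_injective ℂ (inv_pos.2 hc).ne' h

/-- From cos(it/2) = cosh(t/2) and sinh t = 2 sinh(t/2) cosh(t/2), the kernel at i/4 is half of the
kernel with c = 1/2 at 0, and scaling returns to c = 1. This relation determines the constant of
integration in `exp_lcInt_one` without evaluating an integral. -/
lemma lcInt_quarter : lcInt 1 (Complex.I / 4) = lcInt 1 0 / 2 := by
  have h : lcInt 1 (Complex.I / 4) = lcInt (1 / 2) 0 / 2 := by
    rw [lcInt, lcInt, ← integral_div]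
    refine setIntegral_congr_fun measurableSet_Ioi fun t ht => ?_
    have ht : 0 < t := ht
    have h1 := sinh_ofReal_mul_ne_zero (c := 1 / 2) (by norm_num) ht
    have hc : Complex.cosh (t / 2) ≠ 0 := by
      have : Complex.cosh (t / 2) = ((Real.cosh (t / 2) : ℝ) : ℂ) := by push_cast; rfl
      rw [this]; exact_mod_cast (Real.cosh_pos _).ne'
    have h3 : (t : ℂ) ≠ 0 := by exact_mod_cast ht.ne'
    have e1 : 2 * (t : ℂ) * (Complex.I / 4) = t / 2 * Complex.I := by ring
    have e2 : ((1 / 2 : ℝ) : ℂ) * t = t / 2 := by push_cast; ring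
    rw [e2] at h1
    simp only [lcKer]
    rw [e1, e2, Complex.cos_mul_I, mul_zero, Complex.cos_zero, Complex.ofReal_one, one_mul]
    rw [show Complex.sinh (t : ℂ) = 2 * Complex.sinh (t / 2) * Complex.cosh (t / 2) by
      rw [← Complex.sinh_two_mul]; ring_nf]
    field_simp
  rw [h, lcInt_scale (by norm_num), zero_div]

lemma integral_sin_mul_exp {z : ℂ} (hz : |z.im| < 1 / 2) (k : ℕ) :
    IntegrableOn (fun t : ℝ => 4 * Complex.sin (2 * t * z) * Complex.exp (-(2 * k + 1) * t))
      (Set.Ioi 0) ∧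
    ∫ t in Set.Ioi (0 : ℝ), 4 * Complex.sin (2 * t * z) * Complex.exp (-(2 * k + 1) * t) =
      Complex.I * (1 / (Complex.I * z + k + 1 / 2) + 1 / (Complex.I * z - k - 1 / 2)) := by
  have hk : (0 : ℝ) ≤ k := k.cast_nonneg
  rw [abs_lt] at hz
  have r1 : (-(2 * k + 1) - 2 * z * Complex.I : ℂ).re < 0 := by
    simp; linarith [hz.1, hz.2]
  have r2 : (-(2 * k + 1) + 2 * z * Complex.I : ℂ).re < 0 := by
    simp; linarith [hz.1, hz.2]
  have e : ∀ t : ℝ, 4 * Complex.sin (2 * t * z) * Complex.exp (-(2 * k + 1) * t) =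
      2 * Complex.I * (Complex.exp ((-(2 * k + 1) - 2 * z * Complex.I) * t) -
        Complex.exp ((-(2 * k + 1) + 2 * z * Complex.I) * t)) := by
    intro t
    have e1 : Complex.exp ((-(2 * k + 1) - 2 * z * Complex.I) * t) =
        Complex.exp (-(2 * t * z) * Complex.I) * Complex.exp (-(2 * k + 1) * t) := by
      rw [← Complex.exp_add]; ring_nf
    have e2 : Complex.exp ((-(2 * k + 1) + 2 * z * Complex.I) * t) =
        Complex.exp ((2 * t * z) * Complex.I) * Complex.exp (-(2 * k + 1) * t) := by
      rw [← Complex.exp_add]; ring_nf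
    rw [Complex.sin, e1, e2]; ring
  have i1 := integrableOn_exp_mul_complex_Ioi r1 0
  have i2 := integrableOn_exp_mul_complex_Ioi r2 0
  simp only [e]
  refine ⟨(i1.sub i2).const_mul _, ?_⟩
  rw [integral_const_mul, integral_sub i1 i2, integral_exp_mul_complex_Ioi r1,
    integral_exp_mul_complex_Ioi r2]
  have n1 : (-(2 * k + 1) - 2 * z * Complex.I : ℂ) ≠ 0 := fun h => by rw [h] at r1; simp at r1
  have n2 : (-(2 * k + 1) + 2 * z * Complex.I : ℂ) ≠ 0 := fun h => by rw [h] at r2; simp at r2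
  have n3 : Complex.I * z + k + 1 / 2 ≠ 0 := by
    intro h; apply n1; linear_combination (-2) * h
  have n4 : Complex.I * z - k - 1 / 2 ≠ 0 := by
    intro h; apply n2; linear_combination 2 * h
  have f1 : (1 : ℂ) / (Complex.I * z + k + 1 / 2) = -2 / (-(2 * k + 1) - 2 * z * Complex.I) := by
    rw [div_eq_div_iff n3 n1]; ring
  have f2 : (1 : ℂ) / (Complex.I * z - k - 1 / 2) = 2 / (-(2 * k + 1) + 2 * z * Complex.I) := by
    rw [div_eq_div_iff n4 n2]; ring
  rw [f1, f2]
  simp only [Complex.ofReal_zero, mul_zero, Complex.exp_zero]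
  ring

/-- Expanding 1/sinh t = 2 Σ e^{-(2k+1)t} and integrating termwise gives the partial fractions of π
tanh(πz). They are summed by the Mittag-Leffler series of the cotangent at 1/2 + iz. -/
lemma integral_sin_div_sinh {z : ℂ} (hz : |z.im| < 1 / 2) :
    ∫ t in Set.Ioi (0 : ℝ), 2 * Complex.sin (2 * t * z) / Complex.sinh ((1 : ℝ) * t) =
      Real.pi * (Complex.sinh (Real.pi * z) / Complex.cosh (Real.pi * z)) := by
  set f : ℕ → ℝ → ℂ := fun k t => 4 * Complex.sin (2 * t * z) * Complex.exp (-(2 * k + 1) * t)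
  set J := ∫ t in Set.Ioi (0 : ℝ), 2 * Complex.sin (2 * t * z) / Complex.sinh ((1 : ℝ) * t) with hJ
  have hpart : ∀ t : ℝ, 0 < t → ∀ n : ℕ, ∑ k ∈ Finset.range n, f k t =
      2 * Complex.sin (2 * t * z) / Complex.sinh ((1 : ℝ) * t) *
        (1 - ((Real.exp (-2 * t) ^ n : ℝ) : ℂ)) := by
    intro t ht n
    have hs := sinh_ofReal_mul_ne_zero (c := 1) one_pos ht
    have hs' : 2 * Complex.sinh ((1 : ℝ) * t) * Complex.exp (-t) = 1 - Complex.exp (-2 * t) := by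
      rw [Complex.sinh, Complex.ofReal_one, one_mul, mul_div_cancel₀ _ two_ne_zero, sub_mul,
        ← Complex.exp_add, ← Complex.exp_add]
      ring_nf; simp
    induction n with
    | zero => simp
    | succ n ih =>
      have e : f n t = 4 * Complex.sin (2 * t * z) *
          (Complex.exp (-t) * ((Real.exp (-2 * t) ^ n : ℝ) : ℂ)) := by
        simp only [f]
        congr 1
        rw [← Real.exp_nat_mul]; push_cast
        rw [← Complex.exp_add]; ring_nf
      rw [Finset.sum_range_succ, ih, e, pow_succ]
      push_cast
      rw [Complex.ofReal_one] at hs hs'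
      rw [div_mul_eq_mul_div, div_mul_eq_mul_div, div_add' _ _ _ hs]
      congr 1
      linear_combination (2 * Complex.sin (2 * t * z) * Complex.exp (-2 * t) ^ n) * hs'
  have lim1 : Tendsto (fun n : ℕ => ∑ k ∈ Finset.range n,
      Complex.I * (1 / (Complex.I * z + k + 1 / 2) + 1 / (Complex.I * z - k - 1 / 2)))
      atTop (𝓝 J) := by
    have h1 : ∀ n : ℕ, ∑ k ∈ Finset.range n,
      Complex.I * (1 / (Complex.I * z + k + 1 / 2) + 1 / (Complex.I * z - k - 1 / 2)) =
        ∫ t in Set.Ioi (0 : ℝ), ∑ k ∈ Finset.range n, f k t := by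
      intro n
      rw [integral_finsetSum _ fun k _ => (integral_sin_mul_exp hz k).1]
      exact Finset.sum_congr rfl fun k _ => (integral_sin_mul_exp hz k).2.symm
    simp only [h1]
    refine tendsto_integral_of_dominated_convergence
      (fun t : ℝ => ‖2 * Complex.sin (2 * t * z) / Complex.sinh ((1 : ℝ) * t)‖) (fun n => ?_)
      (integrable_sin_div_sinh one_pos hz).norm (fun n => ?_) ?_
    · exact (integrable_finsetSum _ fun k _ => (integral_sin_mul_exp hz k).1).aestronglyMeasurable
    · refine (ae_restrict_iff' measurableSet_Ioi).2 (ae_of_all _ fun t ht => ?_)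
      have ht : 0 < t := ht
      rw [hpart t ht, norm_mul]
      refine mul_le_of_le_one_right (norm_nonneg _) ?_
      rw [← Complex.ofReal_one, ← Complex.ofReal_sub, Complex.norm_real, Real.norm_eq_abs, abs_le]
      have h1 : Real.exp (-2 * t) ^ n ≤ 1 :=
        pow_le_one₀ (Real.exp_pos _).le (Real.exp_le_one_iff.2 (by linarith))
      have h2 : 0 ≤ Real.exp (-2 * t) ^ n := by positivity
      constructor <;> linarith
    · refine (ae_restrict_iff' measurableSet_Ioi).2 (ae_of_all _ fun t ht => ?_)
      have ht : 0 < t := ht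
      simp only [hpart t ht]
      have h1 : Tendsto (fun n : ℕ => Real.exp (-2 * t) ^ n) atTop (𝓝 0) :=
        tendsto_pow_atTop_nhds_zero_of_lt_one (Real.exp_pos _).le
          (by rw [← Real.exp_zero]; exact Real.exp_lt_exp.2 (by linarith))
      have h2 := ((Complex.continuous_ofReal.tendsto 0).comp h1).const_sub 1
      simpa using h2.const_mul (2 * Complex.sin (2 * t * z) / Complex.sinh ((1 : ℝ) * t))
  set x : ℂ := 1 / 2 + Complex.I * z with hx
  rw [abs_lt] at hz
  have hre : ∀ m : ℕ, Complex.I * z + m + 1 / 2 ≠ 0 ∧ Complex.I * z - m - 1 / 2 ≠ 0 := by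
    intro m
    have hm : (0 : ℝ) ≤ m := m.cast_nonneg
    constructor <;> intro h <;> have h1 := congrArg Complex.re h <;> simp at h1 <;>
      linarith [hz.1, hz.2]
  have hxc : x ∈ Complex.integerComplement := by
    rintro ⟨n, hn⟩
    have h1 := congrArg Complex.re hn
    simp [hx] at h1
    have h2 : (0 : ℝ) < n := by linarith [hz.2]
    have h3 : (n : ℝ) < 1 := by linarith [hz.1]
    norm_cast at h2 h3
    omega
  have lim2 := (tendsto_logDeriv_euler_cot_sub hxc).const_add (1 / x)
  -- The poles are paired differently from the cotangent series. The partial sums differ by one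
  -- boundary term, which tends to 0.
  have hsum : ∀ n : ℕ, ∑ k ∈ Finset.range n,
      Complex.I * (1 / (Complex.I * z + k + 1 / 2) + 1 / (Complex.I * z - k - 1 / 2)) =
      Complex.I * (1 / x + ∑ j ∈ Finset.range n, cotTerm x j) -
        Complex.I * (1 / (Complex.I * z + n + 1 / 2)) := by
    intro n
    induction n with
    | zero => simp [hx, add_comm]
    | succ n ih =>
      rw [Finset.sum_range_succ, ih, Finset.sum_range_succ, cotTerm, hx]
      rw [show (1 / 2 + Complex.I * z - (n + 1) : ℂ) = Complex.I * z - n - 1 / 2 by ring,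
        show (1 / 2 + Complex.I * z + (n + 1) : ℂ) = Complex.I * z + (n + 1 : ℕ) + 1 / 2 by
          push_cast; ring]
      ring
  have lim3 : Tendsto (fun n : ℕ => 1 / (Complex.I * z + n + 1 / 2)) atTop (𝓝 0) := by
    have h1 : Tendsto (fun n : ℕ => ‖Complex.I * z + n + 1 / 2‖) atTop atTop := by
      refine tendsto_atTop_mono (fun n => ?_)
        (tendsto_atTop_add_const_right atTop (-(1 / 2 : ℝ)) tendsto_natCast_atTop_atTop)
      refine le_trans ?_ ((le_abs_self _).trans (Complex.abs_re_le_norm _))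
      simp; linarith [hz.2]
    have h2 := tendsto_inv_atTop_zero.comp h1
    rw [tendsto_zero_iff_norm_tendsto_zero]
    simpa [Function.comp_def] using h2
  have lim4 := (lim2.const_mul Complex.I).sub (lim3.const_mul Complex.I)
  have hJ2 := tendsto_nhds_unique (lim1.congr hsum) lim4
  rw [hJ2, Complex.cot, hx]
  have e1 : (Real.pi : ℂ) * (1 / 2 + Complex.I * z) =
      Real.pi * z * Complex.I + Real.pi / 2 := by ring
  rw [e1, Complex.cos_add_pi_div_two, Complex.sin_add_pi_div_two, Complex.sin_mul_I,
    Complex.cos_mul_I]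
  have : Complex.I * (-(Complex.sinh (Real.pi * z) * Complex.I)) = Complex.sinh (Real.pi * z) := by
    linear_combination (-Complex.sinh (Real.pi * z)) * Complex.I_sq
  linear_combination (Real.pi / Complex.cosh (Real.pi * z)) * this

lemma cosh_ne_zero_of_im {z : ℂ} (hz : |z.im| < Real.pi / 2) : Complex.cosh z ≠ 0 := by
  intro h
  have h1 : Complex.cos (z * Complex.I) = 0 := by rw [Complex.cos_mul_I, h]
  obtain ⟨k, hk⟩ := Complex.cos_eq_zero_iff.1 h1
  have hre := congrArg Complex.re hk
  simp at hre
  have h3 : (1 : ℝ) ≤ |(2 * k + 1 : ℝ)| := by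
    have : (1 : ℤ) ≤ |2 * k + 1| := Int.one_le_abs (by omega)
    exact_mod_cast this
  have h4 : |z.im| = |(2 * k + 1 : ℝ)| * Real.pi / 2 := by
    rw [← abs_neg, hre, abs_div, abs_mul, abs_of_pos Real.pi_pos, abs_two]
  nlinarith [Real.pi_pos]

/-- The derivative of e^{-lcInt} cosh(πz) vanishes. With L = `lcInt 1 0`, equality of the values at
0 and i/4 reads e^{-L} = e^{-L/2} cos(π/4), whence e^L = 2. -/
lemma exp_lcInt_one {z : ℂ} (hz : |z.im| < 1 / 2) :
    Complex.exp (lcInt 1 z) = 2 * Complex.cosh (Real.pi * z) := by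
  set h : ℂ → ℂ := fun w => Complex.exp (-lcInt 1 w) * Complex.cosh (Real.pi * w) with hh
  have hd : ∀ w : ℂ, |w.im| < 1 / 2 → HasDerivAt h 0 w := by
    intro w hw
    have h1 := hasDerivAt_lcInt one_pos hw
    rw [integral_sin_div_sinh hw] at h1
    have h2 := h1.neg.cexp.mul (((hasDerivAt_id w).const_mul (Real.pi : ℂ)).ccosh)
    refine h2.congr_deriv ?_
    have : Complex.cosh (Real.pi * w) ≠ 0 := cosh_ne_zero_of_im (by
      rw [Complex.im_ofReal_mul, abs_mul, abs_of_pos Real.pi_pos]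
      nlinarith [Real.pi_pos])
    simp only [id, mul_one]
    field_simp
    ring
  have hconst : ∀ w : ℂ, |w.im| < 1 / 2 → h w = h 0 := by
    intro w hw
    have ho : IsOpen {z : ℂ | |z.im| < 1 / 2} :=
      isOpen_lt (continuous_abs.comp Complex.continuous_im) continuous_const
    obtain ⟨a, ha⟩ := ho.exists_is_const_of_deriv_eq_zero (convex_abs_im_lt _).isPreconnected
      (fun z hz => (hd z hz).differentiableAt.differentiableWithinAt) (fun z hz => (hd z hz).deriv)
    rw [ha w hw, ha 0 (by simp)]
  have e0 : h 0 = Complex.exp (-lcInt 1 0) := by simp [hh]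
  have e1 := hconst (Complex.I / 4) (by norm_num [Complex.div_im])
  have e2 : Complex.cosh (Real.pi * (Complex.I / 4)) = ((√2 / 2 : ℝ) : ℂ) := by
    rw [show (Real.pi : ℂ) * (Complex.I / 4) = ((Real.pi / 4 : ℝ) : ℂ) * Complex.I by
      push_cast; ring, Complex.cosh_mul_I, ← Complex.ofReal_cos, Real.cos_pi_div_four]
  have hL : Complex.exp (lcInt 1 0) = 2 := by
    rw [e0, hh] at e1
    simp only [] at e1
    rw [e2, lcInt_quarter] at e1
    set L := lcInt 1 0
    have a1 : Complex.exp (-L) = Complex.exp (-(L / 2)) * Complex.exp (-(L / 2)) := by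
      rw [← Complex.exp_add]; ring_nf
    rw [a1] at e1
    have a2 : ((√2 / 2 : ℝ) : ℂ) = Complex.exp (-(L / 2)) :=
      mul_left_cancel₀ (Complex.exp_ne_zero _) e1
    have a3 : Complex.exp (-L) = 1 / 2 := by
      rw [a1, ← a2, ← Complex.ofReal_mul]
      have : √2 / 2 * (√2 / 2) = 1 / 2 := by
        have := Real.mul_self_sqrt (show (0 : ℝ) ≤ 2 by norm_num)
        linarith
      rw [this]; simp
    rw [Complex.exp_neg] at a3
    have := congrArg (·⁻¹) a3
    simpa using this
  have e3 := hconst z hz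
  rw [e0, Complex.exp_neg, hL, hh] at e3
  simp only [Complex.exp_neg] at e3
  have hne := Complex.exp_ne_zero (lcInt 1 z)
  field_simp at e3
  rw [mul_comm]
  linear_combination (-1) * e3

lemma exp_lcInt {c : ℝ} (hc : 0 < c) {z : ℂ} (hz : |z.im| < c / 2) :
    Complex.exp (lcInt c z) = 2 * Complex.cosh (Real.pi * z / c) := by
  rw [lcInt_scale hc, exp_lcInt_one, mul_div_assoc]
  rw [Complex.div_ofReal_im, abs_div, abs_of_pos hc, div_lt_iff₀ hc]
  linarith

lemma gExp_diff (hap : 0 < ap) (ham : 0 < am) {z : ℂ} (hz : |z.im| < am / 2) :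
    gExp ap am (z + Complex.I * (ap / 2)) =
      2 * Complex.cosh (Real.pi * z / am) * gExp ap am (z - Complex.I * (ap / 2)) := by
  rw [← exp_lcInt ham hz, ← I_mul_gLog_diff hap ham hz, gExp, gExp, ← Complex.exp_add]
  ring_nf

lemma gExp_comm (ap am : ℝ) (z : ℂ) : gExp ap am z = gExp am ap z := by
  rw [gExp, gExp, gLog_comm]

lemma gExp_neg (ap am : ℝ) (z : ℂ) : gExp ap am (-z) = (gExp ap am z)⁻¹ := by
  rw [gExp, gExp, gLog_neg, ← Complex.exp_neg, mul_neg]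

lemma differentiableOn_gExp (hap : 0 < ap) (ham : 0 < am) :
    DifferentiableOn ℂ (gExp ap am) (strip ap am) :=
  ((differentiableOn_gLog hap ham).const_mul _).cexp

end


/-! ### Asymptotics of g as Re z → ∞. -/

lemma integrable_exp_neg_mul_abs {κ : ℝ} (hκ : 0 < κ) :
    Integrable fun x : ℝ => Real.exp (-κ * |x|) := by
  rw [← integrableOn_univ, ← Set.Iic_union_Ioi (a := (0 : ℝ))]
  refine IntegrableOn.union ?_ ?_
  · refine (integrableOn_exp_mul_Iic hκ 0).congr_fun (fun x hx => ?_) measurableSet_Iic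
    simp only
    rw [abs_of_nonpos hx]; ring_nf
  · refine (integrableOn_exp_mul_Ioi (neg_lt_zero.2 hκ) 0).congr_fun (fun x hx => ?_)
      measurableSet_Ioi
    simp only
    rw [abs_of_pos hx]

lemma tendsto_exp_neg_mul {κ : ℝ} (hκ : 0 < κ) :
    Tendsto (fun x : ℝ => Real.exp (-κ * x)) atTop (𝓝 0) :=
  Real.tendsto_exp_atBot.comp (tendsto_id.const_mul_atTop_of_neg (by linarith))

lemma tendsto_exp_neg_mul_abs_atTop {κ : ℝ} (hκ : 0 < κ) :
    Tendsto (fun x : ℝ => Real.exp (-κ * |x|)) atTop (𝓝 0) :=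
  (tendsto_exp_neg_mul hκ).comp tendsto_abs_atTop_atTop

lemma tendsto_exp_neg_mul_abs_atBot {κ : ℝ} (hκ : 0 < κ) :
    Tendsto (fun x : ℝ => Real.exp (-κ * |x|)) atBot (𝓝 0) :=
  (tendsto_exp_neg_mul hκ).comp tendsto_abs_atBot_atTop

lemma coeffs_eq_zero_of_tendsto {A B C : ℝ}
    (h : Tendsto (fun x : ℝ => A + B * x + C * x ^ 2) atTop (𝓝 0)) : A = 0 ∧ B = 0 ∧ C = 0 := by
  have shift : Tendsto (fun x : ℝ => x + 1) atTop atTop :=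
    tendsto_atTop_add_const_right _ _ tendsto_id
  have h1 : Tendsto (fun x : ℝ => (B + C) + (2 * C) * x) atTop (𝓝 0) := by
    have := (h.comp shift).sub h
    rw [sub_zero] at this
    refine this.congr fun x => ?_
    simp only [Function.comp]; ring
  have h2 : Tendsto (fun _ : ℝ => 2 * C) atTop (𝓝 0) := by
    have := (h1.comp shift).sub h1
    rw [sub_zero] at this
    refine this.congr fun x => ?_
    simp only [Function.comp]; ring
  have hC : C = 0 := by
    have := tendsto_nhds_unique h2 tendsto_const_nhds
    linarith
  subst hC
  have h3 : Tendsto (fun _ : ℝ => B) atTop (𝓝 0) := by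
    refine h1.congr fun x => ?_
    ring
  have hB : B = 0 := (tendsto_nhds_unique h3 tendsto_const_nhds).symm
  subst hB
  have h4 : Tendsto (fun _ : ℝ => A) atTop (𝓝 0) := by
    refine h.congr fun x => ?_
    ring
  exact ⟨(tendsto_nhds_unique h4 tendsto_const_nhds).symm, rfl, rfl⟩

/-- The rate at which the hyperbolic gamma function approaches its asymptotics. -/
noncomputable def decayRate (ap am : ℝ) : ℝ := Real.pi / (ap + am)

/-- The kernel `t² / (sinh (a₊ t) sinh (a₋ t))` as an entire quotient. -/
noncomputable def shKer (ap am : ℝ) (w : ℂ) : ℂ :=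
  (ap * am : ℂ)⁻¹ * ((sinhc (ap * w))⁻¹ * (sinhc (am * w))⁻¹)

section
variable {ap am : ℝ}

lemma decayRate_pos (hap : 0 < ap) (ham : 0 < am) : 0 < decayRate ap am :=
  div_pos Real.pi_pos (by linarith)

lemma sinhc_neg (z : ℂ) : sinhc (-z) = sinhc z := by
  by_cases hz : z = 0
  · simp [hz]
  · rw [sinhc_of_ne hz, sinhc_of_ne (neg_ne_zero.2 hz), Complex.sinh_neg, neg_div_neg_eq]

lemma shKer_neg (w : ℂ) : shKer ap am (-w) = shKer ap am w := by
  rw [shKer, shKer, mul_neg, mul_neg, sinhc_neg, sinhc_neg]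

lemma shKer_ofReal (hap : 0 < ap) (ham : 0 < am) {t : ℝ} (ht : 0 < t) :
    shKer ap am t = t ^ 2 / (Complex.sinh (ap * t) * Complex.sinh (am * t)) := by
  have h3 : (t : ℂ) ≠ 0 := by exact_mod_cast ht.ne'
  have h4 : (ap : ℂ) ≠ 0 := by exact_mod_cast hap.ne'
  have h5 : (am : ℂ) ≠ 0 := by exact_mod_cast ham.ne'
  rw [shKer, sinhc_of_ne (mul_ne_zero h4 h3), sinhc_of_ne (mul_ne_zero h5 h3)]
  have h1 := sinh_ofReal_mul_ne_zero hap ht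
  have h2 := sinh_ofReal_mul_ne_zero ham ht
  generalize Complex.sinh (ap * t) = s₁ at *
  generalize Complex.sinh (am * t) = s₂ at *
  field_simp

lemma im_mul_le_of_decayRate (hap : 0 < ap) (ham : 0 < am) {w : ℂ}
    (hw : |w.im| ≤ decayRate ap am / 2) :
    |((ap : ℂ) * w).im| ≤ Real.pi / 2 ∧ |((am : ℂ) * w).im| ≤ Real.pi / 2 := by
  rw [Complex.im_ofReal_mul, Complex.im_ofReal_mul, abs_mul, abs_mul, abs_of_pos hap,
    abs_of_pos ham]
  have h : (ap + am) * (decayRate ap am / 2) = Real.pi / 2 := by rw [decayRate]; field_simp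
  constructor <;> nlinarith [abs_nonneg w.im]

lemma exists_norm_shKer_le (hap : 0 < ap) (ham : 0 < am) {θ : ℝ} (hθ : θ < 1) :
    ∃ C > 0, ∀ w : ℂ, |w.im| ≤ decayRate ap am / 2 →
      ‖shKer ap am w‖ ≤ C * Real.exp (-(θ * (ap + am)) * |w.re|) := by
  obtain ⟨C, hC0, hC⟩ := exists_norm_inv_sinhc_le hθ
  refine ⟨(ap * am)⁻¹ * (C * C), by positivity, fun w hw => ?_⟩
  obtain ⟨h1, h2⟩ := im_mul_le_of_decayRate hap ham hw
  have h3 := hC _ h1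
  have h4 := hC _ h2
  rw [Complex.re_ofReal_mul, abs_mul, abs_of_pos hap] at h3
  rw [Complex.re_ofReal_mul, abs_mul, abs_of_pos ham] at h4
  rw [shKer, norm_mul, norm_mul, norm_inv (_ * _), norm_mul (ap : ℂ), Complex.norm_real,
    Complex.norm_real, Real.norm_of_nonneg hap.le, Real.norm_of_nonneg ham.le]
  calc _ ≤ (ap * am)⁻¹ * ((C * Real.exp (-θ * (ap * |w.re|))) *
        (C * Real.exp (-θ * (am * |w.re|)))) := by gcongr
    _ = (ap * am)⁻¹ * (C * C) *
        (Real.exp (-θ * (ap * |w.re|)) * Real.exp (-θ * (am * |w.re|))) := by ring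
    _ = _ := by rw [← Real.exp_add]; ring_nf

lemma differentiableOn_shKer (hap : 0 < ap) (ham : 0 < am) :
    DifferentiableOn ℂ (shKer ap am) {w | |w.im| ≤ decayRate ap am / 2} := by
  have h1 : Differentiable ℂ fun w : ℂ => sinhc (ap * w) :=
    differentiable_sinhc.comp (by fun_prop)
  have h2 : Differentiable ℂ fun w : ℂ => sinhc (am * w) :=
    differentiable_sinhc.comp (by fun_prop)
  refine ((h1.differentiableOn.inv fun w hw => sinhc_ne_zero ?_).mul
    (h2.differentiableOn.inv fun w hw => sinhc_ne_zero ?_)).const_mul _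
  · linarith [(im_mul_le_of_decayRate hap ham hw).1, Real.pi_pos]
  · linarith [(im_mul_le_of_decayRate hap ham hw).2, Real.pi_pos]

/-- Exponential decay of the third derivative of `gLog`. -/
lemma exists_norm_gLog₃_le (hap : 0 < ap) (ham : 0 < am) {B : ℝ} (hB : B < mean ap am) :
    ∃ C, ∀ z : ℂ, 0 ≤ z.re → |z.im| ≤ B →
      ‖gLog₃ ap am z‖ ≤ C * Real.exp (-decayRate ap am * z.re) := by
  rcases lt_or_ge B 0 with hB0 | hB0
  · exact ⟨0, fun z _ hz => absurd hz (not_le.2 (hB0.trans_le (abs_nonneg _)))⟩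
  have ha := mean_pos hap ham
  set σ := decayRate ap am / 2 with hσ
  have hσ0 : 0 < σ := by have := decayRate_pos hap ham; rw [hσ]; linarith
  -- With this θ the kernel decays at rate 2aθ = a + B = κ + 2B, which leaves κ = a - B after the
  -- growth e^{2B|Re w|} of the exponential.
  set θ := (1 + B / mean ap am) / 2 with hθ
  have hθ1 : θ < 1 := by
    have : B / mean ap am < 1 := (div_lt_one ha).2 hB
    rw [hθ]; linarith
  obtain ⟨C, hC0, hC⟩ := exists_norm_shKer_le hap ham hθ1
  set κ := mean ap am - B with hκ
  have hκ0 : 0 < κ := by rw [hκ]; linarith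
  have hexp : θ * (ap + am) = κ + 2 * B := by
    have : ap + am = 2 * mean ap am := by rw [mean]; ring
    rw [this, hθ, hκ]; field_simp; ring
  set I₀ := ∫ x : ℝ, C * Real.exp (-κ * |x|) with hI₀
  refine ⟨2 * I₀, fun z hz0 hz => ?_⟩
  -- The third derivative carries a factor t² that removes the double pole of the kernel at 0. The
  -- cosine over the half line can therefore be replaced by an exponential over the whole line
  -- without creating a pole, and raising the contour to Im w = σ gains e^{-2σ Re z}, where 2σ is
  -- the decay rate.
  set h : ℂ → ℂ := fun w => shKer ap am w * Complex.exp (2 * Complex.I * w * z) with hh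
  have hnorm : ∀ w : ℂ, |w.im| ≤ σ →
      ‖h w‖ ≤ C * Real.exp (-κ * |w.re|) * Real.exp (-(2 * w.im) * z.re) := by
    intro w hw
    rw [hh]; simp only
    rw [norm_mul, Complex.norm_exp]
    have e : (2 * Complex.I * w * z).re = -(2 * w.im) * z.re - 2 * w.re * z.im := by
      rw [show 2 * Complex.I * w * z = (2 : ℝ) * (Complex.I * (w * z)) by push_cast; ring,
        Complex.re_ofReal_mul, Complex.I_mul_re, Complex.mul_im]
      ring
    have h1 : -(2 * w.re * z.im) ≤ 2 * B * |w.re| := by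
      have := neg_abs_le (w.re * z.im)
      rw [abs_mul] at this
      nlinarith [mul_le_mul_of_nonneg_left hz (abs_nonneg w.re)]
    calc _ ≤ (C * Real.exp (-(θ * (ap + am)) * |w.re|)) *
          Real.exp (-(2 * w.im) * z.re + 2 * B * |w.re|) := by
          gcongr
          · exact hC w hw
          · rw [e]; linarith
      _ = C * (Real.exp (-(θ * (ap + am)) * |w.re|) *
          Real.exp (-(2 * w.im) * z.re + 2 * B * |w.re|)) := by ring
      _ = C * (Real.exp (-κ * |w.re|) * Real.exp (-(2 * w.im) * z.re)) := by
          rw [← Real.exp_add, ← Real.exp_add, hexp]; ring_nf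
      _ = _ := by ring
  have hd : DifferentiableOn ℂ h {w | |w.im| ≤ σ} :=
    (differentiableOn_shKer hap ham).mul (Differentiable.differentiableOn (by fun_prop))
  have hint : ∀ s : ℝ, |s| ≤ σ → Integrable fun x : ℝ => h (x + s * Complex.I) := by
    intro s hs
    refine Integrable.mono' (((integrable_exp_neg_mul_abs hκ0).const_mul C).mul_const
      (Real.exp (-(2 * s) * z.re))) ?_ (ae_of_all _ fun x => ?_)
    · refine (hd.continuousOn.comp_continuous (by fun_prop) fun x => ?_).aestronglyMeasurable
      simpa using hs
    · simpa using hnorm (x + s * Complex.I) (by simpa using hs)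
  have hshift := integral_horizontal_shift (f := h) (s₁ := 0) (s₂ := σ)
    (b := fun x => C * Real.exp (-κ * |x|))
    (hd.mono fun w hw => by
      rw [Set.mem_preimage, Set.uIcc_of_le hσ0.le] at hw
      exact abs_le.2 ⟨by linarith [hw.1], hw.2⟩)
    (fun x s hs => by
      rw [Set.uIcc_of_le hσ0.le] at hs
      refine (hnorm (x + s * Complex.I) ?_).trans ?_
      · simpa using abs_le.2 ⟨by linarith [hs.1], hs.2⟩
      · have : Real.exp (-(2 * s) * z.re) ≤ 1 :=
          Real.exp_le_one_iff.2 (by nlinarith [hs.1])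
        have h2 : 0 ≤ C * Real.exp (-κ * |x|) := by positivity
        simpa using mul_le_of_le_one_right h2 this)
    (by simpa using (tendsto_exp_neg_mul_abs_atTop hκ0).const_mul C)
    (by simpa using (tendsto_exp_neg_mul_abs_atBot hκ0).const_mul C)
    (hint 0 (by simpa using hσ0.le)) (hint σ (by rw [abs_of_pos hσ0]))
  have hi0 : Integrable fun x : ℝ => h x := by simpa using hint 0 (by simpa using hσ0.le)
  have heq : gLog₃ ap am z = -2 * ∫ x : ℝ, h x := by
    rw [← intervalIntegral.integral_Iic_add_Ioi (b := 0) hi0.integrableOn hi0.integrableOn]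
    have h1 := integral_comp_neg_Ioi 0 (fun x : ℝ => h x)
    rw [neg_zero] at h1
    rw [← h1, ← integral_add hi0.comp_neg.integrableOn hi0.integrableOn, gLog₃,
      ← integral_const_mul]
    refine setIntegral_congr_fun measurableSet_Ioi fun t ht => ?_
    have ht : 0 < t := ht
    simp only [hh, gKer₃]
    rw [Complex.ofReal_neg, shKer_neg, shKer_ofReal hap ham ht, Complex.cos]
    rw [show 2 * Complex.I * -(t : ℂ) * z = -(2 * t * z) * Complex.I by ring,
      show 2 * Complex.I * (t : ℂ) * z = (2 * t * z) * Complex.I by ring]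
    ring
  rw [heq, norm_mul]
  have e0 : ∫ x : ℝ, h x = ∫ x : ℝ, h (x + σ * Complex.I) := by simpa using hshift
  rw [e0, norm_neg, Complex.norm_ofNat, mul_assoc]
  refine mul_le_mul_of_nonneg_left ?_ (by norm_num)
  rw [hI₀, ← integral_mul_const]
  refine norm_integral_le_of_norm_le
    (((integrable_exp_neg_mul_abs hκ0).const_mul C).mul_const _) (ae_of_all _ fun x => ?_)
  have := hnorm (x + σ * Complex.I) (by simp [abs_of_pos hσ0])
  rw [show decayRate ap am = 2 * σ by rw [hσ]; ring]
  simpa using this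

/-- `χ` is the constant in the asymptotics `g(z) ∼ -χ - α z² / 4` as `Re z → ∞`. -/
def IsPhase (ap am : ℝ) (χ : ℂ) : Prop :=
  ∀ B < mean ap am, ∃ C, ∀ z : ℂ, 0 ≤ z.re → |z.im| ≤ B →
    ‖gLog ap am z + χ + alpha ap am * z ^ 2 / 4‖ ≤ C * Real.exp (-decayRate ap am * z.re) ∧
    ‖gLog₁ ap am z + alpha ap am * z / 2‖ ≤ C * Real.exp (-decayRate ap am * z.re)

lemma gLog₁_comm (ap am : ℝ) (z : ℂ) : gLog₁ ap am z = gLog₁ am ap z := by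
  rw [gLog₁, gLog₁]
  congr 1; ext t
  rw [gKer₁, gKer₁]; ring_nf

lemma mean_comm (ap am : ℝ) : mean ap am = mean am ap := by rw [mean, mean, add_comm]

lemma alpha_comm (ap am : ℝ) : alpha ap am = alpha am ap := by rw [alpha, alpha, mul_comm ap]

lemma decayRate_comm (ap am : ℝ) : decayRate ap am = decayRate am ap := by
  rw [decayRate, decayRate, add_comm]

lemma IsPhase.symm {χ : ℂ} (h : IsPhase ap am χ) : IsPhase am ap χ := by
  intro B hB
  rw [mean_comm] at hB
  obtain ⟨C, hC⟩ := h B hB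
  refine ⟨C, fun z hz0 hz => ?_⟩
  rw [gLog_comm, gLog₁_comm, alpha_comm, decayRate_comm]
  exact hC z hz0 hz

/-- Integrating the exponentially small third derivative three times gives g = c₂z²/2 + c₁z + c₀ +
small. Reality of g on the real axis removes imaginary parts, and the difference equation forces c₁
= 0 and c₂ = -α/2. The value of χ = -c₀ is left undetermined. -/
theorem exists_isPhase (hap : 0 < ap) (ham : 0 < am) : ∃ χ, IsPhase ap am χ := by
  have ha := mean_pos hap ham
  have hr := decayRate_pos hap ham
  obtain ⟨c₂, hc₂⟩ := exists_limit_of_deriv_decay ha hr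
    (fun z hz => hasDerivAt_gLog₂ hap ham hz) (fun B hB => exists_norm_gLog₃_le hap ham hB)
  obtain ⟨c₁, hc₁⟩ := exists_limit_of_deriv_decay (f := fun z => gLog₁ ap am z - c₂ * z) ha hr
    (fun z hz => (hasDerivAt_gLog₁ hap ham hz).sub
      (by simpa using (hasDerivAt_id z).const_mul c₂)) hc₂
  obtain ⟨c₀, hc₀⟩ := exists_limit_of_deriv_decay
    (f := fun z => gLog ap am z - (c₂ * z ^ 2 / 2 + c₁ * z))
    (f' := fun z => gLog₁ ap am z - c₂ * z - c₁) ha hr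
    (fun z hz => by
      have h1 : HasDerivAt (fun z : ℂ => c₂ * z ^ 2 / 2 + c₁ * z) (c₂ * z + c₁) z := by
        have := (((hasDerivAt_id z).pow 2).const_mul c₂).div_const 2 |>.add
          ((hasDerivAt_id z).const_mul c₁)
        refine this.congr_deriv ?_
        simp; ring
      exact ((hasDerivAt_gLog hap ham hz).sub h1).congr_deriv (by ring)) hc₁
  have hlim : ∀ s : ℝ, |s| < mean ap am → Tendsto (fun x : ℝ => gLog ap am (x + s * Complex.I) -
      (c₂ * (x + s * Complex.I) ^ 2 / 2 + c₁ * (x + s * Complex.I)) - c₀) atTop (𝓝 0) := by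
    intro s hs
    obtain ⟨C, hC⟩ := hc₀ |s| hs
    refine squeeze_zero_norm' (a := fun x => C * Real.exp (-decayRate ap am * x)) ?_
      (by simpa using (tendsto_exp_neg_mul hr).const_mul C)
    filter_upwards [eventually_ge_atTop 0] with x hx
    simpa using hC (x + s * Complex.I) (by simpa using hx) (by simp)
  have him : c₀.im = 0 ∧ c₁.im = 0 ∧ c₂.im / 2 = 0 := by
    refine coeffs_eq_zero_of_tendsto ?_
    have h1 := (Complex.continuous_im.tendsto 0).comp (hlim 0 (by simpa using ha))
    have h2 := h1.neg
    rw [Complex.zero_im, neg_zero] at h2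
    refine h2.congr fun x => ?_
    obtain ⟨ρ, hρ⟩ := gLog_ofReal (ap := ap) (am := am) x
    have e1 : ((x : ℂ) ^ 2).im = 0 := by rw [← Complex.ofReal_pow, Complex.ofReal_im]
    have e2 : ((x : ℂ) ^ 2).re = x ^ 2 := by rw [← Complex.ofReal_pow, Complex.ofReal_re]
    simp only [Function.comp, Complex.ofReal_zero, zero_mul, add_zero, hρ]
    simp [e1, e2]
    ring
  -- The real part of i(g(x + ia₊/2) - g(x - ia₊/2)) equals log(2 cosh(πx/a₋)) = πx/a₋ + o(1), while
  -- the quadratic expansion gives -a₊ Re(c₂x + c₁) + o(1).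
  have hre : ap * c₁.re = 0 ∧ ap * c₂.re + Real.pi / am = 0 ∧ (0 : ℝ) = 0 := by
    refine coeffs_eq_zero_of_tendsto ?_
    have hs : |ap / 2| < mean ap am := by
      rw [abs_of_pos (by positivity), mean]; linarith
    have h1 := ((hlim (ap / 2) hs).sub (hlim (-(ap / 2)) (by rwa [abs_neg]))).const_mul Complex.I
    have h2 := (Complex.continuous_re.tendsto _).comp h1
    rw [sub_zero, mul_zero, Complex.zero_re] at h2
    have h3 : Tendsto (fun x : ℝ => Real.log (1 + Real.exp (-(2 * Real.pi / am) * x))) atTop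
        (𝓝 0) := by
      have := (tendsto_exp_neg_mul (κ := 2 * Real.pi / am) (by positivity)).const_add 1
      rw [add_zero] at this
      simpa using this.log one_ne_zero
    have h4 := h2.sub h3
    rw [sub_zero] at h4
    refine h4.congr fun x => ?_
    have hx : |(x : ℂ).im| < am / 2 := by simpa using ham
    have e1 := I_mul_gLog_diff hap ham hx
    have e2 : (lcInt am x).re =
        Real.pi * x / am + Real.log (1 + Real.exp (-(2 * Real.pi / am) * x)) := by
      have h := congrArg norm (exp_lcInt ham hx)
      rw [Complex.norm_exp] at h
      have e3 : 2 * Complex.cosh (Real.pi * x / am) = ((Real.exp (Real.pi * x / am) *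
          (1 + Real.exp (-(2 * Real.pi / am) * x)) : ℝ) : ℂ) := by
        rw [mul_add, ← Real.exp_add, Complex.cosh]
        push_cast
        rw [mul_div_cancel₀ _ two_ne_zero, mul_one]
        congr 2; ring
      rw [e3, Complex.norm_real, Real.norm_of_nonneg (by positivity)] at h
      have := congrArg Real.log h
      rwa [Real.log_exp, Real.log_mul (Real.exp_pos _).ne' (by positivity), Real.log_exp] at this
    have e4 : Complex.I * ((gLog ap am (x + (ap / 2 : ℝ) * Complex.I) -
        (c₂ * (x + (ap / 2 : ℝ) * Complex.I) ^ 2 / 2 + c₁ * (x + (ap / 2 : ℝ) * Complex.I)) - c₀) -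
        (gLog ap am (x + (-(ap / 2) : ℝ) * Complex.I) -
        (c₂ * (x + (-(ap / 2) : ℝ) * Complex.I) ^ 2 / 2 +
          c₁ * (x + (-(ap / 2) : ℝ) * Complex.I)) - c₀)) =
        lcInt am x + (ap : ℂ) * (c₂ * x + c₁) := by
      rw [← e1, show (x : ℂ) + (ap / 2 : ℝ) * Complex.I = x + Complex.I * (ap / 2) by
        push_cast; ring, show (x : ℂ) + (-(ap / 2) : ℝ) * Complex.I = x - Complex.I * (ap / 2) by
        push_cast; ring]
      linear_combination (-(ap : ℂ) * (c₂ * x + c₁)) * Complex.I_sq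
    simp only [Function.comp]
    rw [e4, Complex.add_re, e2, Complex.re_ofReal_mul]
    simp
    ring
  have e₁ : c₁ = 0 := Complex.ext ((mul_eq_zero.1 hre.1).resolve_left hap.ne') him.2.1
  have e₂ : c₂ = -(alpha ap am / 2) := by
    have h : c₂.re = -(alpha ap am / 2) := by
      have := hre.2.1
      rw [alpha]
      field_simp at this ⊢
      linarith
    apply Complex.ext
    · rw [h, show (alpha ap am / 2 : ℂ) = ((alpha ap am / 2 : ℝ) : ℂ) by push_cast; rfl]; simp
    · rw [show (alpha ap am / 2 : ℂ) = ((alpha ap am / 2 : ℝ) : ℂ) by push_cast; rfl,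
        Complex.neg_im, Complex.ofReal_im]
      linarith [him.2.2]
  refine ⟨-c₀, fun B hB => ?_⟩
  obtain ⟨C, hC⟩ := hc₀ B hB
  obtain ⟨C', hC'⟩ := hc₁ B hB
  refine ⟨max C C', fun z hz0 hz => ⟨?_, ?_⟩⟩
  · have h := hC z hz0 hz
    rw [e₁, e₂] at h
    refine le_trans (le_of_eq ?_) (h.trans (by gcongr; exact le_max_left _ _))
    congr 1; ring
  · have h := hC' z hz0 hz
    rw [e₁, e₂] at h
    refine le_trans (le_of_eq ?_) (h.trans (by gcongr; exact le_max_right _ _))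
    congr 1; ring

end


/-! ### The normalized function Φ and the Fourier transform of Φ'. -/

/-- The difference of `gLog` and its asymptotics for `Re z → ∞`. -/
noncomputable def gRem (ap am : ℝ) (χ z : ℂ) : ℂ := gLog ap am z + χ + alpha ap am * z ^ 2 / 4

/-- The hyperbolic gamma function divided by its asymptotics for `Re z → ∞`. -/
noncomputable def gPhi (ap am : ℝ) (χ z : ℂ) : ℂ := Complex.exp (Complex.I * gRem ap am χ z)

noncomputable def gPhi₁ (ap am : ℝ) (χ z : ℂ) : ℂ :=
  Complex.I * (gLog₁ ap am z + alpha ap am * z / 2) * gPhi ap am χ z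

section
variable {ap am : ℝ} {χ : ℂ}

lemma gLog₁_neg (z : ℂ) : gLog₁ ap am (-z) = gLog₁ ap am z := by
  rw [gLog₁, gLog₁]
  congr 1; ext t
  rw [gKer₁, gKer₁, mul_neg, Complex.cos_neg]

/-- Oddness of g carries the asymptotics at Re z → ∞ over to Re z → -∞, where the quadratic term
doubles instead of cancelling. -/
lemma gRem_reflect (z : ℂ) :
    gRem ap am χ z = 2 * χ + alpha ap am * z ^ 2 / 2 - gRem ap am χ (-z) := by
  rw [gRem, gRem, gLog_neg]; ring

lemma gPhi_comm (ap am : ℝ) (χ z : ℂ) : gPhi ap am χ z = gPhi am ap χ z := by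
  rw [gPhi, gPhi, gRem, gRem, gLog_comm, alpha_comm]

lemma gPhi₁_comm (ap am : ℝ) (χ z : ℂ) : gPhi₁ ap am χ z = gPhi₁ am ap χ z := by
  rw [gPhi₁, gPhi₁, gLog₁_comm, alpha_comm, gPhi_comm]

lemma gPhi_eq (z : ℂ) : gPhi ap am χ z =
    gExp ap am z * Complex.exp (Complex.I * (χ + alpha ap am * z ^ 2 / 4)) := by
  rw [gPhi, gExp, gRem, ← Complex.exp_add]; ring_nf

lemma gPhi_ne_zero (z : ℂ) : gPhi ap am χ z ≠ 0 := Complex.exp_ne_zero _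

lemma hasDerivAt_gPhi (hap : 0 < ap) (ham : 0 < am) {z : ℂ} (hz : z ∈ strip ap am) :
    HasDerivAt (gPhi ap am χ) (gPhi₁ ap am χ z) z := by
  have h1 : HasDerivAt (gRem ap am χ) (gLog₁ ap am z + alpha ap am * z / 2) z := by
    have := ((hasDerivAt_gLog hap ham hz).add_const χ).add
      ((((hasDerivAt_id z).pow 2).const_mul (alpha ap am : ℂ)).div_const 4)
    refine this.congr_deriv ?_
    simp; ring
  refine (h1.const_mul Complex.I).cexp.congr_deriv ?_
  rw [gPhi₁, gPhi]; ring

lemma differentiableOn_gPhi (hap : 0 < ap) (ham : 0 < am) :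
    DifferentiableOn ℂ (gPhi ap am χ) (strip ap am) := fun _ hz =>
  (hasDerivAt_gPhi hap ham hz).differentiableAt.differentiableWithinAt

lemma differentiableOn_gPhi₁ (hap : 0 < ap) (ham : 0 < am) :
    DifferentiableOn ℂ (gPhi₁ ap am χ) (strip ap am) :=
  ((differentiableOn_gPhi hap ham).deriv isOpen_strip).congr fun _ hz =>
    (hasDerivAt_gPhi hap ham hz).deriv.symm

lemma IsPhase.exists_bound (hχ : IsPhase ap am χ) (hap : 0 < ap) (ham : 0 < am) {B : ℝ}
    (hB : B < mean ap am) :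
    ∃ C > 0, ∀ z : ℂ, 0 ≤ z.re → |z.im| ≤ B →
      ‖gRem ap am χ z‖ ≤ C * Real.exp (-decayRate ap am * z.re) ∧ ‖gRem ap am χ z‖ ≤ C ∧
      ‖gLog₁ ap am z + alpha ap am * z / 2‖ ≤ C * Real.exp (-decayRate ap am * z.re) := by
  obtain ⟨C, hC⟩ := hχ B hB
  have hr := decayRate_pos hap ham
  refine ⟨max C 1, by positivity, fun z hz0 hz => ?_⟩
  obtain ⟨h1, h2⟩ := hC z hz0 hz
  have h3 : C * Real.exp (-decayRate ap am * z.re) ≤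
    max C 1 * Real.exp (-decayRate ap am * z.re) := by gcongr; exact le_max_left _ _
  have h4 : Real.exp (-decayRate ap am * z.re) ≤ 1 := Real.exp_le_one_iff.2 (by nlinarith)
  refine ⟨h1.trans h3, (h1.trans h3).trans (mul_le_of_le_one_right (by positivity) h4),
    h2.trans h3⟩

/-- Upper and lower bounds on `|Im gRem|`. -/
lemma IsPhase.exists_abs_im_gRem_le (hχ : IsPhase ap am χ) (hap : 0 < ap) (ham : 0 < am) {B : ℝ}
    (hB : B < mean ap am) :
    ∃ C, ∀ z : ℂ, |z.im| ≤ B →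
      |(gRem ap am χ z).im + alpha ap am * max (-z.re) 0 * z.im| ≤ C := by
  obtain ⟨C, hC0, hC⟩ := hχ.exists_bound hap ham hB
  refine ⟨2 * ‖χ‖ + C, fun z hz => ?_⟩
  rcases le_total 0 z.re with h | h
  · rw [max_eq_right (by linarith), mul_zero, zero_mul, add_zero]
    have := (Complex.abs_im_le_norm _).trans (hC z h hz).2.1
    linarith [norm_nonneg χ]
  · rw [max_eq_left (by linarith)]
    have h1 := (Complex.abs_im_le_norm _).trans (hC (-z) (by simpa using h) (by simpa using hz)).2.1
    have h2 : (gRem ap am χ z).im + alpha ap am * -z.re * z.im =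
        2 * χ.im - (gRem ap am χ (-z)).im := by
      rw [gRem_reflect]
      have e : (alpha ap am * z ^ 2 / 2 : ℂ).im = alpha ap am * z.re * z.im := by
        rw [show (alpha ap am * z ^ 2 / 2 : ℂ) = ((alpha ap am / 2 : ℝ) : ℂ) * (z * z) by
          push_cast; ring, Complex.im_ofReal_mul, Complex.mul_im]
        ring
      rw [Complex.sub_im, Complex.add_im, e]
      simp
      ring
    rw [h2]
    have h3 := Complex.abs_im_le_norm χ
    rw [abs_le] at *
    constructor <;> linarith [h1.1, h1.2, h3.1, h3.2]

lemma norm_gPhi (z : ℂ) : ‖gPhi ap am χ z‖ = Real.exp (-(gRem ap am χ z).im) := by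
  rw [gPhi, Complex.norm_exp, Complex.I_mul_re]

lemma IsPhase.exists_norm_gPhi_le (hχ : IsPhase ap am χ) (hap : 0 < ap) (ham : 0 < am) {B : ℝ}
    (hB : B < mean ap am) :
    ∃ K > 0, ∀ z : ℂ, |z.im| ≤ B →
      ‖gPhi ap am χ z‖ ≤ K * Real.exp (alpha ap am * max (-z.re) 0 * z.im) := by
  obtain ⟨C, hC⟩ := hχ.exists_abs_im_gRem_le hap ham hB
  refine ⟨Real.exp C, Real.exp_pos _, fun z hz => ?_⟩
  rw [norm_gPhi, ← Real.exp_add]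
  apply Real.exp_le_exp.2
  linarith [(abs_le.1 (hC z hz)).1]

lemma exists_one_add_le_exp {ε : ℝ} (hε : 0 < ε) :
    ∃ K > 0, ∀ x : ℝ, 0 ≤ x → 1 + x ≤ K * Real.exp (ε * x) := by
  refine ⟨1 + 1 / ε, by positivity, fun x hx => ?_⟩
  have h1 := Real.add_one_le_exp (ε * x)
  have h2 : (1 : ℝ) ≤ Real.exp (ε * x) := Real.one_le_exp (by positivity)
  have h3 : x ≤ 1 / ε * Real.exp (ε * x) := by
    rw [one_div, inv_mul_eq_div, le_div_iff₀ hε]; nlinarith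
  nlinarith

/-- To the right the logarithmic derivative of Φ decays at the rate of g. To the left evenness of g'
makes it grow linearly, and ε absorbs this factor. -/
lemma IsPhase.exists_norm_gPhi₁_le (hχ : IsPhase ap am χ) (hap : 0 < ap) (ham : 0 < am) {B ε : ℝ}
    (hB : B < mean ap am) (hε : 0 < ε) :
    ∃ K > 0, ∀ z : ℂ, |z.im| ≤ B →
      ‖gPhi₁ ap am χ z‖ ≤ K * Real.exp (-decayRate ap am * max z.re 0 + ε * max (-z.re) 0 +
        alpha ap am * max (-z.re) 0 * z.im) := by
  obtain ⟨C, hC0, hC⟩ := hχ.exists_bound hap ham hB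
  obtain ⟨K, hK0, hK⟩ := hχ.exists_norm_gPhi_le hap ham hB
  obtain ⟨M, hM0, hM⟩ := exists_one_add_le_exp hε
  have hα := alpha_pos hap ham
  set N := C + alpha ap am * (|B| + 1) with hN
  have hN0 : 0 < N := by positivity
  have key : ∀ z : ℂ, |z.im| ≤ B → ‖gLog₁ ap am z + alpha ap am * z / 2‖ ≤
      N * (M + 1) * Real.exp (-decayRate ap am * max z.re 0 + ε * max (-z.re) 0) := by
    intro z hz
    rcases le_total 0 z.re with h | h
    · rw [max_eq_right (by linarith : -z.re ≤ 0), max_eq_left h, mul_zero, add_zero]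
      refine (hC z h hz).2.2.trans ?_
      gcongr
      have : 0 ≤ alpha ap am * (|B| + 1) := by positivity
      nlinarith
    · rw [max_eq_right h, max_eq_left (by linarith : 0 ≤ -z.re), mul_zero, zero_add]
      have h0 := hC (-z) (by simpa using h) (by simpa using hz)
      have h1 : ‖gLog₁ ap am (-z) + alpha ap am * -z / 2‖ ≤ C := by
        refine h0.2.2.trans (mul_le_of_le_one_right hC0.le (Real.exp_le_one_iff.2 ?_))
        have := decayRate_pos hap ham
        simp only [Complex.neg_re]
        nlinarith
      have e : gLog₁ ap am z + alpha ap am * z / 2 =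
          (gLog₁ ap am (-z) + alpha ap am * -z / 2) + alpha ap am * z := by
        rw [gLog₁_neg]; ring
      have h2 : ‖(alpha ap am : ℂ) * z‖ ≤ alpha ap am * (-z.re + |B|) := by
        rw [norm_mul, Complex.norm_real, Real.norm_of_nonneg hα.le]
        gcongr
        refine (Complex.norm_le_abs_re_add_abs_im z).trans ?_
        rw [abs_of_nonpos h]
        linarith [le_abs_self B]
      have h3 := hM (-z.re) (by linarith)
      have h4 : 0 ≤ Real.exp (ε * -z.re) := (Real.exp_pos _).le
      rw [e]
      calc _ ≤ C + alpha ap am * (-z.re + |B|) := (norm_add_le _ _).trans (add_le_add h1 h2)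
        _ ≤ N * (1 + -z.re) := by
          have : 0 ≤ C * (-z.re) := mul_nonneg hC0.le (by linarith)
          have : 0 ≤ alpha ap am * (|B| * -z.re) :=
            mul_nonneg hα.le (mul_nonneg (abs_nonneg _) (by linarith))
          rw [hN]; nlinarith
        _ ≤ N * (M * Real.exp (ε * -z.re)) := by gcongr
        _ ≤ _ := by nlinarith
  refine ⟨N * (M + 1) * K, by positivity, fun z hz => ?_⟩
  rw [gPhi₁, norm_mul, norm_mul, Complex.norm_I, one_mul, Real.exp_add]
  calc _ ≤ (N * (M + 1) * Real.exp (-decayRate ap am * max z.re 0 + ε * max (-z.re) 0)) *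
        (K * Real.exp (alpha ap am * max (-z.re) 0 * z.im)) :=
        mul_le_mul (key z hz) (hK z hz) (norm_nonneg _) (by positivity)
    _ = _ := by ring

lemma norm_exp_I_mul (z y : ℂ) : ‖Complex.exp (Complex.I * alpha ap am * z * y)‖ =
    Real.exp (-alpha ap am * (z.re * y.im + z.im * y.re)) := by
  rw [Complex.norm_exp, show Complex.I * alpha ap am * z * y =
    (alpha ap am : ℂ) * (Complex.I * (z * y)) by ring, Complex.re_ofReal_mul, Complex.I_mul_re,
    Complex.mul_im]
  ring_nf

lemma max_sub_max_neg (x : ℝ) : max x 0 - max (-x) 0 = x := by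
  rcases le_total 0 x with h | h
  · rw [max_eq_left h, max_eq_right (by linarith)]; ring
  · rw [max_eq_right h, max_eq_left (by linarith)]; ring

lemma max_add_max_neg (x : ℝ) : max x 0 + max (-x) 0 = |x| := by
  rcases le_total 0 x with h | h
  · rw [max_eq_left h, max_eq_right (by linarith), abs_of_nonneg h]; ring
  · rw [max_eq_right h, max_eq_left (by linarith), abs_of_nonpos h]; ring

/-- The integrand of the Fourier transform of the derivative of `gPhi`. -/
noncomputable def ftKer (ap am : ℝ) (χ y z : ℂ) : ℂ :=
  gPhi₁ ap am χ z * Complex.exp (Complex.I * alpha ap am * z * y)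

/-- The first condition on κ controls Re z → ∞ and the second Re z → -∞. The factor 2 in the latter
pays for the loss ε = κ in `IsPhase.exists_norm_gPhi₁_le`. -/
lemma IsPhase.exists_norm_ftKer_le (hχ : IsPhase ap am χ) (hap : 0 < ap) (ham : 0 < am) {B κ : ℝ}
    (hB : B < mean ap am) (hκ : 0 < κ) :
    ∃ K > 0, ∀ z y : ℂ, |z.im| ≤ B → κ ≤ decayRate ap am + alpha ap am * y.im →
      2 * κ ≤ -alpha ap am * (z.im + y.im) →
      ‖ftKer ap am χ y z‖ ≤ K * Real.exp (-κ * |z.re|) *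
        Real.exp (-alpha ap am * (z.im * y.re)) := by
  obtain ⟨K, hK0, hK⟩ := hχ.exists_norm_gPhi₁_le hap ham hB hκ
  refine ⟨K, hK0, fun z y hz h1 h2 => ?_⟩
  rw [ftKer, norm_mul, norm_exp_I_mul]
  refine (mul_le_mul_of_nonneg_right (hK z hz) (Real.exp_pos _).le).trans ?_
  rw [mul_assoc K, mul_assoc K, ← Real.exp_add, ← Real.exp_add]
  gcongr K * Real.exp ?_
  rw [← max_add_max_neg z.re]
  conv_lhs => rw [← max_sub_max_neg z.re]
  rw [max_sub_max_neg z.re]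
  have hp : 0 ≤ max z.re 0 := le_max_right _ _
  have hm : 0 ≤ max (-z.re) 0 := le_max_right _ _
  have e : z.re * y.im = max z.re 0 * y.im - max (-z.re) 0 * y.im := by
    rw [← sub_mul, max_sub_max_neg]
  rw [e]
  nlinarith [mul_le_mul_of_nonneg_right h1 hp, mul_le_mul_of_nonneg_right h2 hm]

lemma IsPhase.exists_norm_gPhi_mul_exp_le (hχ : IsPhase ap am χ) (hap : 0 < ap) (ham : 0 < am)
    {B : ℝ} (hB : B < mean ap am) :
    ∃ K > 0, ∀ (κ : ℝ) (z y : ℂ), |z.im| ≤ B → κ ≤ alpha ap am * y.im →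
      κ ≤ -alpha ap am * (z.im + y.im) →
      ‖gPhi ap am χ z * Complex.exp (Complex.I * alpha ap am * z * y)‖ ≤
        K * Real.exp (-κ * |z.re|) * Real.exp (-alpha ap am * (z.im * y.re)) := by
  obtain ⟨K, hK0, hK⟩ := hχ.exists_norm_gPhi_le hap ham hB
  refine ⟨K, hK0, fun κ z y hz h1 h2 => ?_⟩
  rw [norm_mul, norm_exp_I_mul]
  refine (mul_le_mul_of_nonneg_right (hK z hz) (Real.exp_pos _).le).trans ?_
  rw [mul_assoc K, mul_assoc K, ← Real.exp_add, ← Real.exp_add]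
  gcongr K * Real.exp ?_
  rw [← max_add_max_neg z.re]
  have hp : 0 ≤ max z.re 0 := le_max_right _ _
  have hm : 0 ≤ max (-z.re) 0 := le_max_right _ _
  have e : z.re * y.im = max z.re 0 * y.im - max (-z.re) 0 * y.im := by
    rw [← sub_mul, max_sub_max_neg]
  rw [e]
  nlinarith [mul_le_mul_of_nonneg_right h1 hp, mul_le_mul_of_nonneg_right h2 hm]

/-- The Fourier transform of the derivative of `gPhi` along the line `Im z = s`. -/
noncomputable def ftInt (ap am : ℝ) (χ : ℂ) (s : ℝ) (y : ℂ) : ℂ :=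
  ∫ v : ℝ, ftKer ap am χ y (v + s * Complex.I)

lemma differentiableOn_ftKer (hap : 0 < ap) (ham : 0 < am) (y : ℂ) :
    DifferentiableOn ℂ (ftKer ap am χ y) (strip ap am) :=
  (differentiableOn_gPhi₁ hap ham).mul (Differentiable.differentiableOn (by fun_prop))

lemma line_mem_strip {s : ℝ} (hs : |s| < mean ap am) (v : ℝ) :
    (v : ℂ) + s * Complex.I ∈ strip ap am := by
  change |((v : ℂ) + s * Complex.I).im| < mean ap am
  simpa using hs

lemma continuous_line_of_differentiableOn {f : ℂ → ℂ} (hf : DifferentiableOn ℂ f (strip ap am))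
    {s : ℝ} (hs : |s| < mean ap am) : Continuous fun v : ℝ => f (v + s * Complex.I) :=
  hf.continuousOn.comp_continuous (by fun_prop) (line_mem_strip hs)

lemma exists_rate {ap am : ℝ} {s t : ℝ} (h1 : 0 < decayRate ap am + alpha ap am * t)
    (h2 : 0 < -alpha ap am * (s + t)) : ∃ κ > 0, κ ≤ decayRate ap am + alpha ap am * t ∧
      2 * κ ≤ -alpha ap am * (s + t) :=
  ⟨min (decayRate ap am + alpha ap am * t) (-alpha ap am * (s + t) / 2),
    lt_min h1 (by linarith), min_le_left _ _, by
      linarith [min_le_right (decayRate ap am + alpha ap am * t) (-alpha ap am * (s + t) / 2)]⟩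

lemma IsPhase.integrable_ftKer (hχ : IsPhase ap am χ) (hap : 0 < ap) (ham : 0 < am) {s : ℝ}
    (hs : |s| < mean ap am) {y : ℂ} (h1 : 0 < decayRate ap am + alpha ap am * y.im)
    (h2 : s + y.im < 0) : Integrable fun v : ℝ => ftKer ap am χ y (v + s * Complex.I) := by
  obtain ⟨κ, hκ, k1, k2⟩ := exists_rate h1 (s := s) (by nlinarith [alpha_pos hap ham])
  obtain ⟨K, hK0, hK⟩ := hχ.exists_norm_ftKer_le hap ham hs hκ
  refine Integrable.mono' (((integrable_exp_neg_mul_abs hκ).const_mul K).mul_const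
    (Real.exp (-alpha ap am * (s * y.re))))
    (continuous_line_of_differentiableOn (differentiableOn_ftKer hap ham y) hs).aestronglyMeasurable
    (ae_of_all _ fun v => ?_)
  simpa using hK (v + s * Complex.I) y (by simp) k1 (by simpa using k2)

lemma IsPhase.ftInt_eq (hχ : IsPhase ap am χ) (hap : 0 < ap) (ham : 0 < am) {s₁ s₂ : ℝ}
    (hs₁ : |s₁| < mean ap am) (hs₂ : |s₂| < mean ap am) {y : ℂ}
    (h : 0 < decayRate ap am + alpha ap am * y.im) (h₁ : s₁ + y.im < 0) (h₂ : s₂ + y.im < 0) :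
    ftInt ap am χ s₁ y = ftInt ap am χ s₂ y := by
  have hα := alpha_pos hap ham
  obtain ⟨κ, hκ, k1, k2⟩ := exists_rate (s := max s₁ s₂) h (by
    have : max s₁ s₂ + y.im < 0 := by rcases max_choice s₁ s₂ with e | e <;> rw [e] <;> assumption
    nlinarith)
  obtain ⟨K, hK0, hK⟩ := hχ.exists_norm_ftKer_le hap ham
    (B := max |s₁| |s₂|) (max_lt hs₁ hs₂) hκ
  have hs : ∀ s ∈ Set.uIcc s₁ s₂, |s| ≤ max |s₁| |s₂| := fun s hs => by
    rw [abs_le]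
    have hlow : -max |s₁| |s₂| ≤ min s₁ s₂ := by
      rcases min_choice s₁ s₂ with e | e <;> rw [e]
      · linarith [neg_abs_le s₁, le_max_left |s₁| |s₂|]
      · linarith [neg_abs_le s₂, le_max_right |s₁| |s₂|]
    have hup : max s₁ s₂ ≤ max |s₁| |s₂| := max_le_max (le_abs_self _) (le_abs_self _)
    exact ⟨hlow.trans hs.1, hs.2.trans hup⟩
  have hbd : ∀ x : ℝ, ∀ s ∈ Set.uIcc s₁ s₂, ‖ftKer ap am χ y (x + s * Complex.I)‖ ≤
      K * Real.exp (alpha ap am * (max |s₁| |s₂| * |y.re|)) * Real.exp (-κ * |x|) := by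
    intro x s hs'
    have h3 := hK (x + s * Complex.I) y (by simpa using hs s hs') k1 (by
      have h5 : s ≤ max s₁ s₂ := hs'.2
      simp only [Complex.add_im, Complex.ofReal_im, Complex.mul_im, Complex.ofReal_re,
        Complex.I_im, mul_one, Complex.I_re, mul_zero, add_zero, zero_add]
      nlinarith)
    have h4 : -(s * y.re) ≤ max |s₁| |s₂| * |y.re| := by
      refine (neg_le_abs _).trans ?_
      rw [abs_mul]
      gcongr
      exact hs s hs'
    simp only [Complex.add_im, Complex.ofReal_im, Complex.mul_im, Complex.ofReal_re,
      Complex.I_im, mul_one, Complex.I_re, mul_zero, add_zero, zero_add, Complex.add_re,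
      Complex.mul_re, sub_self] at h3
    refine h3.trans ?_
    rw [mul_right_comm]
    gcongr K * Real.exp ?_ * _
    nlinarith
  refine integral_horizontal_shift ((differentiableOn_ftKer hap ham y).mono fun z hz =>
    (hs z.im hz).trans_lt (max_lt hs₁ hs₂)) hbd ?_ ?_ (hχ.integrable_ftKer hap ham hs₁ h h₁)
    (hχ.integrable_ftKer hap ham hs₂ h h₂)
  · simpa using (tendsto_exp_neg_mul_abs_atTop hκ).const_mul _
  · simpa using (tendsto_exp_neg_mul_abs_atBot hκ).const_mul _

lemma IsPhase.differentiableOn_ftInt (hχ : IsPhase ap am χ) (hap : 0 < ap) (ham : 0 < am) {s : ℝ}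
    (hs : |s| < mean ap am) : DifferentiableOn ℂ (ftInt ap am χ s)
      {y | 0 < decayRate ap am + alpha ap am * y.im ∧ s + y.im < 0} := by
  have hα := alpha_pos hap ham
  have hdom : DominatedOn volume {y | 0 < decayRate ap am + alpha ap am * y.im ∧ s + y.im < 0}
      (fun y v => ftKer ap am χ y (v + s * Complex.I)) := by
    intro y₀ hy₀
    obtain ⟨κ, hκ, k1, k2⟩ := exists_rate hy₀.1 (s := s) (by nlinarith [hy₀.2])
    obtain ⟨K, hK0, hK⟩ := hχ.exists_norm_ftKer_le hap ham hs (half_pos hκ)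
    set ρ := κ / (2 * alpha ap am) with hρ
    have hρ0 : 0 < ρ := by positivity
    have hρα : alpha ap am * ρ = κ / 2 := by rw [hρ]; field_simp
    have hball : ∀ y ∈ Metric.ball y₀ ρ, κ / 2 ≤ decayRate ap am + alpha ap am * y.im ∧
        2 * (κ / 2) ≤ -alpha ap am * (s + y.im) ∧ |y.re| ≤ |y₀.re| + ρ := by
      intro y hy
      rw [Metric.mem_ball, dist_eq_norm] at hy
      have h1 := (Complex.abs_im_le_norm (y - y₀)).trans hy.le
      have h2 := (Complex.abs_re_le_norm (y - y₀)).trans hy.le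
      rw [Complex.sub_im, abs_le] at h1
      rw [Complex.sub_re] at h2
      refine ⟨by nlinarith [h1.1], by nlinarith [h1.2], ?_⟩
      linarith [abs_sub_abs_le_abs_sub y.re y₀.re]
    refine ⟨ρ, hρ0, fun y hy => ⟨by linarith [(hball y hy).1], ?_⟩,
      fun v => K * Real.exp (-(κ / 2) * |v|) *
        Real.exp (alpha ap am * (|s| * (|y₀.re| + ρ))),
      ((integrable_exp_neg_mul_abs (half_pos hκ)).const_mul K).mul_const _,
      ae_of_all _ fun v y hy => ?_⟩
    · have := (hball y hy).2.1
      by_contra hcon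
      push Not at hcon
      nlinarith
    · obtain ⟨b1, b2, b3⟩ := hball y hy
      have h3 := hK (v + s * Complex.I) y (by simp) b1 (by simpa using b2)
      simp only [Complex.add_im, Complex.ofReal_im, Complex.mul_im, Complex.ofReal_re,
        Complex.I_im, mul_one, Complex.I_re, mul_zero, add_zero, zero_add, Complex.add_re,
        Complex.mul_re, sub_self] at h3
      refine h3.trans ?_
      have h4 : -(s * y.re) ≤ |s| * (|y₀.re| + ρ) := by
        refine (neg_le_abs _).trans ?_
        rw [abs_mul]
        gcongr
      refine mul_le_mul_of_nonneg_left (Real.exp_le_exp.2 ?_) (by positivity)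
      nlinarith
  intro y hy
  refine (hdom.hasDerivAt (F' := fun y v => ftKer ap am χ y (v + s * Complex.I) *
    (Complex.I * alpha ap am * (v + s * Complex.I))) (fun y _ => ?_) (fun y _ => ?_)
    (ae_of_all _ fun v y _ => ?_) hy).differentiableAt.differentiableWithinAt
  · exact (continuous_line_of_differentiableOn
      (differentiableOn_ftKer hap ham y) hs).aestronglyMeasurable
  · exact ((continuous_line_of_differentiableOn (differentiableOn_ftKer hap ham y) hs).mul
      (by fun_prop)).aestronglyMeasurable
  · have := ((hasDerivAt_id y).const_mul
      (Complex.I * alpha ap am * (v + s * Complex.I))).cexp.const_mul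
        (gPhi₁ ap am χ (v + s * Complex.I))
    refine this.congr_deriv ?_
    rw [ftKer]
    simp only [id, mul_one]
    ring

/-- The growth in Re y is dictated by the line of integration. Since the transform does not depend
on that line (`IsPhase.ftInt_eq`), the line can be chosen to suit y. -/
lemma IsPhase.exists_norm_ftInt_le (hχ : IsPhase ap am χ) (hap : 0 < ap) (ham : 0 < am) {s κ : ℝ}
    (hs : |s| < mean ap am) (hκ : 0 < κ) : ∃ K > 0, ∀ y : ℂ,
      κ ≤ decayRate ap am + alpha ap am * y.im → 2 * κ ≤ -alpha ap am * (s + y.im) →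
      ‖ftInt ap am χ s y‖ ≤ K * Real.exp (-alpha ap am * (s * y.re)) := by
  obtain ⟨K, hK0, hK⟩ := hχ.exists_norm_ftKer_le hap ham hs hκ
  have hI : 0 ≤ ∫ v : ℝ, Real.exp (-κ * |v|) := integral_nonneg fun v => (Real.exp_pos _).le
  refine ⟨K * (∫ v : ℝ, Real.exp (-κ * |v|)) + 1, by positivity, fun y k1 k2 => ?_⟩
  have h : ‖ftInt ap am χ s y‖ ≤
      ∫ v : ℝ, K * Real.exp (-κ * |v|) * Real.exp (-alpha ap am * (s * y.re)) := by
    refine norm_integral_le_of_norm_le (((integrable_exp_neg_mul_abs hκ).const_mul K).mul_const _)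
      (ae_of_all _ fun v => ?_)
    simpa using hK (v + s * Complex.I) y (by simp) k1 (by simpa using k2)
  rw [integral_mul_const, integral_const_mul] at h
  refine h.trans ?_
  gcongr
  linarith

end


/-! ### The difference equation for the Fourier transform. -/

section
variable {ap am : ℝ} {χ : ℂ}

lemma alpha_mul (hap : 0 < ap) (ham : 0 < am) : alpha ap am * (ap * am) = 2 * Real.pi := by
  rw [alpha]; field_simp

/-- The Gaussian normalization absorbs one of the two exponentials in 2 cosh. What remains, 1 plus
an exponential in z, becomes a shift of y under Fourier transformation. -/
lemma gPhi_add (hap : 0 < ap) (ham : 0 < am) {z : ℂ} (hz : |(z + Complex.I * (ap / 2)).im| < am / 2) :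
    gPhi ap am χ (z + Complex.I * ap) = (1 + Complex.exp (-alpha ap am * ap * z -
      Complex.I * alpha ap am * ap ^ 2 / 2)) * gPhi ap am χ z := by
  have h := gExp_diff hap ham hz
  rw [show z + Complex.I * (ap / 2) + Complex.I * (ap / 2) = z + Complex.I * ap by ring,
    show z + Complex.I * (ap / 2) - Complex.I * (ap / 2) = z by ring] at h
  have hpc : (ap : ℂ) ≠ 0 := by exact_mod_cast hap.ne'
  have hmc : (am : ℂ) ≠ 0 := by exact_mod_cast ham.ne'
  have hα : (alpha ap am : ℂ) = 2 * Real.pi / (ap * am) := by rw [alpha]; push_cast; rfl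
  rw [gPhi_eq, gPhi_eq, h, Complex.cosh, mul_div_cancel₀ _ two_ne_zero]
  set w := Real.pi * (z + Complex.I * (ap / 2)) / am with hw
  have e1 : -alpha ap am * ap * z - Complex.I * alpha ap am * ap ^ 2 / 2 = -w + -w := by
    rw [hw, hα]; field_simp; ring
  have e2 : Complex.I * (χ + alpha ap am * (z + Complex.I * ap) ^ 2 / 4) =
      Complex.I * (χ + alpha ap am * z ^ 2 / 4) + -w := by
    have : Complex.I * (χ + alpha ap am * (z + Complex.I * ap) ^ 2 / 4) =
        Complex.I * (χ + alpha ap am * z ^ 2 / 4) +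
          (Complex.I ^ 2 * (alpha ap am * ap * z / 2 + Complex.I * alpha ap am * ap ^ 2 / 4)) := by
      ring
    rw [this, Complex.I_sq]
    linear_combination e1 / 2
  rw [e1, e2, Complex.exp_add, Complex.exp_add, Complex.exp_neg]
  have := Complex.exp_ne_zero w
  field_simp

lemma gPhi₁_add (hap : 0 < ap) (ham : 0 < am) {z : ℂ} (hz₀ : z ∈ strip ap am)
    (hz₁ : z + Complex.I * ap ∈ strip ap am)
    (hz : |(z + Complex.I * (ap / 2)).im| < am / 2) :
    gPhi₁ ap am χ (z + Complex.I * ap) = gPhi₁ ap am χ z + Complex.exp (-alpha ap am * ap * z -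
      Complex.I * alpha ap am * ap ^ 2 / 2) * (gPhi₁ ap am χ z -
        alpha ap am * ap * gPhi ap am χ z) := by
  have h1 := (hasDerivAt_gPhi (χ := χ) hap ham hz₁).comp_add_const z (Complex.I * ap)
  have h2 := (((((hasDerivAt_id z).const_mul (-alpha ap am * ap : ℂ)).sub_const
    (Complex.I * alpha ap am * ap ^ 2 / 2)).cexp.const_add 1)).mul
    (hasDerivAt_gPhi (χ := χ) hap ham hz₀)
  have ho : IsOpen {w : ℂ | |(w + Complex.I * (ap / 2)).im| < am / 2} :=
    isOpen_lt (by fun_prop) continuous_const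
  have h3 := h2.congr_of_eventuallyEq (f₁ := fun w => gPhi ap am χ (w + Complex.I * ap)) (by
    filter_upwards [ho.mem_nhds hz] with w hw
    exact gPhi_add hap ham hw)
  rw [h1.unique h3]
  simp only [id, mul_one]
  ring

/-- Integration by parts. Now Φ itself, which tends to 1 and not to 0 on the right, must be
integrable against the exponential, whence 0 < Im y. -/
lemma IsPhase.integral_deriv_gPhi_mul_exp (hχ : IsPhase ap am χ) (hap : 0 < ap) (ham : 0 < am)
    {s : ℝ} (hs : |s| < mean ap am) {y : ℂ} (h1 : 0 < y.im) (h2 : s + y.im < 0) :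
    Integrable (fun v : ℝ => gPhi ap am χ (v + s * Complex.I) *
      Complex.exp (Complex.I * alpha ap am * (v + s * Complex.I) * y)) ∧
    ftInt ap am χ s y = -(Complex.I * alpha ap am * y) * ∫ v : ℝ,
      gPhi ap am χ (v + s * Complex.I) *
        Complex.exp (Complex.I * alpha ap am * (v + s * Complex.I) * y) := by
  have hα := alpha_pos hap ham
  have hr := decayRate_pos hap ham
  obtain ⟨K, hK0, hK⟩ := hχ.exists_norm_gPhi_mul_exp_le hap ham hs
  set κ := min (alpha ap am * y.im) (-alpha ap am * (s + y.im)) with hκ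
  have hκ0 : 0 < κ := lt_min (by positivity) (by nlinarith)
  set f : ℝ → ℂ := fun v => gPhi ap am χ (v + s * Complex.I) *
      Complex.exp (Complex.I * alpha ap am * (v + s * Complex.I) * y) with hf
  set M := K * Real.exp (-alpha ap am * (s * y.re)) with hM
  have hbd : ∀ v : ℝ, ‖f v‖ ≤ M * Real.exp (-κ * |v|) := by
    intro v
    have := hK κ (v + s * Complex.I) y (by simp) (min_le_left _ _)
      ((min_le_right _ _).trans_eq (by simp))
    rw [hM, mul_right_comm]
    simpa [hf] using this
  have hint : Integrable f := by
    refine Integrable.mono' ((integrable_exp_neg_mul_abs hκ0).const_mul M) ?_ (ae_of_all _ hbd)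
    exact ((continuous_line_of_differentiableOn (differentiableOn_gPhi hap ham) hs).mul
      (by fun_prop)).aestronglyMeasurable
  refine ⟨hint, ?_⟩
  have hder : ∀ v : ℝ, HasDerivAt f (ftKer ap am χ y (v + s * Complex.I) +
      Complex.I * alpha ap am * y * f v) v := by
    intro v
    have h3 : HasDerivAt (fun z : ℂ => gPhi ap am χ z *
        Complex.exp (Complex.I * alpha ap am * z * y)) (ftKer ap am χ y (v + s * Complex.I) +
      Complex.I * alpha ap am * y * f v) (v + s * Complex.I) := by
      have h4 : HasDerivAt (fun z : ℂ => Complex.exp (Complex.I * alpha ap am * z * y))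
          (Complex.exp (Complex.I * alpha ap am * (v + s * Complex.I) * y) *
            (Complex.I * alpha ap am * y)) (v + s * Complex.I) := by
        have := (((hasDerivAt_id ((v : ℂ) + s * Complex.I)).const_mul
          (Complex.I * alpha ap am)).mul_const y).cexp
        simpa using this
      refine ((hasDerivAt_gPhi hap ham (line_mem_strip hs v)).mul h4).congr_deriv ?_
      rw [ftKer, hf]; ring
    exact (h3.comp_add_const (v : ℂ) (s * Complex.I)).comp_ofReal
  have hint' := hχ.integrable_ftKer hap ham hs (y := y) (by positivity) h2
  have htop : Tendsto f atTop (𝓝 0) := squeeze_zero_norm hbd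
    (by simpa using (tendsto_exp_neg_mul_abs_atTop hκ0).const_mul M)
  have hbot : Tendsto f atBot (𝓝 0) := squeeze_zero_norm hbd
    (by simpa using (tendsto_exp_neg_mul_abs_atBot hκ0).const_mul M)
  have h := integral_of_hasDerivAt_of_tendsto hder (hint'.add (hint.const_mul _)) hbot htop
  rw [integral_add hint' (hint.const_mul _), integral_const_mul, sub_self] at h
  rw [ftInt]
  linear_combination h

/-- This is the Fourier transform of `gPhi₁_add`. Translating z by ia₊ produces the factor
e^{-αa₊y}, and multiplication by e^{-αa₊z} replaces y by y + ia₊. The term with undifferentiated Φ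
is turned back into `ftInt` by parts at y + ia₊, where the imaginary part is positive. -/
lemma IsPhase.ftInt_diff (hχ : IsPhase ap am χ) (hap : 0 < ap) (ham : 0 < am) {s : ℝ}
    (hs₀ : |s - ap| < mean ap am) (hs₁ : |s| < mean ap am) {y : ℂ}
    (h1 : 0 < decayRate ap am + alpha ap am * y.im) (h2 : s + y.im < 0) (h3 : 0 < y.im + ap) :
    (y + Complex.I * ap) * (Complex.exp (alpha ap am * ap * y) - 1) * ftInt ap am χ (s - ap) y =
      y * Complex.exp (-(Complex.I * alpha ap am * ap ^ 2 / 2)) *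
        ftInt ap am χ (s - ap) (y + Complex.I * ap) := by
  have hα := alpha_pos hap ham
  have hr := decayRate_pos hap ham
  set y' := y + Complex.I * ap with hy'
  have hy'im : y'.im = y.im + ap := by simp [hy']
  obtain ⟨i3, e3⟩ := hχ.integral_deriv_gPhi_mul_exp hap ham hs₀ (y := y') (by rw [hy'im]; exact h3)
    (by rw [hy'im]; linarith)
  have i1 := hχ.integrable_ftKer hap ham hs₀ h1 (by linarith)
  have i2 := hχ.integrable_ftKer hap ham hs₀ (y := y') (by rw [hy'im]; positivity)
    (by rw [hy'im]; linarith)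
  have hpt : ∀ v : ℝ, Complex.exp (alpha ap am * ap * y) * ftKer ap am χ y (v + s * Complex.I) =
      ftKer ap am χ y (v + (s - ap : ℝ) * Complex.I) +
      Complex.exp (-(Complex.I * alpha ap am * ap ^ 2 / 2)) *
        (ftKer ap am χ y' (v + (s - ap : ℝ) * Complex.I) - alpha ap am * ap *
          (gPhi ap am χ (v + (s - ap : ℝ) * Complex.I) *
          Complex.exp (Complex.I * alpha ap am * (v + (s - ap : ℝ) * Complex.I) * y'))) := by
    intro v
    set z : ℂ := v + (s - ap : ℝ) * Complex.I with hz
    have hz1 : (v : ℂ) + s * Complex.I = z + Complex.I * ap := by rw [hz]; push_cast; ring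
    have hm : ∀ s : ℝ, |s| < mean ap am ↔ -(ap + am) / 2 < s ∧ s < (ap + am) / 2 := by
      intro s; rw [abs_lt, mean, neg_div]
    rw [hm] at hs₀ hs₁
    have h := gPhi₁_add (χ := χ) hap ham (z := z)
      (line_mem_strip ((hm _).2 hs₀) v) (by rw [← hz1]; exact line_mem_strip ((hm _).2 hs₁) v) (by
        have : (z + Complex.I * (ap / 2)).im = s - ap / 2 := by
          rw [hz, show (ap / 2 : ℂ) = ((ap / 2 : ℝ) : ℂ) by push_cast; rfl]; simp; ring
        rw [this, abs_lt]
        constructor <;> linarith [hs₀.1, hs₁.2])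
    rw [hz1, ftKer, h, ftKer, ftKer]
    have e1 : Complex.exp (Complex.I * alpha ap am * (z + Complex.I * ap) * y) =
        Complex.exp (Complex.I * alpha ap am * z * y) * Complex.exp (-(alpha ap am * ap * y)) := by
      rw [← Complex.exp_add]
      congr 1
      linear_combination (alpha ap am * ap * y) * Complex.I_sq
    have e2 : Complex.exp (Complex.I * alpha ap am * z * y') =
        Complex.exp (Complex.I * alpha ap am * z * y) * Complex.exp (-alpha ap am * ap * z) := by
      rw [← Complex.exp_add, hy']
      congr 1
      linear_combination (alpha ap am * ap * z) * Complex.I_sq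
    rw [e1, e2, sub_eq_add_neg (-(alpha ap am : ℂ) * ap * z), Complex.exp_add, Complex.exp_neg
      (alpha ap am * ap * y)]
    have := Complex.exp_ne_zero (alpha ap am * ap * y)
    field_simp
  have hI : Complex.exp (alpha ap am * ap * y) * ftInt ap am χ s y =
      ftInt ap am χ (s - ap) y + Complex.exp (-(Complex.I * alpha ap am * ap ^ 2 / 2)) *
        (ftInt ap am χ (s - ap) y' - alpha ap am * ap * ∫ v : ℝ,
          (gPhi ap am χ (v + (s - ap : ℝ) * Complex.I) *
          Complex.exp (Complex.I * alpha ap am * (v + (s - ap : ℝ) * Complex.I) * y'))) := by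
    have i4 : Integrable fun v : ℝ => Complex.exp (-(Complex.I * alpha ap am * ap ^ 2 / 2)) *
        (ftKer ap am χ y' (v + (s - ap : ℝ) * Complex.I) - alpha ap am * ap *
          (gPhi ap am χ (v + (s - ap : ℝ) * Complex.I) *
          Complex.exp (Complex.I * alpha ap am * (v + (s - ap : ℝ) * Complex.I) * y'))) :=
      (i2.sub (i3.const_mul _)).const_mul _
    rw [ftInt, ← integral_const_mul, funext hpt, integral_add i1 i4, integral_const_mul,
      integral_sub i2 (i3.const_mul _), integral_const_mul]
    rfl
  -- Moving the line from Im z = s back to Im z = s - a₊ leaves a relation between transforms on one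
  -- line only.
  rw [hχ.ftInt_eq hap ham hs₁ hs₀ h1 h2 (by linarith)] at hI
  have hαc : (alpha ap am : ℂ) ≠ 0 := by exact_mod_cast hα.ne'
  have key : Complex.I * alpha ap am * (y' * (Complex.exp (alpha ap am * ap * y) - 1) *
      ftInt ap am χ (s - ap) y) = Complex.I * alpha ap am * (y *
        Complex.exp (-(Complex.I * alpha ap am * ap ^ 2 / 2)) * ftInt ap am χ (s - ap) y') := by
    generalize (∫ v : ℝ, (gPhi ap am χ (v + (s - ap : ℝ) * Complex.I) *
          Complex.exp (Complex.I * alpha ap am * (v + (s - ap : ℝ) * Complex.I) * y'))) = J at *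
    generalize Complex.exp (-(Complex.I * alpha ap am * ap ^ 2 / 2)) = Q at *
    generalize Complex.exp (alpha ap am * ap * y) = P at *
    generalize ftInt ap am χ (s - ap) y = D at *
    generalize ftInt ap am χ (s - ap) y' = D' at *
    have hyy : y = y' - Complex.I * ap := by rw [hy']; ring
    rw [hyy]
    linear_combination (Complex.I * alpha ap am * y') * hI - (alpha ap am * Q * ap) * e3 +
      (alpha ap am * Q * D' * ap) * Complex.I_sq
  exact mul_left_cancel₀ (mul_ne_zero Complex.I_ne_zero hαc) key

/-! ### Exchange of a₊ and a₋, and a special value of G. -/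

/-- The two difference equations are compatible. -/
lemma sinh_mul_gExp (hap : 0 < ap) (ham : 0 < am) (y : ℝ) :
    Complex.sinh (Real.pi * y / am) * gExp ap am (Complex.I * ((am - ap) / 2) - y) =
      Complex.sinh (Real.pi * y / ap) * gExp ap am (Complex.I * ((ap - am) / 2) - y) := by
  have hpc : (ap : ℂ) ≠ 0 := by exact_mod_cast hap.ne'
  have hmc : (am : ℂ) ≠ 0 := by exact_mod_cast ham.ne'
  set L : ℝ → ℂ := fun ε => Complex.cosh (Real.pi * (-y + Complex.I * (am / 2 - ε)) / am) *
    gExp ap am (Complex.I * ((am - ap) / 2 - ε) - y) with hL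
  set R : ℝ → ℂ := fun ε => Complex.cosh (Real.pi * (-y + Complex.I * (ap / 2 - ε)) / ap) *
    gExp ap am (Complex.I * ((ap - am) / 2 - ε) - y) with hR
  have hcast : ∀ c ε : ℝ, (Complex.I * (c - ε : ℂ)).im = c - ε := by
    intro c ε
    rw [← Complex.ofReal_sub]; simp
  -- Both difference equations evaluate G at -y + i(a - ε), one with step ia₊ and the other with
  -- step ia₋. The line Im = a itself lies outside the strip, but after the common value is
  -- eliminated both sides are continuous at ε = 0.
  have heq : ∀ ε : ℝ, 0 < ε → ε < ap → ε < am → L ε = R ε := by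
    intro ε h0 hp hm
    have h1 := gExp_diff hap ham (z := -y + Complex.I * (am / 2 - ε)) (by
      have := hcast (am / 2) ε
      push_cast at this
      simp only [Complex.add_im, Complex.neg_im, Complex.ofReal_im, neg_zero, zero_add, this]
      rw [abs_lt]; constructor <;> linarith)
    have h2 := gExp_diff ham hap (z := -y + Complex.I * (ap / 2 - ε)) (by
      have := hcast (ap / 2) ε
      push_cast at this
      simp only [Complex.add_im, Complex.neg_im, Complex.ofReal_im, neg_zero, zero_add, this]
      rw [abs_lt]; constructor <;> linarith)
    rw [gExp_comm am ap, gExp_comm am ap] at h2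
    rw [show -(y : ℂ) + Complex.I * (ap / 2 - ε) + Complex.I * (am / 2) =
      -y + Complex.I * (am / 2 - ε) + Complex.I * (ap / 2) by ring, h1] at h2
    rw [show -(y : ℂ) + Complex.I * (am / 2 - ε) - Complex.I * (ap / 2) =
      Complex.I * ((am - ap) / 2 - ε) - y by ring,
      show -(y : ℂ) + Complex.I * (ap / 2 - ε) - Complex.I * (am / 2) =
      Complex.I * ((ap - am) / 2 - ε) - y by ring] at h2
    simp only [hL, hR]
    linear_combination h2 / 2
  have hcontE : ∀ c : ℝ, |c| < mean ap am →
      ContinuousAt (fun ε : ℝ => gExp ap am (Complex.I * (c - ε) - y)) 0 := by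
    intro c hc
    have h1 : Complex.I * (c - (0 : ℝ)) - y ∈ strip ap am := by
      change |(Complex.I * (c - (0 : ℝ)) - y : ℂ).im| < _
      simpa using hc
    have h2 := (differentiableOn_gExp hap ham).differentiableAt (isOpen_strip.mem_nhds h1)
    exact ContinuousAt.comp (f := fun ε : ℝ => Complex.I * ((c : ℂ) - ε) - y)
      h2.continuousAt (by fun_prop)
  have hLc : ContinuousAt L 0 := by
    have := hcontE ((am - ap) / 2) (by rw [mean, abs_lt]; constructor <;> linarith)
    push_cast at this
    exact ContinuousAt.mul (by fun_prop) this
  have hRc : ContinuousAt R 0 := by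
    have := hcontE ((ap - am) / 2) (by rw [mean, abs_lt]; constructor <;> linarith)
    push_cast at this
    exact ContinuousAt.mul (by fun_prop) this
  have h0 : L 0 = R 0 := by
    have l1 : Tendsto L (𝓝[>] 0) (𝓝 (L 0)) := hLc.tendsto.mono_left nhdsWithin_le_nhds
    have l2 : Tendsto R (𝓝[>] 0) (𝓝 (R 0)) := hRc.tendsto.mono_left nhdsWithin_le_nhds
    refine tendsto_nhds_unique (l1.congr' ?_) l2
    filter_upwards [Ioo_mem_nhdsGT (lt_min hap ham)] with ε hε
    exact heq ε hε.1 (hε.2.trans_le (min_le_left _ _)) (hε.2.trans_le (min_le_right _ _))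
  have hcosh : ∀ c : ℝ, 0 < c → Complex.cosh (Real.pi * (-y + Complex.I * (c / 2 - (0 : ℝ))) / c) =
      -(Complex.I * Complex.sinh (Real.pi * y / c)) := by
    intro c hc
    have hcc : (c : ℂ) ≠ 0 := by exact_mod_cast hc.ne'
    rw [show (Real.pi : ℂ) * (-y + Complex.I * (c / 2 - (0 : ℝ))) / c =
      -(Real.pi * y / c) + Real.pi / 2 * Complex.I by push_cast; field_simp; ring,
      Complex.cosh_add, Complex.cosh_mul_I, Complex.sinh_mul_I, Complex.sinh_neg]
    simp
    ring
  simp only [hL, hR] at h0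
  rw [hcosh am ham, hcosh ap hap] at h0
  simp only [Complex.ofReal_zero, sub_zero] at h0
  have h5 : (-Complex.I) * (Complex.sinh (Real.pi * y / am) *
      gExp ap am (Complex.I * ((am - ap) / 2) - y)) = (-Complex.I) *
      (Complex.sinh (Real.pi * y / ap) * gExp ap am (Complex.I * ((ap - am) / 2) - y)) := by
    linear_combination h0
  exact mul_left_cancel₀ (neg_ne_zero.2 Complex.I_ne_zero) h5

/-- Division by y and continuity extend the compatibility relation to y = 0, the only place where it
is not trivially 0 = 0 before division and where it evaluates G. -/
lemma sinhc_mul_gExp (hap : 0 < ap) (ham : 0 < am) (y : ℝ) :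
    ap * sinhc (Real.pi * y / am) * gExp ap am (Complex.I * ((am - ap) / 2) - y) =
      am * sinhc (Real.pi * y / ap) * gExp ap am (Complex.I * ((ap - am) / 2) - y) := by
  have hpc : (ap : ℂ) ≠ 0 := by exact_mod_cast hap.ne'
  have hmc : (am : ℂ) ≠ 0 := by exact_mod_cast ham.ne'
  have hπ : (Real.pi : ℂ) ≠ 0 := by exact_mod_cast Real.pi_ne_zero
  have hcont : ∀ {b c : ℝ}, |c| < mean ap am → Continuous fun y : ℝ =>
      sinhc (Real.pi * y / b) * gExp ap am (Complex.I * c - y) := by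
    intro b c hc
    refine (differentiable_sinhc.continuous.comp (by fun_prop)).mul ?_
    refine (differentiableOn_gExp hap ham).continuousOn.comp_continuous (by fun_prop) fun x => ?_
    change |(Complex.I * c - x : ℂ).im| < _
    simpa using hc
  have h1 := hcont (b := am) (c := (am - ap) / 2) (by rw [mean, abs_lt]; constructor <;> linarith)
  have h2 := hcont (b := ap) (c := (ap - am) / 2) (by rw [mean, abs_lt]; constructor <;> linarith)
  have h3 := (h1.const_mul (ap : ℂ)).ext_on (dense_compl_singleton (0 : ℝ))
    (h2.const_mul (am : ℂ)) (fun y hy => by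
      have hy0 : (y : ℂ) ≠ 0 := by exact_mod_cast hy
      have h := sinh_mul_gExp hap ham y
      push_cast
      rw [sinhc_of_ne (div_ne_zero (mul_ne_zero hπ hy0) hmc),
        sinhc_of_ne (div_ne_zero (mul_ne_zero hπ hy0) hpc)]
      generalize Complex.sinh (Real.pi * y / am) = s₁ at *
      generalize Complex.sinh (Real.pi * y / ap) = s₂ at *
      generalize gExp ap am (Complex.I * ((am - ap) / 2) - y) = g₁ at *
      generalize gExp ap am (Complex.I * ((ap - am) / 2) - y) = g₂ at *
      field_simp
      linear_combination h)
  have h4 := congrFun h3 y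
  push_cast at h4
  linear_combination h4

/-- With E = G(i(a₋ - a₊)/2), the relation at y = 0 reads a₊E = a₋/E because G(-z) = 1/G(z); E is
positive by `gLog_I_mul`. -/
lemma gExp_special (hap : 0 < ap) (ham : 0 < am) :
    gExp ap am (Complex.I * ((am - ap) / 2)) = ((√(am / ap) : ℝ) : ℂ) := by
  have h := sinhc_mul_gExp hap ham 0
  simp only [Complex.ofReal_zero, mul_zero, zero_div, sinhc_zero, mul_one, sub_zero] at h
  rw [show Complex.I * (((ap : ℂ) - am) / 2) = -(Complex.I * ((am - ap) / 2)) by ring,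
    gExp_neg] at h
  obtain ⟨ρ, hρ⟩ := gLog_I_mul (ap := ap) (am := am) ((am - ap) / 2)
  have e : gExp ap am (Complex.I * ((am - ap) / 2)) = ((Real.exp (-ρ) : ℝ) : ℂ) := by
    push_cast at hρ
    rw [gExp, hρ, ← mul_assoc, Complex.I_mul_I]
    push_cast
    ring_nf
  rw [e] at h ⊢
  have h2 : ap * Real.exp (-ρ) = am * (Real.exp (-ρ))⁻¹ := by exact_mod_cast h
  congr 1
  symm
  rw [Real.sqrt_eq_iff_mul_self_eq_of_pos (Real.exp_pos _)]
  have := Real.exp_pos (-ρ)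
  field_simp at h2 ⊢
  linarith

end


/-! ### Evaluation of the Fourier transform of Φ'. -/

/-- The reciprocal of the Fourier transform `ftInt`. -/
noncomputable def ftMul (ap am : ℝ) (y : ℂ) : ℂ :=
  ap / √(ap * am) * sinhc (Real.pi * y / am) *
    Complex.exp (-(alpha ap am * mean ap am * y / 2) + Complex.I * alpha ap am * y ^ 2 / 4) *
    gExp ap am (Complex.I * ((am - ap) / 2) - y)

section
variable {ap am : ℝ} {χ : ℂ}

lemma ofReal_alpha : (alpha ap am : ℂ) = 2 * Real.pi / (ap * am) := by
  rw [alpha]; push_cast; rfl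

lemma ofReal_mean : (mean ap am : ℂ) = (ap + am) / 2 := by
  rw [mean]; push_cast; rfl

lemma I_mul_sub_im (d : ℝ) (y : ℂ) : (Complex.I * d - y).im = d - y.im := by simp

/-- The hyperbolic cosine in the difference equation of G becomes -i sinh(π(y + ia₊)/a₋), which
supplies y + ia₊ times the `sinhc` factor of the shifted function. The resulting multiplier is
inverse to the one in `IsPhase.ftInt_diff`. -/
lemma ftMul_diff (hap : 0 < ap) (ham : 0 < am) {y : ℂ} (h1 : -ap < y.im) (h2 : y.im < am - ap) :
    (y + Complex.I * ap) * ftMul ap am (y + Complex.I * ap) *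
      (-2 * Complex.I * Complex.sinh (Real.pi * y / am)) = y * ftMul ap am y *
      Complex.exp (-(Complex.I * alpha ap am * mean ap am * ap / 2) - alpha ap am * ap * y / 2 -
        Complex.I * alpha ap am * ap ^ 2 / 4) := by
  have hpc : (ap : ℂ) ≠ 0 := by exact_mod_cast hap.ne'
  have hmc : (am : ℂ) ≠ 0 := by exact_mod_cast ham.ne'
  have hπ : (Real.pi : ℂ) ≠ 0 := by exact_mod_cast Real.pi_ne_zero
  have h := gExp_diff hap ham (z := Complex.I * ((am / 2 - ap : ℝ) : ℂ) - y) (by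
    rw [I_mul_sub_im, abs_lt]; constructor <;> linarith)
  have e1 : Complex.I * ((am / 2 - ap : ℝ) : ℂ) - y + Complex.I * (ap / 2) =
      Complex.I * ((am - ap) / 2) - y := by push_cast; ring
  have e2 : Complex.I * ((am / 2 - ap : ℝ) : ℂ) - y - Complex.I * (ap / 2) =
      Complex.I * ((am - ap) / 2) - (y + Complex.I * ap) := by push_cast; ring
  have e3 : Complex.cosh (Real.pi * (Complex.I * ((am / 2 - ap : ℝ) : ℂ) - y) / am) =
      -Complex.I * Complex.sinh (Real.pi * (y + Complex.I * ap) / am) := by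
    rw [show Real.pi * (Complex.I * ((am / 2 - ap : ℝ) : ℂ) - y) / am =
      -(Real.pi * (y + Complex.I * ap) / am) + Real.pi / 2 * Complex.I by
        push_cast; field_simp; ring, Complex.cosh_add, Complex.cosh_mul_I, Complex.sinh_mul_I,
      Complex.sinh_neg]
    simp
    ring
  rw [e1, e2, e3] at h
  have s1 := mul_sinhc (Real.pi * (y + Complex.I * ap) / am)
  have s2 := mul_sinhc (Real.pi * y / am)
  have e4 : Complex.exp (-(alpha ap am * mean ap am * (y + Complex.I * ap) / 2) +
      Complex.I * alpha ap am * (y + Complex.I * ap) ^ 2 / 4) =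
      Complex.exp (-(alpha ap am * mean ap am * y / 2) + Complex.I * alpha ap am * y ^ 2 / 4) *
      Complex.exp (-(Complex.I * alpha ap am * mean ap am * ap / 2) - alpha ap am * ap * y / 2 -
        Complex.I * alpha ap am * ap ^ 2 / 4) := by
    rw [← Complex.exp_add]
    congr 1
    linear_combination (alpha ap am * ap * y / 2 + Complex.I * alpha ap am * ap ^ 2 / 4) *
      Complex.I_sq
  rw [ftMul, ftMul, e4, h, ← s1, ← s2]
  ring

/-- The multipliers of the two difference equations cancel. The conditions on Im y keep y, y + ia₊
and sinh(πy/a₋) away from 0, so that they can be divided out. -/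
lemma ftInt_mul_ftMul_periodic (hχ : IsPhase ap am χ) (hap : 0 < ap) (ham : 0 < am) {s : ℝ}
    (hs₀ : |s - ap| < mean ap am) (hs₁ : |s| < mean ap am) {y : ℂ}
    (h1 : 0 < decayRate ap am + alpha ap am * y.im) (h2 : s + y.im < 0) (h3 : -ap < y.im)
    (h4 : y.im < am - ap) (hy : y.im ≠ 0) (hy' : |y.im| < am) :
    ftInt ap am χ (s - ap) (y + Complex.I * ap) * ftMul ap am (y + Complex.I * ap) =
      ftInt ap am χ (s - ap) y * ftMul ap am y := by
  have hpc : (ap : ℂ) ≠ 0 := by exact_mod_cast hap.ne'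
  have hmc : (am : ℂ) ≠ 0 := by exact_mod_cast ham.ne'
  have hπ : (Real.pi : ℂ) ≠ 0 := by exact_mod_cast Real.pi_ne_zero
  have hy0 : y ≠ 0 := by rintro rfl; simp at hy
  have hy1 : y + Complex.I * ap ≠ 0 := by
    intro h
    have := congrArg Complex.im h
    simp at this
    linarith
  have hs : Complex.sinh (Real.pi * y / am) ≠ 0 := by
    refine sinh_ne_zero_of_im (div_ne_zero (mul_ne_zero hπ hy0) hmc) ?_
    rw [Complex.div_ofReal_im, Complex.im_ofReal_mul, abs_div, abs_mul, abs_of_pos Real.pi_pos,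
      abs_of_pos ham, div_lt_iff₀ ham]
    exact mul_lt_mul_of_pos_left hy' Real.pi_pos
  have e1 := hχ.ftInt_diff hap ham hs₀ hs₁ h1 h2 (by linarith)
  have e2 := ftMul_diff hap ham h3 h4
  have e3 : Complex.exp (alpha ap am * ap * y) - 1 =
      2 * Complex.sinh (Real.pi * y / am) * Complex.exp (Real.pi * y / am) := by
    rw [Complex.sinh, mul_div_cancel₀ _ two_ne_zero, sub_mul, ← Complex.exp_add, ← Complex.exp_add]
    rw [neg_add_cancel, Complex.exp_zero, ofReal_alpha]
    congr 2; field_simp; ring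
  have e4 : Complex.exp (-(Complex.I * alpha ap am * mean ap am * ap / 2) -
      alpha ap am * ap * y / 2 - Complex.I * alpha ap am * ap ^ 2 / 4) *
      Complex.exp (Real.pi * y / am) =
      -Complex.I * Complex.exp (-(Complex.I * alpha ap am * ap ^ 2 / 2)) := by
    have : -Complex.I = Complex.exp (-(Real.pi / 2) * Complex.I) := by
      rw [Complex.exp_mul_I, Complex.cos_neg, Complex.sin_neg]; simp
    rw [this, ← Complex.exp_add, ← Complex.exp_add]
    congr 1
    rw [ofReal_alpha, ofReal_mean]
    field_simp
    ring
  generalize Complex.exp (-(Complex.I * alpha ap am * mean ap am * ap / 2) -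
      alpha ap am * ap * y / 2 - Complex.I * alpha ap am * ap ^ 2 / 4) = X at *
  have hQ := Complex.exp_ne_zero (-(Complex.I * alpha ap am * ap ^ 2 / 2))
  generalize Complex.exp (-(Complex.I * alpha ap am * ap ^ 2 / 2)) = Q at *
  rw [e3] at e1
  generalize Complex.exp (Real.pi * y / am) = E at *
  generalize Complex.sinh (Real.pi * y / am) = S at *
  generalize ftInt ap am χ (s - ap) (y + Complex.I * ap) = D' at *
  generalize ftInt ap am χ (s - ap) y = D at *
  generalize ftMul ap am (y + Complex.I * ap) = T' at *
  generalize ftMul ap am y = T at *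
  have hne : y * (y + Complex.I * ap) * (2 * Complex.I * S * Q) ≠ 0 :=
    mul_ne_zero (mul_ne_zero hy0 hy1)
      (mul_ne_zero (mul_ne_zero (mul_ne_zero two_ne_zero Complex.I_ne_zero) hs) hQ)
  apply mul_left_cancel₀ hne
  linear_combination (-(y * Q * D')) * e2 + (X * y * T) * e1 -
    ((y + Complex.I * ap) * 2 * S * D * y * T) * e4

/-- Removing the Gaussian from Φ splits its one-sided growth evenly between the two ends of the
strip. -/
lemma IsPhase.exists_norm_gExp_le (hχ : IsPhase ap am χ) (hap : 0 < ap) (ham : 0 < am) {B : ℝ}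
    (hB : B < mean ap am) :
    ∃ K > 0, ∀ w : ℂ, |w.im| ≤ B →
      ‖gExp ap am w‖ ≤ K * Real.exp (alpha ap am / 2 * (|w.re| * w.im)) := by
  obtain ⟨K, hK0, hK⟩ := hχ.exists_norm_gPhi_le hap ham hB
  refine ⟨K * Real.exp χ.im, by positivity, fun w hw => ?_⟩
  have e : gExp ap am w =
      gPhi ap am χ w * Complex.exp (-(Complex.I * (χ + alpha ap am * w ^ 2 / 4))) := by
    rw [gPhi_eq, mul_assoc, ← Complex.exp_add]; simp
  have e2 : (-(Complex.I * (χ + alpha ap am * w ^ 2 / 4))).re =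
      χ.im + alpha ap am / 2 * (w.re * w.im) := by
    rw [show (alpha ap am * w ^ 2 / 4 : ℂ) = ((alpha ap am / 4 : ℝ) : ℂ) * (w * w) by
      push_cast; ring, Complex.neg_re, Complex.I_mul_re, Complex.add_im, Complex.im_ofReal_mul,
      Complex.mul_im]
    ring
  rw [e, norm_mul, Complex.norm_exp, e2]
  refine (mul_le_mul_of_nonneg_right (hK w hw) (Real.exp_pos _).le).trans (le_of_eq ?_)
  have : w.re * w.im = max w.re 0 * w.im - max (-w.re) 0 * w.im := by
    rw [← sub_mul, max_sub_max_neg]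
  rw [mul_assoc K, mul_assoc K, ← Real.exp_add, ← Real.exp_add, ← max_add_max_neg w.re, this]
  ring_nf

lemma differentiableOn_ftMul (hap : 0 < ap) (ham : 0 < am) :
    DifferentiableOn ℂ (ftMul ap am) {y | -ap < y.im ∧ y.im < am} := by
  have h1 : Differentiable ℂ fun y : ℂ => sinhc (Real.pi * y / am) :=
    differentiable_sinhc.comp (by fun_prop)
  have h2 : DifferentiableOn ℂ (fun y : ℂ => gExp ap am (Complex.I * ((am - ap) / 2) - y))
      {y | -ap < y.im ∧ y.im < am} := by
    refine (differentiableOn_gExp hap ham).comp (Differentiable.differentiableOn (by fun_prop))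
      fun y hy => ?_
    change |(Complex.I * ((am - ap) / 2) - y : ℂ).im| < mean ap am
    have := I_mul_sub_im ((am - ap) / 2) y
    push_cast at this
    rw [this, mean, abs_lt]
    constructor <;> linarith [hy.1, hy.2]
  exact ((h1.differentiableOn.const_mul _).mul
    (Differentiable.differentiableOn (by fun_prop))).mul h2

lemma IsPhase.exists_norm_ftMul_le (hχ : IsPhase ap am χ) (hap : 0 < ap) (ham : 0 < am) {B : ℝ}
    (hB : B < mean ap am) :
    ∃ K > 0, ∀ y : ℂ, |(am - ap) / 2 - y.im| ≤ B →
      ‖ftMul ap am y‖ ≤ K * Real.exp (alpha ap am / 2 * (ap * |y.re| - mean ap am * y.re -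
        y.re * y.im + |y.re| * ((am - ap) / 2 - y.im))) := by
  obtain ⟨C, hC0, hC⟩ := exists_norm_sinhc_le
  obtain ⟨K, hK0, hK⟩ := hχ.exists_norm_gExp_le hap ham hB
  refine ⟨ap / √(ap * am) * C * K, by positivity, fun y hy => ?_⟩
  have hwre : (Complex.I * ((am - ap) / 2) - y : ℂ).re = -y.re := by
    rw [show ((am : ℂ) - ap) / 2 = (((am - ap) / 2 : ℝ) : ℂ) by push_cast; rfl]
    simp
  have hwim : (Complex.I * ((am - ap) / 2) - y : ℂ).im = (am - ap) / 2 - y.im := by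
    have := I_mul_sub_im ((am - ap) / 2) y
    push_cast at this
    exact this
  have h1 := hK (Complex.I * ((am - ap) / 2) - y) (by rw [hwim]; exact hy)
  rw [hwre, hwim, abs_neg] at h1
  have h2 := hC (Real.pi * y / am)
  rw [Complex.div_ofReal_re, Complex.re_ofReal_mul, abs_div, abs_mul, abs_of_pos Real.pi_pos,
    abs_of_pos ham] at h2
  have h3 : ‖Complex.exp (-(alpha ap am * mean ap am * y / 2) +
      Complex.I * alpha ap am * y ^ 2 / 4)‖ =
      Real.exp (alpha ap am / 2 * (-(mean ap am * y.re) - y.re * y.im)) := by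
    rw [Complex.norm_exp, show -(alpha ap am * mean ap am * y / 2 : ℂ) +
      Complex.I * alpha ap am * y ^ 2 / 4 = ((alpha ap am / 2 * -mean ap am : ℝ) : ℂ) * y +
      ((alpha ap am / 4 : ℝ) : ℂ) * (Complex.I * (y * y)) by push_cast; ring, Complex.add_re,
      Complex.re_ofReal_mul, Complex.re_ofReal_mul, Complex.I_mul_re, Complex.mul_im]
    ring_nf
  have h4 : Real.pi * |y.re| / am = alpha ap am / 2 * (ap * |y.re|) := by
    rw [alpha]; field_simp
  rw [h4] at h2
  have h5 : ‖(ap / √(ap * am) : ℂ)‖ = ap / √(ap * am) := by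
    rw [← Complex.ofReal_div, Complex.norm_real, Real.norm_of_nonneg (by positivity)]
  rw [ftMul, norm_mul, norm_mul, norm_mul, h3, h5]
  calc _ ≤ ap / √(ap * am) * (C * Real.exp (alpha ap am / 2 * (ap * |y.re|))) *
        Real.exp (alpha ap am / 2 * (-(mean ap am * y.re) - y.re * y.im)) *
        (K * Real.exp (alpha ap am / 2 * (|y.re| * ((am - ap) / 2 - y.im)))) := by gcongr
    _ = ap / √(ap * am) * C * K * (Real.exp (alpha ap am / 2 * (ap * |y.re|)) *
        Real.exp (alpha ap am / 2 * (-(mean ap am * y.re) - y.re * y.im)) *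
        Real.exp (alpha ap am / 2 * (|y.re| * ((am - ap) / 2 - y.im)))) := by ring
    _ = _ := by rw [← Real.exp_add, ← Real.exp_add]; ring_nf

lemma IsPhase.tendsto_gRem (hχ : IsPhase ap am χ) (hap : 0 < ap) (ham : 0 < am) {s : ℝ}
    (hs : |s| < mean ap am) :
    Tendsto (fun v : ℝ => gRem ap am χ (v + s * Complex.I)) atTop (𝓝 0) := by
  obtain ⟨C, hC0, hC⟩ := hχ.exists_bound hap ham hs
  refine squeeze_zero_norm' (a := fun v => C * Real.exp (-decayRate ap am * v)) ?_
    (by simpa using (tendsto_exp_neg_mul (decayRate_pos hap ham)).const_mul C)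
  filter_upwards [eventually_ge_atTop 0] with v hv
  simpa using (hC (v + s * Complex.I) (by simpa using hv) (by simp)).1

lemma IsPhase.tendsto_gPhi_atTop (hχ : IsPhase ap am χ) (hap : 0 < ap) (ham : 0 < am) {s : ℝ}
    (hs : |s| < mean ap am) :
    Tendsto (fun v : ℝ => gPhi ap am χ (v + s * Complex.I)) atTop (𝓝 1) := by
  have h1 := (hχ.tendsto_gRem hap ham hs).const_mul Complex.I
  rw [mul_zero] at h1
  have h2 := (Complex.continuous_exp.tendsto 0).comp h1
  rwa [Complex.exp_zero] at h2

lemma IsPhase.tendsto_gPhi_atBot (hχ : IsPhase ap am χ) (hap : 0 < ap) (ham : 0 < am) {s : ℝ}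
    (hs : |s| < mean ap am) (hs0 : s < 0) :
    Tendsto (fun v : ℝ => gPhi ap am χ (v + s * Complex.I)) atBot (𝓝 0) := by
  obtain ⟨K, hK0, hK⟩ := hχ.exists_norm_gPhi_le hap ham hs
  have hα := alpha_pos hap ham
  have hk : 0 < alpha ap am * -s := mul_pos hα (by linarith)
  refine squeeze_zero_norm' (a := fun v => K * Real.exp (-(alpha ap am * -s) * |v|)) ?_
    (by simpa using (tendsto_exp_neg_mul_abs_atBot hk).const_mul K)
  filter_upwards [eventually_le_atBot 0] with v hv
  have := hK (v + s * Complex.I) (by simp)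
  simp only [Complex.add_im, Complex.ofReal_im, Complex.mul_im, Complex.ofReal_re,
    Complex.I_im, mul_one, Complex.I_re, mul_zero, add_zero, zero_add, Complex.add_re,
    Complex.mul_re, sub_self] at this
  rw [max_eq_left (by linarith)] at this
  rw [abs_of_nonpos hv]
  refine this.trans (le_of_eq ?_)
  ring_nf

/-- At y = 0 this is the fundamental theorem of calculus: Φ rises from 0 on the left, because s < 0,
to 1 on the right. -/
lemma IsPhase.ftInt_zero (hχ : IsPhase ap am χ) (hap : 0 < ap) (ham : 0 < am) {s : ℝ}
    (hs : |s| < mean ap am) (hs0 : s < 0) : ftInt ap am χ s 0 = 1 := by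
  have hint := hχ.integrable_ftKer hap ham hs (y := 0)
    (by simpa using decayRate_pos hap ham) (by simpa using hs0)
  have hder : ∀ v : ℝ, HasDerivAt (fun v : ℝ => gPhi ap am χ (v + s * Complex.I))
      (ftKer ap am χ 0 (v + s * Complex.I)) v := by
    intro v
    have h3 := hasDerivAt_gPhi (χ := χ) hap ham (line_mem_strip hs v)
    have h4 := (h3.comp_add_const (v : ℂ) (s * Complex.I)).comp_ofReal
    refine h4.congr_deriv ?_
    rw [ftKer, mul_zero, Complex.exp_zero, mul_one]
  have h := integral_of_hasDerivAt_of_tendsto hder hint (hχ.tendsto_gPhi_atBot hap ham hs hs0)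
    (hχ.tendsto_gPhi_atTop hap ham hs)
  rw [ftInt, h, sub_zero]

lemma ftMul_zero (hap : 0 < ap) (ham : 0 < am) : ftMul ap am 0 = 1 := by
  rw [ftMul]
  simp only [mul_zero, zero_div, sinhc_zero, mul_one, neg_zero, ne_eq, OfNat.ofNat_ne_zero,
    not_false_eq_true, zero_pow, add_zero, Complex.exp_zero, sub_zero]
  rw [gExp_special hap ham, ← Complex.ofReal_div, ← Complex.ofReal_mul, ← Complex.ofReal_one]
  congr 1
  rw [Real.sqrt_div ham.le, Real.sqrt_mul hap.le]
  have h1 := Real.sqrt_pos.2 hap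
  have h2 := Real.sqrt_pos.2 ham
  field_simp
  rw [Real.sq_sqrt hap.le]

/-- The Fourier transform of the derivative of the normalized hyperbolic gamma function is
again a hyperbolic gamma function. -/
theorem IsPhase.ftInt_mul_ftMul_of_le (hχ : IsPhase ap am χ) (hap : 0 < ap) (ham : 0 < am)
    (hle : ap ≤ am) (y : ℝ) : ftInt ap am χ (-(mean ap am / 2)) y * ftMul ap am y = 1 := by
  have hα := alpha_pos hap ham
  have hr := decayRate_pos hap ham
  have ha := mean_pos hap ham
  -- `ftInt` converges for Im y > -2ε. The strip -ε ≤ Im y ≤ a₊ - ε therefore stays in its domain,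
  -- has 0 in its interior, and has boundary lines off the real axis as `ftInt_mul_ftMul_periodic`
  -- requires.
  set ε := decayRate ap am / (2 * alpha ap am) with hε
  have hε0 : 0 < ε := by positivity
  have hαε : alpha ap am * ε = decayRate ap am / 2 := by rw [hε]; field_simp
  have hεp : 4 * ε < ap := by
    have : ε = ap * am / (4 * (ap + am)) := by
      have hπ := Real.pi_pos
      rw [hε, decayRate, alpha]; field_simp; norm_num
    rw [this, mul_div_assoc', div_lt_iff₀ (by positivity)]
    nlinarith [mul_pos hap hap]
  have hmean : mean ap am = (ap + am) / 2 := rfl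
  -- The line s₂ is admissible for the whole strip, and |s₂| < a because a₊ ≤ a₋, but it gives a
  -- sufficient growth bound only in the upper half. In the lower half the bound is taken on s₁.
  set s₁ := -(ap / 2 - ε / 2) with hs₁
  set s₂ := -(ap - ε / 2) with hs₂
  have hs₁' : |s₁| < mean ap am := by rw [hmean, abs_lt]; constructor <;> linarith
  have hs₂' : |s₂| < mean ap am := by rw [hmean, abs_lt]; constructor <;> linarith
  set f : ℂ → ℂ := fun y => ftInt ap am χ s₂ y * ftMul ap am y with hf
  set U : Set ℂ := {y | 0 < decayRate ap am + alpha ap am * y.im ∧ s₂ + y.im < 0} with hU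
  have hUo : IsOpen U :=
    (isOpen_lt continuous_const (continuous_const.add
      (continuous_const.mul Complex.continuous_im))).inter
      (isOpen_lt (continuous_const.add Complex.continuous_im) continuous_const)
  have hUim : ∀ y ∈ U, -ap < y.im ∧ y.im < am := by
    intro y hy
    refine ⟨?_, by linarith [hy.2]⟩
    by_contra hcon
    push Not at hcon
    have := hy.1
    nlinarith
  have hfd : DifferentiableOn ℂ f U :=
    (hχ.differentiableOn_ftInt hap ham hs₂').mul ((differentiableOn_ftMul hap ham).mono hUim)
  have hsub : Complex.im ⁻¹' Set.Icc (-ε) (-ε + ap) ⊆ U := by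
    intro y hy
    have hy1 : -ε ≤ y.im := hy.1
    have hy2 : y.im ≤ -ε + ap := hy.2
    exact ⟨by nlinarith, by linarith⟩
  obtain ⟨K₁, hK₁0, hK₁⟩ := hχ.exists_norm_ftInt_le hap ham hs₁'
    (κ := decayRate ap am / 8) (by positivity)
  obtain ⟨K₂, hK₂0, hK₂⟩ := hχ.exists_norm_ftInt_le hap ham hs₂'
    (κ := decayRate ap am / 8) (by positivity)
  obtain ⟨K, hK0, hK⟩ := hχ.exists_norm_ftMul_le hap ham
    (B := max ((am - ap) / 2 + ε) (ap - ε - (am - ap) / 2)) (by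
      rw [hmean]; exact max_lt (by linarith) (by linarith))
  -- The first condition serves Re y ≥ 0, the second Re y ≤ 0. The resulting exponent α(a₋ + ε)/2
  -- lies below αa₋ = 2π/a₊, the limit in `eq_const_of_periodic_strip`.
  have hexp : ∀ (y : ℂ) (s : ℝ), -s - y.im ≤ (am + ε) / 2 → mean ap am + s ≤ (am + ε) / 2 →
      Real.exp (-alpha ap am * (s * y.re)) * Real.exp (alpha ap am / 2 * (ap * |y.re| -
        mean ap am * y.re - y.re * y.im + |y.re| * ((am - ap) / 2 - y.im))) ≤
      Real.exp (alpha ap am * ((am + ε) / 2) * |y.re|) := by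
    intro y s h1 h2
    rw [← Real.exp_add]
    apply Real.exp_le_exp.2
    rcases le_total 0 y.re with h | h
    · rw [abs_of_nonneg h]
      have := mul_le_mul_of_nonneg_left h1 (mul_nonneg hα.le h)
      rw [hmean]
      nlinarith
    · rw [abs_of_nonpos h]
      have := mul_le_mul_of_nonneg_left h2 (mul_nonneg hα.le (by linarith : 0 ≤ -y.re))
      rw [hmean] at *
      nlinarith
  obtain ⟨L, hL⟩ := eq_const_of_periodic_strip (f := f) (c := -ε) (p := ap)
    (θ := alpha ap am * ((am + ε) / 2)) (C := (K₁ + K₂) * K) hap (by positivity) (by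
      rw [lt_div_iff₀ hap, ← alpha_mul hap ham]
      have : (am + ε) / 2 < am := by linarith
      nlinarith [mul_lt_mul_of_pos_left this (mul_pos hα hap)]) hUo hsub hfd (by
      intro x
      have h := ftInt_mul_ftMul_periodic hχ hap ham (s := ε / 2) (y := x + (-ε : ℝ) * Complex.I)
        (by rw [hmean, abs_lt]; constructor <;> linarith)
        (by rw [hmean, abs_lt]; constructor <;> linarith)
        (by simp; linarith) (by simp; linarith) (by simp; linarith) (by simp; linarith)
        (by simpa using hε0.ne') (by
          simp only [Complex.add_im, Complex.ofReal_im, Complex.mul_im, Complex.ofReal_re,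
            Complex.I_im, mul_one, Complex.I_re, mul_zero, add_zero, zero_add, abs_neg]
          rw [abs_of_pos hε0]; linarith)
      rw [show ε / 2 - ap = s₂ by rw [hs₂]; ring] at h
      simp only [hf]
      rw [← h]
      congr 2 <;> push_cast <;> ring) (by
      intro y h1 h2
      have hT := hK y (by
        rw [abs_le]
        constructor
        · linarith [le_max_right ((am - ap) / 2 + ε) (ap - ε - (am - ap) / 2)]
        · linarith [le_max_left ((am - ap) / 2 + ε) (ap - ε - (am - ap) / 2)])
      have hyU := hsub (show y ∈ Complex.im ⁻¹' Set.Icc (-ε) (-ε + ap) from ⟨h1, h2⟩)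
      have hk : decayRate ap am / 8 ≤ decayRate ap am + alpha ap am * y.im := by nlinarith
      simp only [hf]
      rw [norm_mul]
      rcases le_or_gt y.im (-ε + ap / 2) with h3 | h3
      · have e := hχ.ftInt_eq hap ham hs₂' hs₁' hyU.1 hyU.2 (by linarith)
        have hD := hK₁ y hk (by nlinarith)
        rw [e]
        calc _ ≤ (K₁ * Real.exp (-alpha ap am * (s₁ * y.re))) * (K * Real.exp (alpha ap am / 2 *
              (ap * |y.re| - mean ap am * y.re - y.re * y.im +
                |y.re| * ((am - ap) / 2 - y.im)))) := by gcongr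
          _ = K₁ * K * (Real.exp (-alpha ap am * (s₁ * y.re)) * Real.exp (alpha ap am / 2 *
              (ap * |y.re| - mean ap am * y.re - y.re * y.im +
                |y.re| * ((am - ap) / 2 - y.im)))) := by ring
          _ ≤ K₁ * K * Real.exp (alpha ap am * ((am + ε) / 2) * |y.re|) := by
            gcongr
            exact hexp y s₁ (by linarith) (by linarith)
          _ ≤ _ := by gcongr; linarith
      · have hD := hK₂ y hk (by nlinarith)
        calc _ ≤ (K₂ * Real.exp (-alpha ap am * (s₂ * y.re))) * (K * Real.exp (alpha ap am / 2 *
              (ap * |y.re| - mean ap am * y.re - y.re * y.im +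
                |y.re| * ((am - ap) / 2 - y.im)))) := by gcongr
          _ = K₂ * K * (Real.exp (-alpha ap am * (s₂ * y.re)) * Real.exp (alpha ap am / 2 *
              (ap * |y.re| - mean ap am * y.re - y.re * y.im +
                |y.re| * ((am - ap) / 2 - y.im)))) := by ring
          _ ≤ K₂ * K * Real.exp (alpha ap am * ((am + ε) / 2) * |y.re|) := by
            gcongr
            exact hexp y s₂ (by linarith) (by linarith)
          _ ≤ _ := by gcongr; linarith)
  have hf0 : f 0 = 1 := by
    simp only [hf]
    rw [hχ.ftInt_zero hap ham hs₂' (by linarith), ftMul_zero hap ham, mul_one]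
  have hy := hL y (by simpa using hε0) (by simp; linarith)
  rw [← hL 0 (by simpa using hε0) (by simp; linarith), hf0] at hy
  rw [hχ.ftInt_eq hap ham (s₂ := s₂) (by rw [abs_neg, abs_of_pos (by linarith)]; linarith) hs₂'
    (by simpa using hr) (by simpa using ha) (by simp; linarith)]
  exact hy

lemma ftInt_comm (ap am : ℝ) (χ : ℂ) (s : ℝ) (y : ℂ) :
    ftInt ap am χ s y = ftInt am ap χ s y := by
  simp only [ftInt, ftKer, gPhi₁_comm ap am, alpha_comm ap am]

/-- The symmetry in a₊ and a₋ is invisible in the formula; it is the compatibility relation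
`sinhc_mul_gExp`. It removes the assumption a₊ ≤ a₋. -/
lemma ftMul_comm (hap : 0 < ap) (ham : 0 < am) (y : ℝ) : ftMul ap am y = ftMul am ap y := by
  have h := sinhc_mul_gExp hap ham y
  rw [ftMul, ftMul, alpha_comm am ap, mean_comm am ap, gExp_comm am ap, mul_comm am ap]
  linear_combination (1 / √(ap * am) * Complex.exp (-(alpha ap am * mean ap am * y / 2) +
    Complex.I * alpha ap am * y ^ 2 / 4)) * h

theorem IsPhase.ftInt_mul_ftMul (hχ : IsPhase ap am χ) (hap : 0 < ap) (ham : 0 < am) (y : ℝ) :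
    ftInt ap am χ (-(mean ap am / 2)) y * ftMul ap am y = 1 := by
  rcases le_total ap am with h | h
  · exact hχ.ftInt_mul_ftMul_of_le hap ham h y
  · rw [ftInt_comm, ftMul_comm hap ham, mean_comm]
    exact hχ.symm.ftInt_mul_ftMul_of_le ham hap h y

end


/-! ### Boundary values on Im z = a, and F in terms of Φ. -/

section
variable {ap am : ℝ} {χ : ℂ}

lemma hypGamma_of_strip {z : ℂ} (hz : |z.im| < mean ap am) : hypGamma ap am z = gExp ap am z := by
  rw [hypGamma, if_pos hz, gExp]

lemma hypGamma_ofReal (hap : 0 < ap) (ham : 0 < am) (x : ℝ) :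
    hypGamma ap am x = gExp ap am x :=
  hypGamma_of_strip (by simpa using mean_pos hap ham)

lemma add_I_mul_im (w : ℂ) (t : ℝ) : (w + Complex.I * t).im = w.im + t := by simp

/-- Iterating `gExp_diff` inside the strip reproduces the product in the definition of `hypGamma`.
-/
lemma gExp_add_mul (hap : 0 < ap) (ham : 0 < am) {w : ℂ} (k : ℕ)
    (h : ∀ j < k, |w.im + (j + 1 / 2) * ap| < am / 2) :
    gExp ap am (w + Complex.I * (k * ap)) = gExp ap am w * ∏ j ∈ Finset.range k,
      2 * Complex.cosh (Real.pi * (w + Complex.I * ((j + 1 / 2) * ap)) / am) := by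
  induction k with
  | zero => simp
  | succ k ih =>
    have hk := h k (Nat.lt_succ_self k)
    rw [← add_I_mul_im] at hk
    have hd := gExp_diff hap ham hk
    push_cast at hd
    rw [Finset.prod_range_succ, ← mul_assoc (gExp ap am w), ← ih fun j hj => h j (hj.trans (Nat.lt_succ_self k)),
      show w + Complex.I * (((k + 1 : ℕ) : ℂ) * ap) =
        w + Complex.I * ((k + 1 / 2) * ap) + Complex.I * (ap / 2) by push_cast; ring, hd,
      show w + Complex.I * ((k + 1 / 2) * ap) - Complex.I * (ap / 2) =
        w + Complex.I * (k * ap) by ring]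
    ring

/-- The hyperbolic gamma function on the line `Im z = a`. -/
lemma hypGamma_add_I_mean (hap : 0 < ap) (ham : 0 < am) (y : ℝ) :
    hypGamma ap am (y + Complex.I * mean ap am) =
      2 * Complex.I * Complex.sinh (Real.pi * y / am) *
        gExp ap am (Complex.I * ((am - ap) / 2) + y) := by
  have hmc : (am : ℂ) ≠ 0 := by exact_mod_cast ham.ne'
  have him : ((y : ℂ) + Complex.I * mean ap am).im = mean ap am := by simp
  have ha := mean_pos hap ham
  -- On Im z = a the definition of `hypGamma` uses n = round(a/a₊) ≥ 1 factors; write n = m + 1. The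
  -- first m stay in the strip and rebuild `gExp` at height a - a₊ = (a₋ - a₊)/2. The last has its
  -- argument at height a₋/2, where the hyperbolic cosine becomes i sinh(πy/a₋).
  have hround := abs_le.1 (abs_sub_round (mean ap am / ap))
  have hmean : mean ap am / ap = 1 / 2 + am / (2 * ap) := by rw [mean]; field_simp
  have hpos : 0 < round (mean ap am / ap) := by
    have h1 : 0 < am / (2 * ap) := by positivity
    have : (0 : ℝ) < round (mean ap am / ap) := by linarith [hround.2]
    exact_mod_cast this
  obtain ⟨m, hm⟩ : ∃ m : ℕ, round (mean ap am / ap) = ((m + 1 : ℕ) : ℤ) :=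
    ⟨(round (mean ap am / ap)).toNat - 1, by omega⟩
  rw [hm] at hround
  push_cast at hround
  set w : ℂ := y + Complex.I * mean ap am - Complex.I * ((m + 1) * ap) with hw
  have hwim : w.im = mean ap am - (m + 1) * ap := by
    rw [hw, show (y : ℂ) + Complex.I * mean ap am - Complex.I * ((m + 1) * ap) =
      y + Complex.I * ((mean ap am - (m + 1) * ap : ℝ) : ℂ) by push_cast; ring, add_I_mul_im]
    simp
  have hlow : -(ap / 2) ≤ w.im := by
    have h1 := mul_le_mul_of_nonneg_right hround.1 hap.le
    rw [sub_mul, div_mul_cancel₀ _ hap.ne'] at h1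
    rw [hwim]; linarith
  have hprod := gExp_add_mul hap ham (w := w) m (by
    intro j hj
    have h1 : (j : ℝ) + 1 ≤ m := by exact_mod_cast hj
    have h2 : 0 ≤ (j : ℝ) * ap := by positivity
    rw [abs_lt]
    constructor
    · linarith
    · rw [hwim, mean]
      nlinarith [mul_le_mul_of_nonneg_right h1 hap.le])
  rw [hypGamma, him, if_neg (by rw [abs_of_pos ha]; exact lt_irrefl _), hm,
    if_pos (Int.natCast_nonneg _)]
  simp only [Int.toNat_natCast, Int.cast_natCast]
  rw [show ((m + 1 : ℕ) : ℂ) = m + 1 by push_cast; rfl, ← hw, ← gExp, Finset.prod_range_succ, ← mul_assoc, ← hprod,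
    show w + Complex.I * (m * ap) = Complex.I * ((am - ap) / 2) + y by
      rw [hw, ofReal_mean]; ring,
    show Real.pi * (w + Complex.I * ((m + 1 / 2) * ap)) / am =
      Real.pi * y / am + Real.pi / 2 * Complex.I by
      rw [hw, ofReal_mean]; field_simp; ring, Complex.cosh_add, Complex.cosh_mul_I,
    Complex.sinh_mul_I]
  simp
  ring

lemma hypGamma_neg_add_I_mean (hap : 0 < ap) (ham : 0 < am) (y : ℝ) :
    hypGamma ap am (-y + Complex.I * mean ap am) =
      -(2 * Complex.I * Complex.sinh (Real.pi * y / am) *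
        gExp ap am (Complex.I * ((am - ap) / 2) - y)) := by
  have h := hypGamma_add_I_mean hap ham (-y)
  push_cast at h
  rw [h, mul_neg, neg_div, Complex.sinh_neg, sub_eq_add_neg]
  ring_nf

/-- Exchanging a₊ and a₋ in one of the two boundary values by `sinh_mul_gExp` makes the gamma
factors cancel through G(z)G(-z) = 1. -/
lemma todaW_eq (hap : 0 < ap) (ham : 0 < am) (y : ℝ) :
    todaW ap am y = ((4 * Real.sinh (Real.pi * y / ap) * Real.sinh (Real.pi * y / am) : ℝ) : ℂ) := by
  have h := sinh_mul_gExp hap ham y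
  rw [todaW, hypGamma_add_I_mean hap ham, hypGamma_neg_add_I_mean hap ham]
  have e : gExp ap am (Complex.I * ((ap - am) / 2) - y) =
      (gExp ap am (Complex.I * ((am - ap) / 2) + y))⁻¹ := by
    rw [← gExp_neg]; congr 1; ring
  have hne : gExp ap am (Complex.I * ((am - ap) / 2) + y) ≠ 0 := Complex.exp_ne_zero _
  rw [e] at h
  push_cast
  generalize gExp ap am (Complex.I * ((am - ap) / 2) + y) = E at *
  have h2 : Complex.sinh (Real.pi * y / am) * gExp ap am (Complex.I * ((am - ap) / 2) - y) * E =
      Complex.sinh (Real.pi * y / ap) := by rw [h]; field_simp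
  linear_combination (4 * Complex.sinh (Real.pi * y / am)) * h2 - 4 * Complex.sinh (Real.pi * y / am)
    ^ 2 * gExp ap am (Complex.I * ((am - ap) / 2) - y) * E * Complex.I_sq

lemma sinh_mul_sinh_pos (hap : 0 < ap) (ham : 0 < am) {y : ℝ} (hy : 0 < y) :
    0 < 4 * Real.sinh (Real.pi * y / ap) * Real.sinh (Real.pi * y / am) := by
  have hπ := Real.pi_pos
  have h1 : 0 < Real.sinh (Real.pi * y / ap) := Real.sinh_pos_iff.2 (by positivity)
  have h2 : 0 < Real.sinh (Real.pi * y / am) := Real.sinh_pos_iff.2 (by positivity)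
  positivity

lemma todaW_ne_zero (hap : 0 < ap) (ham : 0 < am) {y : ℝ} (hy : 0 < y) : todaW ap am y ≠ 0 := by
  rw [todaW_eq hap ham]
  exact_mod_cast (sinh_mul_sinh_pos hap ham hy).ne'

lemma cpow_half_sq (w : ℂ) : (w ^ (1 / 2 : ℂ)) ^ 2 = w := by
  rw [one_div]; exact Complex.cpow_nat_inv_pow w two_ne_zero

lemma todaW_neg (ap am y : ℝ) : todaW ap am (-y) = todaW ap am y := by
  rw [todaW, todaW, mul_comm]; push_cast; rw [neg_neg]

lemma todaUSqrt_sq {η y : ℝ} (h : todaW ap am y ≠ 0) :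
    todaUSqrt ap am η y ^ 2 = todaU ap am η y := by
  have h1 := left_ne_zero_of_mul h
  rw [todaUSqrt, mul_pow, cpow_half_sq, todaW, todaC, todaU, div_pow, ← Complex.exp_nat_mul]
  rw [show ((2 : ℕ) : ℂ) * -(Complex.I * alpha ap am * η * y / 2) =
    -(Complex.I * alpha ap am * η * y) by push_cast; ring]
  field_simp

/-- The square of this expression is (1 - e^{-2πx/a₊})(1 - e^{-2πx/a₋}). -/
lemma tendsto_todaW_sqrt (hap : 0 < ap) (ham : 0 < am) :
    Tendsto (fun x : ℝ => todaW ap am x ^ (1 / 2 : ℂ) *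
      Complex.exp (-(alpha ap am * mean ap am * x / 2))) atTop (𝓝 1) := by
  have hπ := Real.pi_pos
  have h1 : ∀ c : ℝ, 0 < c →
      Tendsto (fun x : ℝ => 1 - Real.exp (-(2 * Real.pi / c) * x)) atTop (𝓝 1) := by
    intro c hc
    simpa using (tendsto_exp_neg_mul (κ := 2 * Real.pi / c) (by positivity)).const_sub 1
  have h2 := ((Real.continuous_sqrt.tendsto _).comp ((h1 ap hap).mul (h1 am ham)))
  rw [mul_one, Real.sqrt_one] at h2
  have h3 := (Complex.continuous_ofReal.tendsto _).comp h2
  rw [Complex.ofReal_one] at h3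
  refine h3.congr' ?_
  filter_upwards [eventually_gt_atTop 0] with x hx
  have hpos := (sinh_mul_sinh_pos hap ham hx).le
  have e : ∀ c : ℝ, 0 < c → 1 - Real.exp (-(2 * Real.pi / c) * x) =
      2 * Real.sinh (Real.pi * x / c) * Real.exp (-(Real.pi * x / c)) := by
    intro c hc
    rw [Real.sinh_eq, mul_div_cancel₀ _ two_ne_zero, sub_mul, ← Real.exp_add, ← Real.exp_add,
      add_neg_cancel, Real.exp_zero]
    ring_nf
  have e2 : (1 - Real.exp (-(2 * Real.pi / ap) * x)) * (1 - Real.exp (-(2 * Real.pi / am) * x)) =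
      4 * Real.sinh (Real.pi * x / ap) * Real.sinh (Real.pi * x / am) *
        Real.exp (-(alpha ap am * mean ap am * x / 2)) ^ 2 := by
    rw [e ap hap, e am ham, ← Real.exp_nat_mul]
    have : ((2 : ℕ) : ℝ) * -(alpha ap am * mean ap am * x / 2) =
        -(Real.pi * x / ap) + -(Real.pi * x / am) := by
      rw [alpha, mean]; push_cast; field_simp; ring
    rw [this, Real.exp_add]; ring
  simp only [Function.comp_apply]
  rw [e2, Real.sqrt_mul hpos, Real.sqrt_sq (Real.exp_pos _).le, todaW_eq hap ham,
    Real.sqrt_eq_rpow, Complex.ofReal_mul, Complex.ofReal_cpow hpos]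
  push_cast
  rfl

/-- `gPhi` on the line `Im z = -a/2`. -/
noncomputable def gPhiLine (ap am : ℝ) (χ : ℂ) (v : ℝ) : ℂ :=
  gPhi ap am χ (v + (-(mean ap am / 2) : ℝ) * Complex.I)

/-- The inverse of `gPhi` on the line `Im z = a/2`. -/
noncomputable def gPsiLine (ap am : ℝ) (χ : ℂ) (v : ℝ) : ℂ :=
  (gPhi ap am χ (v + (mean ap am / 2 : ℝ) * Complex.I))⁻¹

lemma gExp_eq (z : ℂ) : gExp ap am z =
    gPhi ap am χ z * Complex.exp (-(Complex.I * (χ + alpha ap am * z ^ 2 / 4))) := by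
  rw [gPhi_eq, mul_assoc, ← Complex.exp_add, add_neg_cancel, Complex.exp_zero, mul_one]

/-- This and `mul_exp_aux` reduce the collection of exponential factors to one additive identity
between exponents. -/
lemma mul_exp_div_aux {A B C D e₁ e₂ e₃ e₄ f₁ f₂ : ℂ} (h : e₁ - e₂ - e₃ + e₄ = f₁ + f₂) :
    A * Complex.exp e₁ * (B * Complex.exp e₂)⁻¹ / (C * Complex.exp e₃ * (D * Complex.exp e₄)⁻¹) =
      Complex.exp f₁ * (A * D * (B⁻¹ * C⁻¹) * Complex.exp f₂) := by
  have h' : Complex.exp e₁ * Complex.exp (-e₂) * Complex.exp (-e₃) * Complex.exp e₄ =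
      Complex.exp f₁ * Complex.exp f₂ := by
    rw [← Complex.exp_add, ← Complex.exp_add, ← Complex.exp_add, ← Complex.exp_add, ← h]; ring_nf
  simp only [div_eq_mul_inv, mul_inv, inv_inv, ← Complex.exp_neg, neg_neg]
  linear_combination A * D * B⁻¹ * C⁻¹ * h'

lemma mul_exp_aux {A B R J e₁ e₂ e₃ e₄ f₁ f₂ f₃ : ℂ} (h : e₁ + e₂ + e₃ + e₄ = f₁ + f₂ + f₃) :
    A * Complex.exp e₁ * (B * Complex.exp e₂) * (R * Complex.exp e₃ * Complex.exp e₄ * J) =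
      R * (A * Complex.exp f₁) * B * Complex.exp f₂ * Complex.exp f₃ * J := by
  have h' := congrArg Complex.exp h
  simp only [Complex.exp_add] at h'
  linear_combination A * B * R * J * h'

/-- After z = s + y/2 the four arguments lie on Im = ±a/2. Two of them are reflected by G(-z) =
1/G(z), so that all real parts become (x-γ)/2 ± s, (x+γ)/2 - s - y and (x+γ)/2 + s + y. The squares
in s then cancel between numerator and denominator, and the Gaussians leave a plane wave. -/
lemma conicalR_eq_integral (hap : 0 < ap) (ham : 0 < am) (χ : ℂ) (γ x y : ℝ) :
    conicalR ap am (mean ap am - Complex.I * γ) x y =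
      1 / (√(ap * am) * gExp ap am γ) *
      Complex.exp (Complex.I * alpha ap am / 2 * (γ * x + y ^ 2) -
        alpha ap am * mean ap am * x / 2) *
      ∫ s : ℝ, gPhiLine ap am χ ((x - γ) / 2 + s) * gPhiLine ap am χ ((x - γ) / 2 - s) *
        (gPsiLine ap am χ ((x + γ) / 2 - s - y) * gPsiLine ap am χ ((x + γ) / 2 + s + y)) *
        Complex.exp (Complex.I * alpha ap am * s * y) := by
  have ha := mean_pos hap ham
  rw [conicalR, show Complex.I * (mean ap am - Complex.I * γ) - Complex.I * mean ap am =
    (γ : ℂ) by linear_combination (-(γ : ℂ)) * Complex.I_sq, hypGamma_ofReal hap ham,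
    mul_assoc _ (Complex.exp _)]
  congr 1
  rw [← integral_const_mul]
  refine (integral_add_right_eq_self (μ := volume) (G := ℝ) (E := ℂ) _ (y / 2)).symm.trans ?_
  refine integral_congr_ae (ae_of_all _ fun s => ?_)
  dsimp only
  have hm : ∀ r : ℝ, hypGamma ap am (r - Complex.I * mean ap am / 2) =
      gExp ap am (r - Complex.I * mean ap am / 2) := fun r => hypGamma_of_strip (by
    rw [show (r : ℂ) - Complex.I * mean ap am / 2 =
      r + Complex.I * ((-(mean ap am / 2) : ℝ) : ℂ) by push_cast; ring, add_I_mul_im,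
      Complex.ofReal_im, zero_add, abs_neg, abs_of_pos (by positivity)]
    linarith)
  have hp : ∀ r : ℝ, hypGamma ap am (r + Complex.I * mean ap am / 2) =
      gExp ap am (r + Complex.I * mean ap am / 2) := fun r => hypGamma_of_strip (by
    rw [show (r : ℂ) + Complex.I * mean ap am / 2 =
      r + Complex.I * ((mean ap am / 2 : ℝ) : ℂ) by push_cast; ring, add_I_mul_im,
      Complex.ofReal_im, zero_add, abs_of_pos (by positivity)]
    linarith)
  have a1 : ((s + y / 2 : ℝ) : ℂ) + (x - y) / 2 - Complex.I * (mean ap am - Complex.I * γ) / 2 =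
      (((x - γ) / 2 + s : ℝ) : ℂ) - Complex.I * mean ap am / 2 := by
    push_cast; linear_combination (γ / 2 : ℂ) * Complex.I_sq
  have a2 : ((s + y / 2 : ℝ) : ℂ) - (x - y) / 2 - Complex.I * (mean ap am - Complex.I * γ) / 2 =
      ((-((x + γ) / 2 - s - y) : ℝ) : ℂ) - Complex.I * mean ap am / 2 := by
    push_cast; linear_combination (γ / 2 : ℂ) * Complex.I_sq
  have a3 : ((s + y / 2 : ℝ) : ℂ) + (x + y) / 2 + Complex.I * (mean ap am - Complex.I * γ) / 2 =
      (((x + γ) / 2 + s + y : ℝ) : ℂ) + Complex.I * mean ap am / 2 := by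
    push_cast; linear_combination (-γ / 2 : ℂ) * Complex.I_sq
  have a4 : ((s + y / 2 : ℝ) : ℂ) - (x + y) / 2 + Complex.I * (mean ap am - Complex.I * γ) / 2 =
      ((-((x - γ) / 2 - s) : ℝ) : ℂ) + Complex.I * mean ap am / 2 := by
    push_cast; linear_combination (-γ / 2 : ℂ) * Complex.I_sq
  have b2 : ∀ r : ℝ, ((-r : ℝ) : ℂ) - Complex.I * mean ap am / 2 =
      -(r + Complex.I * mean ap am / 2) := fun r => by push_cast; ring
  have b4 : ∀ r : ℝ, ((-r : ℝ) : ℂ) + Complex.I * mean ap am / 2 =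
      -(r - Complex.I * mean ap am / 2) := fun r => by push_cast; ring
  rw [a1, a2, a3, a4, hm, hm, hp, hp, b2, b4, gExp_neg, gExp_neg, gExp_eq (χ := χ), gExp_eq (χ := χ),
    gExp_eq (χ := χ), gExp_eq (χ := χ)]
  have c1 : ∀ r : ℝ, (r : ℂ) - Complex.I * mean ap am / 2 =
      r + (-(mean ap am / 2) : ℝ) * Complex.I := fun r => by push_cast; ring
  have c2 : ∀ r : ℝ, (r : ℂ) + Complex.I * mean ap am / 2 =
      r + (mean ap am / 2 : ℝ) * Complex.I := fun r => by push_cast; ring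
  simp only [gPhiLine, gPsiLine, c1, c2]
  refine mul_exp_div_aux ?_
  push_cast
  linear_combination (alpha ap am * mean ap am * x / 2 : ℂ) * Complex.I_sq

/-- The Gaussians of the weights cancel those of `conicalR`, together with every χ. The factor
e^{-αax/2} that is left exactly normalizes w(x)^{1/2}, so every factor has a limit as x, γ → ∞ with
x - γ fixed. -/
lemma conicalF_eq (hap : 0 < ap) (ham : 0 < am) (χ : ℂ) (γ x y : ℝ) :
    conicalF ap am γ x y = 1 / √(ap * am) *
      (todaW ap am x ^ (1 / 2 : ℂ) * Complex.exp (-(alpha ap am * mean ap am * x / 2))) *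
      todaW ap am y ^ (1 / 2 : ℂ) *
      Complex.exp (Complex.I * alpha ap am * y ^ 2 / 4 -
        Complex.I / 2 * gRem ap am χ ((x - γ : ℝ) : ℂ)) *
      Complex.exp (Complex.I * (gRem ap am χ ((x + γ : ℝ) : ℂ) / 2 - gRem ap am χ (γ : ℂ) +
        gRem ap am χ ((γ - y : ℝ) : ℂ) / 2 + gRem ap am χ ((γ + y : ℝ) : ℂ) / 2)) *
      ∫ s : ℝ, gPhiLine ap am χ ((x - γ) / 2 + s) * gPhiLine ap am χ ((x - γ) / 2 - s) *
        (gPsiLine ap am χ ((x + γ) / 2 - s - y) * gPsiLine ap am χ ((x + γ) / 2 + s + y)) *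
        Complex.exp (Complex.I * alpha ap am * s * y) := by
  rw [conicalF, conicalR_eq_integral hap ham χ, weightSqrt, weightSqrt, ← todaW, ← todaW]
  generalize (∫ s : ℝ, gPhiLine ap am χ ((x - γ) / 2 + s) * gPhiLine ap am χ ((x - γ) / 2 - s) *
    (gPsiLine ap am χ ((x + γ) / 2 - s - y) * gPsiLine ap am χ ((x + γ) / 2 + s + y)) *
    Complex.exp (Complex.I * alpha ap am * s * y)) = J
  have g0 : 1 / (√(ap * am) * gExp ap am γ) =
      1 / √(ap * am) * Complex.exp (-(Complex.I * gLog ap am γ)) := by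
    rw [gExp, Complex.exp_neg, one_div, mul_inv, one_div]
  rw [g0]
  have g1 : gLog ap am ((-x - γ : ℝ) : ℂ) = -gLog ap am ((x + γ : ℝ) : ℂ) := by
    rw [← gLog_neg]; congr 1; push_cast; ring
  have g2 : gLog ap am ((y - γ : ℝ) : ℂ) = -gLog ap am ((γ - y : ℝ) : ℂ) := by
    rw [← gLog_neg]; congr 1; push_cast; ring
  have g3 : gLog ap am ((-y - γ : ℝ) : ℂ) = -gLog ap am ((γ + y : ℝ) : ℂ) := by
    rw [← gLog_neg]; congr 1; push_cast; ring
  have g4 : ∀ z, gLog ap am z = gRem ap am χ z - χ - alpha ap am * z ^ 2 / 4 := fun z => by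
    rw [gRem]; ring
  rw [g1, g2, g3, g4, g4, g4, g4, g4]
  refine mul_exp_aux ?_
  push_cast
  ring

end


/-! ### The Toda limit and the bound as x → -∞. -/

/-- The integral to which the integral representing `conicalF` converges in the Toda limit. -/
noncomputable def todaInt (ap am : ℝ) (χ : ℂ) (X y : ℝ) : ℂ :=
  ∫ s : ℝ, gPhiLine ap am χ (X / 2 + s) * gPhiLine ap am χ (X / 2 - s) *
    Complex.exp (Complex.I * alpha ap am * s * y)

section
variable {ap am : ℝ} {χ : ℂ}

lemma abs_mean_div_two_lt (hap : 0 < ap) (ham : 0 < am) : |mean ap am / 2| < mean ap am := by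
  have := mean_pos hap ham
  rw [abs_of_pos (by positivity)]; linarith

lemma abs_neg_mean_div_two_lt (hap : 0 < ap) (ham : 0 < am) :
    |-(mean ap am / 2)| < mean ap am := by
  rw [abs_neg]; exact abs_mean_div_two_lt hap ham

lemma norm_exp_phase (ap am s y : ℝ) :
    ‖Complex.exp (Complex.I * alpha ap am * s * y)‖ = 1 := by
  rw [norm_exp_I_mul]; simp

lemma continuous_gPhiLine (hap : 0 < ap) (ham : 0 < am) : Continuous (gPhiLine ap am χ) :=
  continuous_line_of_differentiableOn (differentiableOn_gPhi hap ham)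
    (abs_neg_mean_div_two_lt hap ham)

lemma continuous_gPsiLine (hap : 0 < ap) (ham : 0 < am) : Continuous (gPsiLine ap am χ) :=
  (continuous_line_of_differentiableOn (differentiableOn_gPhi hap ham)
    (abs_mean_div_two_lt hap ham)).inv₀ fun _ => gPhi_ne_zero _

lemma IsPhase.tendsto_gPsiLine (hχ : IsPhase ap am χ) (hap : 0 < ap) (ham : 0 < am) :
    Tendsto (gPsiLine ap am χ) atTop (𝓝 1) := by
  have h := (hχ.tendsto_gPhi_atTop hap ham (abs_mean_div_two_lt hap ham)).inv₀ one_ne_zero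
  rwa [inv_one] at h

/-- For Im z = a/2 > 0 the modulus of Φ grows to the left, so its inverse is bounded on the whole
line. -/
lemma IsPhase.exists_norm_gPsiLine_le (hχ : IsPhase ap am χ) (hap : 0 < ap) (ham : 0 < am) :
    ∃ K > 0, ∀ v, ‖gPsiLine ap am χ v‖ ≤ K := by
  obtain ⟨C, hC⟩ := hχ.exists_abs_im_gRem_le hap ham (abs_mean_div_two_lt hap ham)
  have h0 : 0 < alpha ap am * (mean ap am / 2) :=
    mul_pos (alpha_pos hap ham) (by have := mean_pos hap ham; positivity)
  refine ⟨Real.exp C, Real.exp_pos _, fun v => ?_⟩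
  rw [gPsiLine, norm_inv, norm_gPhi, ← Real.exp_neg, neg_neg]
  apply Real.exp_le_exp.2
  have h1 := (abs_le.1 (hC (v + (mean ap am / 2 : ℝ) * Complex.I) (by simp))).2
  have h2 : (v + (mean ap am / 2 : ℝ) * Complex.I).im = mean ap am / 2 := by simp
  rw [h2] at h1
  nlinarith [mul_nonneg h0.le (le_max_right (-(v + (mean ap am / 2 : ℝ) * Complex.I).re) 0)]

lemma IsPhase.exists_norm_gPhiLine_le (hχ : IsPhase ap am χ) (hap : 0 < ap) (ham : 0 < am) :
    ∃ K > 0, ∀ v, ‖gPhiLine ap am χ v‖ ≤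
      K * Real.exp (-(alpha ap am * mean ap am / 2) * max (-v) 0) := by
  obtain ⟨K, hK0, hK⟩ := hχ.exists_norm_gPhi_le hap ham (abs_neg_mean_div_two_lt hap ham)
  refine ⟨K, hK0, fun v => (hK _ (by simp)).trans (le_of_eq ?_)⟩
  simp
  exact Or.inl (by ring)

lemma alpha_mul_mean_pos (hap : 0 < ap) (ham : 0 < am) : 0 < alpha ap am * mean ap am / 2 := by
  have := mul_pos (alpha_pos hap ham) (mean_pos hap ham)
  positivity

/-- One of p + s and p - s equals p - |s|, so one factor decays whatever the sign of s. The
s-dependence dominates the integrals, and p = X/2 gives the rate αaX/4 of `todaInt`. -/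
lemma IsPhase.exists_norm_gPhiLine_mul_le (hχ : IsPhase ap am χ) (hap : 0 < ap) (ham : 0 < am) :
    ∃ K > 0, ∀ p s, ‖gPhiLine ap am χ (p + s) * gPhiLine ap am χ (p - s)‖ ≤
      K * Real.exp (alpha ap am * mean ap am / 2 * p) *
        Real.exp (-(alpha ap am * mean ap am / 2) * |s|) := by
  obtain ⟨K, hK0, hK⟩ := hχ.exists_norm_gPhiLine_le hap ham
  have hk := alpha_mul_mean_pos hap ham
  refine ⟨K * K, by positivity, fun p s => ?_⟩
  rw [norm_mul]
  calc _ ≤ (K * Real.exp (-(alpha ap am * mean ap am / 2) * max (-(p + s)) 0)) *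
        (K * Real.exp (-(alpha ap am * mean ap am / 2) * max (-(p - s)) 0)) := by
        gcongr <;> exact hK _
    _ = K * K * (Real.exp (-(alpha ap am * mean ap am / 2) * max (-(p + s)) 0) *
        Real.exp (-(alpha ap am * mean ap am / 2) * max (-(p - s)) 0)) := by ring
    _ ≤ K * K * (Real.exp (alpha ap am * mean ap am / 2 * p) *
        Real.exp (-(alpha ap am * mean ap am / 2) * |s|)) := by
        rw [← Real.exp_add, ← Real.exp_add]
        gcongr K * K * Real.exp ?_
        have h : |s| - p ≤ max (-(p + s)) 0 + max (-(p - s)) 0 := by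
          rcases abs_cases s with ⟨e, -⟩ | ⟨e, -⟩ <;> rw [e] <;>
            linarith [le_max_left (-(p + s)) 0, le_max_left (-(p - s)) 0,
              le_max_right (-(p + s)) 0, le_max_right (-(p - s)) 0]
        nlinarith [mul_le_mul_of_nonneg_left h hk.le]
    _ = _ := by ring

lemma IsPhase.exists_norm_todaInt_le (hχ : IsPhase ap am χ) (hap : 0 < ap) (ham : 0 < am) :
    ∃ K, ∀ X y, ‖todaInt ap am χ X y‖ ≤
      K * Real.exp (alpha ap am * mean ap am * X / 4) := by
  obtain ⟨K, hK0, hK⟩ := hχ.exists_norm_gPhiLine_mul_le hap ham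
  have hk := alpha_mul_mean_pos hap ham
  refine ⟨K * ∫ s : ℝ, Real.exp (-(alpha ap am * mean ap am / 2) * |s|), fun X y => ?_⟩
  refine (norm_integral_le_of_norm_le (((integrable_exp_neg_mul_abs hk).const_mul
    (K * Real.exp (alpha ap am * mean ap am / 2 * (X / 2)))))
    (ae_of_all _ fun s => ?_)).trans (le_of_eq ?_)
  · rw [norm_mul, norm_exp_phase, mul_one]
    exact hK _ _
  · rw [integral_const_mul]; ring_nf

lemma tendsto_add_atTop_id (x : ℝ) : Tendsto (fun Λ : ℝ => x + Λ) atTop atTop :=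
  tendsto_atTop_add_const_left _ _ tendsto_id

lemma IsPhase.tendsto_conicalInt (hχ : IsPhase ap am χ) (hap : 0 < ap) (ham : 0 < am)
    (X y : ℝ) : Tendsto (fun S : ℝ => ∫ s : ℝ,
      gPhiLine ap am χ (X / 2 + s) * gPhiLine ap am χ (X / 2 - s) *
      (gPsiLine ap am χ (S / 2 - s - y) * gPsiLine ap am χ (S / 2 + s + y)) *
      Complex.exp (Complex.I * alpha ap am * s * y)) atTop (𝓝 (todaInt ap am χ X y)) := by
  obtain ⟨K, hK0, hK⟩ := hχ.exists_norm_gPhiLine_mul_le hap ham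
  obtain ⟨M, hM0, hM⟩ := hχ.exists_norm_gPsiLine_le hap ham
  have hk := alpha_mul_mean_pos hap ham
  have hc := continuous_gPhiLine (χ := χ) hap ham
  have hc' := continuous_gPsiLine (χ := χ) hap ham
  refine tendsto_integral_filter_of_dominated_convergence
    (fun s => K * Real.exp (alpha ap am * mean ap am / 2 * (X / 2)) *
      Real.exp (-(alpha ap am * mean ap am / 2) * |s|) * (M * M)) ?_ ?_
    (((integrable_exp_neg_mul_abs hk).const_mul _).mul_const _) ?_
  · exact Eventually.of_forall fun S => Continuous.aestronglyMeasurable (by fun_prop)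
  · refine Eventually.of_forall fun S => ae_of_all _ fun s => ?_
    rw [norm_mul, norm_exp_phase, mul_one, norm_mul]
    refine mul_le_mul (hK _ _) ?_ (norm_nonneg _) (by positivity)
    rw [norm_mul]
    exact mul_le_mul (hM _) (hM _) (norm_nonneg _) hM0.le
  · refine ae_of_all _ fun s => ?_
    have hS : Tendsto (fun S : ℝ => S / 2) atTop atTop := tendsto_id.atTop_div_const two_pos
    have h1 : Tendsto (fun S : ℝ => S / 2 - s - y) atTop atTop :=
      tendsto_atTop_add_const_right _ _ (tendsto_atTop_add_const_right _ _ hS)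
    have h2 : Tendsto (fun S : ℝ => S / 2 + s + y) atTop atTop :=
      tendsto_atTop_add_const_right _ _ (tendsto_atTop_add_const_right _ _ hS)
    have h := ((((hχ.tendsto_gPsiLine hap ham).comp h1).mul
      ((hχ.tendsto_gPsiLine hap ham).comp h2)).const_mul
      (gPhiLine ap am χ (X / 2 + s) * gPhiLine ap am χ (X / 2 - s))).mul_const
      (Complex.exp (Complex.I * alpha ap am * s * y))
    simpa using h

lemma IsPhase.tendsto_gRem_ofReal (hχ : IsPhase ap am χ) (hap : 0 < ap) (ham : 0 < am) :
    Tendsto (fun v : ℝ => gRem ap am χ v) atTop (𝓝 0) := by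
  simpa using hχ.tendsto_gRem hap ham (s := 0) (by simpa using mean_pos hap ham)

/-- With γ = η + Λ the difference x - γ of the shifted variables stays equal to x - η, while x + γ,
γ and γ ± y tend to ∞. Every remainder `gRem` except the one at x - η therefore disappears. -/
lemma IsPhase.tendsto_conicalF (hχ : IsPhase ap am χ) (hap : 0 < ap) (ham : 0 < am)
    (η x y : ℝ) : Tendsto (fun Λ : ℝ => conicalF ap am (η + Λ) (x + Λ) y) atTop
      (𝓝 (1 / √(ap * am) * todaW ap am y ^ (1 / 2 : ℂ) *
        Complex.exp (Complex.I * alpha ap am * y ^ 2 / 4 -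
          Complex.I / 2 * gRem ap am χ ((x - η : ℝ) : ℂ)) * todaInt ap am χ (x - η) y)) := by
  have hR := hχ.tendsto_gRem_ofReal hap ham
  have tS : Tendsto (fun Λ : ℝ => x + Λ + (η + Λ)) atTop atTop :=
    (tendsto_add_atTop_id x).atTop_add_atTop (tendsto_add_atTop_id η)
  have tm : Tendsto (fun Λ : ℝ => η + Λ - y) atTop atTop :=
    tendsto_atTop_add_const_right _ _ (tendsto_add_atTop_id η)
  have tp : Tendsto (fun Λ : ℝ => η + Λ + y) atTop atTop :=
    tendsto_atTop_add_const_right _ _ (tendsto_add_atTop_id η)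
  have h1 := (tendsto_todaW_sqrt hap ham).comp (tendsto_add_atTop_id x)
  have h2 := (((((hR.comp tS).div_const 2).sub (hR.comp (tendsto_add_atTop_id η))).add
    ((hR.comp tm).div_const 2)).add ((hR.comp tp).div_const 2)).const_mul Complex.I
  have h3 := (Complex.continuous_exp.tendsto _).comp h2
  have h4 := (hχ.tendsto_conicalInt hap ham (x - η) y).comp tS
  have h := ((((h1.const_mul (1 / √(ap * am) : ℂ)).mul_const (todaW ap am y ^ (1 / 2 : ℂ))).mul_const
    (Complex.exp (Complex.I * alpha ap am * y ^ 2 / 4 -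
          Complex.I / 2 * gRem ap am χ ((x - η : ℝ) : ℂ)))).mul h3).mul h4
  simp only [zero_div, sub_zero, add_zero, mul_zero, Complex.exp_zero, mul_one] at h
  refine h.congr fun Λ => ?_
  rw [conicalF_eq hap ham χ]
  simp only [Function.comp_apply]
  rw [show x + Λ - (η + Λ) = x - η by ring]

lemma IsPhase.todaF_eq (hχ : IsPhase ap am χ) (hap : 0 < ap) (ham : 0 < am) (η x y : ℝ) :
    todaF ap am η x y = 1 / √(ap * am) * todaW ap am y ^ (1 / 2 : ℂ) *
        Complex.exp (Complex.I * alpha ap am * y ^ 2 / 4 -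
          Complex.I / 2 * gRem ap am χ ((x - η : ℝ) : ℂ)) * todaInt ap am χ (x - η) y :=
  (hχ.tendsto_conicalF hap ham η x y).limUnder_eq

theorem tendsto_conicalF_todaF (hap : 0 < ap) (ham : 0 < am) (η x y : ℝ) :
    Tendsto (fun Λ : ℝ => conicalF ap am (η + Λ) (x + Λ) y) atTop (𝓝 (todaF ap am η x y)) := by
  obtain ⟨χ, hχ⟩ := exists_isPhase hap ham
  rw [hχ.todaF_eq hap ham]
  exact hχ.tendsto_conicalF hap ham η x y

theorem todaF_isBigO (hap : 0 < ap) (ham : 0 < am) (η y : ℝ) :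
    Asymptotics.IsBigO atBot (fun x : ℝ => todaF ap am η x y)
      (fun x : ℝ => Real.exp (alpha ap am * mean ap am * x / 4)) := by
  obtain ⟨χ, hχ⟩ := exists_isPhase hap ham
  obtain ⟨K, hK⟩ := hχ.exists_norm_todaInt_le hap ham
  -- With B = 0: on the real axis `gRem` grows quadratically to the left, but its imaginary part is
  -- bounded, so the prefactor only oscillates.
  obtain ⟨C, hC⟩ := hχ.exists_abs_im_gRem_le hap ham (mean_pos hap ham)
  refine Asymptotics.IsBigO.of_bound (‖1 / √(ap * am) * todaW ap am y ^ (1 / 2 : ℂ)‖ *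
    Real.exp (C / 2) * (K * Real.exp (-(alpha ap am * mean ap am * η / 4))))
    (Eventually.of_forall fun x => ?_)
  have h1 : ‖Complex.exp (Complex.I * alpha ap am * y ^ 2 / 4 -
      Complex.I / 2 * gRem ap am χ ((x - η : ℝ) : ℂ))‖ ≤ Real.exp (C / 2) := by
    rw [Complex.norm_exp]
    apply Real.exp_le_exp.2
    have h2 := (abs_le.1 (hC ((x - η : ℝ) : ℂ) (by simp))).2
    rw [Complex.ofReal_im, mul_zero, add_zero] at h2
    rw [show Complex.I * alpha ap am * y ^ 2 / 4 - Complex.I / 2 * gRem ap am χ ((x - η : ℝ) : ℂ) =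
      Complex.I * ((alpha ap am * y ^ 2 / 4 : ℝ) : ℂ) -
        ((1 / 2 : ℝ) : ℂ) * (Complex.I * gRem ap am χ ((x - η : ℝ) : ℂ)) by push_cast; ring,
      Complex.sub_re, Complex.I_mul_re, Complex.ofReal_im, Complex.re_ofReal_mul, Complex.I_mul_re]
    linarith
  have h3 := hK (x - η) y
  rw [hχ.todaF_eq hap ham, norm_mul, norm_mul _ (Complex.exp _), Real.norm_of_nonneg
    (Real.exp_pos _).le, mul_assoc _ (K * _), mul_assoc K, ← Real.exp_add]
  rw [show alpha ap am * mean ap am * (x - η) / 4 = -(alpha ap am * mean ap am * η / 4) +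
    alpha ap am * mean ap am * x / 4 by ring] at h3
  gcongr

end


/-! ### Integration by parts in the Toda integral. -/

/-- The derivative of `gPhiLine`. -/
noncomputable def gPhiLine₁ (ap am : ℝ) (χ : ℂ) (v : ℝ) : ℂ :=
  gPhi₁ ap am χ (v + (-(mean ap am / 2) : ℝ) * Complex.I)

/-- A truncated version of the Fourier transform of `gPhiLine₁`. -/
noncomputable def lineConv (ap am : ℝ) (χ : ℂ) (X y : ℝ) : ℂ :=
  ∫ v : ℝ, gPhiLine₁ ap am χ v * gPhiLine ap am χ (X - v) *
    Complex.exp (Complex.I * alpha ap am * v * y)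

section
variable {ap am : ℝ} {χ : ℂ}

lemma hasDerivAt_gPhiLine (hap : 0 < ap) (ham : 0 < am) (v : ℝ) :
    HasDerivAt (gPhiLine ap am χ) (gPhiLine₁ ap am χ v) v :=
  ((hasDerivAt_gPhi (χ := χ) hap ham (line_mem_strip (abs_neg_mean_div_two_lt hap ham) v)
    ).comp_add_const (v : ℂ) _).comp_ofReal

lemma continuous_gPhiLine₁ (hap : 0 < ap) (ham : 0 < am) : Continuous (gPhiLine₁ ap am χ) :=
  continuous_line_of_differentiableOn (differentiableOn_gPhi₁ hap ham)
    (abs_neg_mean_div_two_lt hap ham)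

lemma IsPhase.integrable_gPhiLine₁ (hχ : IsPhase ap am χ) (hap : 0 < ap) (ham : 0 < am) :
    Integrable (gPhiLine₁ ap am χ) := by
  have h := hχ.integrable_ftKer hap ham (abs_neg_mean_div_two_lt hap ham) (y := 0)
    (by simpa using decayRate_pos hap ham) (by simpa using mean_pos hap ham)
  simp only [ftKer, mul_zero, Complex.exp_zero, mul_one] at h
  exact h

/-- The factor accounts for e^{iαvy} against e^{iαzy} at z = v - ia/2. -/
lemma integral_gPhiLine₁_mul_exp (ap am : ℝ) (χ : ℂ) (y : ℝ) :
    ∫ v : ℝ, gPhiLine₁ ap am χ v * Complex.exp (Complex.I * alpha ap am * v * y) =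
      Complex.exp (-(alpha ap am * mean ap am * y / 2)) *
        ftInt ap am χ (-(mean ap am / 2)) y := by
  rw [ftInt, ← integral_const_mul]
  refine integral_congr_ae (ae_of_all _ fun v => ?_)
  dsimp only
  rw [ftKer, gPhiLine₁, mul_left_comm, ← Complex.exp_add]
  congr 2
  push_cast
  linear_combination (alpha ap am * mean ap am * y / 2 : ℂ) * Complex.I_sq

lemma IsPhase.exists_norm_gPhiLine_le_const (hχ : IsPhase ap am χ) (hap : 0 < ap)
    (ham : 0 < am) : ∃ K > 0, ∀ v, ‖gPhiLine ap am χ v‖ ≤ K := by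
  obtain ⟨K, hK0, hK⟩ := hχ.exists_norm_gPhiLine_le hap ham
  refine ⟨K, hK0, fun v => (hK v).trans (mul_le_of_le_one_right hK0.le
    (Real.exp_le_one_iff.2 ?_))⟩
  nlinarith [mul_nonneg (alpha_mul_mean_pos hap ham).le (le_max_right (-v) 0)]

/-- Φ(X - v) tends boundedly to 1 for each v, and Φ' is integrable. -/
lemma IsPhase.tendsto_lineConv (hχ : IsPhase ap am χ) (hap : 0 < ap) (ham : 0 < am) (y : ℝ) :
    Tendsto (fun X => lineConv ap am χ X y) atTop
      (𝓝 (∫ v : ℝ, gPhiLine₁ ap am χ v * Complex.exp (Complex.I * alpha ap am * v * y))) := by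
  obtain ⟨K, hK0, hK⟩ := hχ.exists_norm_gPhiLine_le_const hap ham
  have hc := continuous_gPhiLine (χ := χ) hap ham
  have hc' := continuous_gPhiLine₁ (χ := χ) hap ham
  refine tendsto_integral_filter_of_dominated_convergence (fun v => ‖gPhiLine₁ ap am χ v‖ * K)
    ?_ ?_ ((hχ.integrable_gPhiLine₁ hap ham).norm.mul_const _) ?_
  · exact Eventually.of_forall fun X => Continuous.aestronglyMeasurable (by fun_prop)
  · refine Eventually.of_forall fun X => ae_of_all _ fun v => ?_
    rw [norm_mul, norm_exp_phase, mul_one, norm_mul]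
    exact mul_le_mul_of_nonneg_left (hK _) (norm_nonneg _)
  · refine ae_of_all _ fun v => ?_
    have h1 : Tendsto (fun X : ℝ => X - v) atTop atTop :=
      tendsto_atTop_add_const_right _ _ tendsto_id
    have h2 := (hχ.tendsto_gPhi_atTop hap ham (abs_neg_mean_div_two_lt hap ham)).comp h1
    have h := (h2.const_mul (gPhiLine₁ ap am χ v)).mul_const
      (Complex.exp (Complex.I * alpha ap am * v * y))
    rwa [mul_one] at h

lemma IsPhase.integrable_lineConv (hχ : IsPhase ap am χ) (hap : 0 < ap) (ham : 0 < am)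
    (X y : ℝ) : Integrable fun v : ℝ => gPhiLine₁ ap am χ v * gPhiLine ap am χ (X - v) *
      Complex.exp (Complex.I * alpha ap am * v * y) := by
  obtain ⟨K, hK0, hK⟩ := hχ.exists_norm_gPhiLine_le_const hap ham
  have hc := continuous_gPhiLine (χ := χ) hap ham
  have hc' := continuous_gPhiLine₁ (χ := χ) hap ham
  refine ((hχ.integrable_gPhiLine₁ hap ham).norm.mul_const K).mono'
    (Continuous.aestronglyMeasurable (by fun_prop)) (ae_of_all _ fun v => ?_)
  rw [norm_mul, norm_exp_phase, mul_one, norm_mul]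
  exact mul_le_mul_of_nonneg_left (hK _) (norm_nonneg _)

lemma IsPhase.integrable_todaInt (hχ : IsPhase ap am χ) (hap : 0 < ap) (ham : 0 < am)
    (X y : ℝ) : Integrable fun s : ℝ => gPhiLine ap am χ (X / 2 + s) *
      gPhiLine ap am χ (X / 2 - s) * Complex.exp (Complex.I * alpha ap am * s * y) := by
  obtain ⟨K, hK0, hK⟩ := hχ.exists_norm_gPhiLine_mul_le hap ham
  have hc := continuous_gPhiLine (χ := χ) hap ham
  refine ((integrable_exp_neg_mul_abs (alpha_mul_mean_pos hap ham)).const_mul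
    (K * Real.exp (alpha ap am * mean ap am / 2 * (X / 2)))).mono'
    (Continuous.aestronglyMeasurable (by fun_prop)) (ae_of_all _ fun s => ?_)
  rw [norm_mul, norm_exp_phase, mul_one]
  exact hK _ _

lemma lineConv_integrand_shift (ap am : ℝ) (χ : ℂ) (X y s : ℝ) :
    gPhiLine₁ ap am χ (X / 2 + s) * gPhiLine ap am χ (X / 2 - s) *
        Complex.exp (Complex.I * alpha ap am * s * y) =
      Complex.exp (-(Complex.I * alpha ap am * X * y / 2)) *
        (gPhiLine₁ ap am χ (s + X / 2) * gPhiLine ap am χ (X - (s + X / 2)) *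
          Complex.exp (Complex.I * alpha ap am * ((s + X / 2 : ℝ) : ℂ) * y)) := by
  rw [mul_left_comm, ← Complex.exp_add, show s + X / 2 = X / 2 + s by ring,
    show X - (X / 2 + s) = X / 2 - s by ring]
  congr 2
  push_cast
  ring

lemma lineConv_integrand_reflect (ap am : ℝ) (χ : ℂ) (X y s : ℝ) :
    gPhiLine ap am χ (X / 2 + s) * gPhiLine₁ ap am χ (X / 2 - s) *
        Complex.exp (Complex.I * alpha ap am * s * y) =
      Complex.exp (Complex.I * alpha ap am * X * y / 2) *
        (gPhiLine₁ ap am χ (X / 2 - s) * gPhiLine ap am χ (X - (X / 2 - s)) *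
          Complex.exp (Complex.I * alpha ap am * ((X / 2 - s : ℝ) : ℂ) * ((-y : ℝ) : ℂ))) := by
  rw [mul_left_comm (Complex.exp _), ← Complex.exp_add, show X - (X / 2 - s) = X / 2 + s by ring,
    mul_comm (gPhiLine ap am χ _)]
  congr 2
  push_cast
  ring

/-- As a function of s, Φ(X/2 + s) Φ(X/2 - s) is a plateau with edges near s = ∓X/2. Integrating by
parts against e^{iαsy}, with y ≠ 0, isolates the edges, and moving each to the origin produces its
plane wave. -/
lemma IsPhase.todaInt_eq (hχ : IsPhase ap am χ) (hap : 0 < ap) (ham : 0 < am) (X : ℝ) {y : ℝ}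
    (hy : y ≠ 0) : todaInt ap am χ X y = -(1 / (Complex.I * alpha ap am * y)) *
      (Complex.exp (-(Complex.I * alpha ap am * X * y / 2)) * lineConv ap am χ X y -
        Complex.exp (Complex.I * alpha ap am * X * y / 2) * lineConv ap am χ X (-y)) := by
  have hα : (alpha ap am : ℂ) ≠ 0 := by exact_mod_cast (alpha_pos hap ham).ne'
  have hyc : (y : ℂ) ≠ 0 := by exact_mod_cast hy
  set c : ℂ := Complex.I * alpha ap am * y with hc
  have hc0 : c ≠ 0 := mul_ne_zero (mul_ne_zero Complex.I_ne_zero hα) hyc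
  have hu : ∀ s : ℝ, HasDerivAt
      (fun s : ℝ => gPhiLine ap am χ (X / 2 + s) * gPhiLine ap am χ (X / 2 - s))
      (gPhiLine₁ ap am χ (X / 2 + s) * gPhiLine ap am χ (X / 2 - s) -
        gPhiLine ap am χ (X / 2 + s) * gPhiLine₁ ap am χ (X / 2 - s)) s := by
    intro s
    have h1 := (hasDerivAt_gPhiLine (χ := χ) hap ham (X / 2 + s)).comp_const_add (X / 2) s
    have h2 := (hasDerivAt_gPhiLine (χ := χ) hap ham (X / 2 - s)).comp_const_sub (X / 2) s
    refine (h1.mul h2).congr_deriv ?_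
    ring
  have hv : ∀ s : ℝ, HasDerivAt
      (fun s : ℝ => Complex.exp (Complex.I * alpha ap am * s * y) * (1 / c))
      (Complex.exp (Complex.I * alpha ap am * s * y)) s := by
    intro s
    have h1 : HasDerivAt (fun z : ℂ => Complex.exp (Complex.I * alpha ap am * z * y) * (1 / c))
        (Complex.exp (Complex.I * alpha ap am * s * y)) (s : ℂ) := by
      refine (((((hasDerivAt_id (s : ℂ)).const_mul (Complex.I * alpha ap am)).mul_const
        (y : ℂ)).cexp).mul_const (1 / c)).congr_deriv ?_
      simp only [id, mul_one, ← hc]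
      field_simp
    exact h1.comp_ofReal
  have hi1 : Integrable fun s : ℝ => gPhiLine₁ ap am χ (X / 2 + s) *
      gPhiLine ap am χ (X / 2 - s) * Complex.exp (Complex.I * alpha ap am * s * y) := by
    simp only [lineConv_integrand_shift]
    exact ((hχ.integrable_lineConv hap ham X y).comp_add_right (X / 2)).const_mul _
  have hi2 : Integrable fun s : ℝ => gPhiLine ap am χ (X / 2 + s) *
      gPhiLine₁ ap am χ (X / 2 - s) * Complex.exp (Complex.I * alpha ap am * s * y) := by
    simp only [lineConv_integrand_reflect]
    exact ((hχ.integrable_lineConv hap ham X (-y)).comp_sub_left (X / 2)).const_mul _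
  have e1 : ∫ s : ℝ, gPhiLine₁ ap am χ (X / 2 + s) * gPhiLine ap am χ (X / 2 - s) *
      Complex.exp (Complex.I * alpha ap am * s * y) =
      Complex.exp (-(Complex.I * alpha ap am * X * y / 2)) * lineConv ap am χ X y := by
    simp only [lineConv_integrand_shift]
    rw [integral_const_mul, lineConv]
    congr 1
    exact integral_add_right_eq_self (fun v : ℝ => gPhiLine₁ ap am χ v *
      gPhiLine ap am χ (X - v) * Complex.exp (Complex.I * alpha ap am * v * y)) (X / 2)
  have e2 : ∫ s : ℝ, gPhiLine ap am χ (X / 2 + s) * gPhiLine₁ ap am χ (X / 2 - s) *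
      Complex.exp (Complex.I * alpha ap am * s * y) =
      Complex.exp (Complex.I * alpha ap am * X * y / 2) * lineConv ap am χ X (-y) := by
    simp only [lineConv_integrand_reflect]
    rw [integral_const_mul, lineConv]
    congr 1
    exact integral_sub_left_eq_self (fun v : ℝ => gPhiLine₁ ap am χ v *
      gPhiLine ap am χ (X - v) * Complex.exp (Complex.I * alpha ap am * v * ((-y : ℝ) : ℂ)))
      volume (X / 2)
  have hparts := integral_mul_deriv_eq_deriv_mul_of_integrable
    (fun s _ => hu s) (fun s _ => hv s)
    (hχ.integrable_todaInt hap ham X y) (by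
      refine ((hi1.sub hi2).mul_const (1 / c)).congr (ae_of_all _ fun s => ?_)
      simp only [Pi.sub_apply, Pi.mul_apply]; ring) (by
      refine ((hχ.integrable_todaInt hap ham X y).mul_const (1 / c)).congr
        (ae_of_all _ fun s => ?_)
      simp only [Pi.mul_apply]; ring)
  rw [todaInt, hparts, ← e1, ← e2, ← integral_sub hi1 hi2, neg_mul, ← integral_const_mul]
  congr 1
  refine integral_congr_ae (ae_of_all _ fun s => ?_)
  dsimp only
  ring

/-- The Fourier transform of `gPhiLine₁` in terms of the hyperbolic gamma function. -/
lemma IsPhase.integral_gPhiLine₁_eq (hχ : IsPhase ap am χ) (hap : 0 < ap) (ham : 0 < am)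
    {y : ℝ} (hy : todaW ap am y ≠ 0) :
    ∫ v : ℝ, gPhiLine₁ ap am χ v * Complex.exp (Complex.I * alpha ap am * v * y) =
      -(Complex.I * alpha ap am * y) * √(ap * am) *
        Complex.exp (-(Complex.I * alpha ap am * y ^ 2 / 4)) /
        hypGamma ap am (-y + Complex.I * mean ap am) := by
  have hG := right_ne_zero_of_mul hy
  have h := hχ.ftInt_mul_ftMul hap ham y
  have hpc : (ap : ℂ) ≠ 0 := by exact_mod_cast hap.ne'
  have hmc : (am : ℂ) ≠ 0 := by exact_mod_cast ham.ne'
  have hπ : (Real.pi : ℂ) ≠ 0 := by exact_mod_cast Real.pi_ne_zero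
  have hs : ((√(ap * am) : ℝ) : ℂ) ≠ 0 := by
    exact_mod_cast (Real.sqrt_pos.2 (mul_pos hap ham)).ne'
  -- Since y times the `sinhc` factor is (a₋/π) sinh(πy/a₋), `ftMul` contains the boundary value
  -- G(-y + ia) found in `hypGamma_neg_add_I_mean`.
  have h1 : Complex.I * alpha ap am * y * √(ap * am) * ftMul ap am y =
      -(Complex.exp (-(alpha ap am * mean ap am * y / 2) + Complex.I * alpha ap am * y ^ 2 / 4) *
        hypGamma ap am (-y + Complex.I * mean ap am)) := by
    rw [hypGamma_neg_add_I_mean hap ham, ftMul, ← mul_sinhc (Real.pi * y / am), ofReal_alpha]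
    field_simp
  rw [integral_gPhiLine₁_mul_exp, eq_div_iff hG]
  have h2 : Complex.exp (-(alpha ap am * mean ap am * y / 2)) =
      Complex.exp (-(alpha ap am * mean ap am * y / 2) + Complex.I * alpha ap am * y ^ 2 / 4) *
      Complex.exp (-(Complex.I * alpha ap am * y ^ 2 / 4)) := by
    rw [← Complex.exp_add, add_neg_cancel_right]
  rw [h2]
  linear_combination (Complex.exp (-(Complex.I * alpha ap am * y ^ 2 / 4)) *
    ftInt ap am χ (-(mean ap am / 2)) y) * h1 + (-(Complex.I * alpha ap am * y * √(ap * am) *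
    Complex.exp (-(Complex.I * alpha ap am * y ^ 2 / 4)))) * h

end


/-! ### Asymptotics as x → ∞. -/

section
variable {ap am : ℝ}

lemma tendsto_mul_zero_of_norm_eq_one {u f : ℝ → ℂ} {l : Filter ℝ} (hu : ∀ x, ‖u x‖ = 1)
    (hf : Tendsto f l (𝓝 0)) : Tendsto (fun x => u x * f x) l (𝓝 0) := by
  rw [tendsto_zero_iff_norm_tendsto_zero] at hf ⊢
  simpa only [norm_mul, hu, one_mul] using hf

/-- The two integrals `lineConv` are replaced by their limits. Their plane-wave factors have modulus
1, so the errors stay o(1). The Gaussian phases e^{±iαy²/4} cancel, X = x - η supplies the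
η-dependence, and 1/G(±y + ia) completes the c-functions. The limit at y carries the wave
e^{-iαxy/2}, hence belongs to u^T(η; -y). -/
theorem todaF_asymptotics (hap : 0 < ap) (ham : 0 < am) (η : ℝ) {y : ℝ} (hy : 0 < y) :
    Tendsto (fun x : ℝ => todaF ap am η x y -
        (todaUSqrt ap am η y * Complex.exp (Complex.I * alpha ap am * x * y / 2) +
          todaUSqrt ap am η (-y) * Complex.exp (-(Complex.I * alpha ap am * x * y / 2))))
      atTop (𝓝 0) := by
  obtain ⟨χ, hχ⟩ := exists_isPhase hap ham
  have hW := todaW_ne_zero hap ham hy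
  have hα : (alpha ap am : ℂ) ≠ 0 := by exact_mod_cast (alpha_pos hap ham).ne'
  have hyc : (y : ℂ) ≠ 0 := by exact_mod_cast hy.ne'
  have hs : ((√(ap * am) : ℝ) : ℂ) ≠ 0 := by
    exact_mod_cast (Real.sqrt_pos.2 (mul_pos hap ham)).ne'
  have hX : Tendsto (fun x : ℝ => x - η) atTop atTop :=
    tendsto_atTop_add_const_right _ _ tendsto_id
  have hE : Tendsto (fun x : ℝ => Complex.exp (Complex.I * alpha ap am * y ^ 2 / 4 -
      Complex.I / 2 * gRem ap am χ ((x - η : ℝ) : ℂ))) atTop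
      (𝓝 (Complex.exp (Complex.I * alpha ap am * y ^ 2 / 4))) := by
    have h := (((hχ.tendsto_gRem_ofReal hap ham).comp hX).const_mul (Complex.I / 2)).const_sub
      (Complex.I * alpha ap am * y ^ 2 / 4)
    rw [mul_zero, sub_zero] at h
    exact (Complex.continuous_exp.tendsto _).comp h
  have hD := hχ.integral_gPhiLine₁_eq hap ham hW
  have hD' := hχ.integral_gPhiLine₁_eq hap ham (y := -y) (by rwa [todaW_neg])
  have hA := (hE.mul ((hχ.tendsto_lineConv hap ham y).comp hX)).sub_const
    (Complex.exp (Complex.I * alpha ap am * y ^ 2 / 4) *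
    ∫ v : ℝ, gPhiLine₁ ap am χ v * Complex.exp (Complex.I * alpha ap am * v * y))
  have hA' := (hE.mul ((hχ.tendsto_lineConv hap ham (-y)).comp hX)).sub_const
    (Complex.exp (Complex.I * alpha ap am * y ^ 2 / 4) *
    ∫ v : ℝ, gPhiLine₁ ap am χ v * Complex.exp (Complex.I * alpha ap am * v * ((-y : ℝ) : ℂ)))
  rw [sub_self] at hA hA'
  have hu : ∀ x : ℝ, ‖Complex.exp (-(Complex.I * alpha ap am * ((x - η : ℝ) : ℂ) * y / 2))‖ = 1 := by
    intro x
    have := norm_exp_phase ap am (x - η) (-y / 2)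
    rw [← this]; congr 2; push_cast; ring
  have hu' : ∀ x : ℝ, ‖Complex.exp (Complex.I * alpha ap am * ((x - η : ℝ) : ℂ) * y / 2)‖ = 1 := by
    intro x
    have := norm_exp_phase ap am (x - η) (y / 2)
    rw [← this]; congr 2; push_cast; ring
  have h := ((tendsto_mul_zero_of_norm_eq_one hu hA).sub
    (tendsto_mul_zero_of_norm_eq_one hu' hA')).const_mul
    (-(1 / √(ap * am) * todaW ap am y ^ (1 / 2 : ℂ) * (1 / (Complex.I * alpha ap am * y))))
  rw [sub_zero, mul_zero] at h
  refine h.congr fun x => ?_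
  simp only [Function.comp_apply]
  rw [hD, hD', hχ.todaF_eq hap ham, hχ.todaInt_eq hap ham _ hy.ne', todaUSqrt, todaUSqrt, todaW_neg,
    todaC, todaC]
  have hG := left_ne_zero_of_mul hW
  have hG' := right_ne_zero_of_mul hW
  have e1 : Complex.exp (Complex.I * alpha ap am * ((x - η : ℝ) : ℂ) * y / 2) =
      Complex.exp (-(Complex.I * alpha ap am * η * y / 2)) *
        Complex.exp (Complex.I * alpha ap am * x * y / 2) := by
    rw [← Complex.exp_add]; congr 1; push_cast; ring
  have e2 : Complex.exp (-(Complex.I * alpha ap am * ((x - η : ℝ) : ℂ) * y / 2)) =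
      Complex.exp (-(Complex.I * alpha ap am * η * ((-y : ℝ) : ℂ) / 2)) *
        Complex.exp (-(Complex.I * alpha ap am * x * y / 2)) := by
    rw [← Complex.exp_add]; congr 1; push_cast; ring
  have e3 : Complex.exp (Complex.I * alpha ap am * y ^ 2 / 4) *
      Complex.exp (-(Complex.I * alpha ap am * y ^ 2 / 4)) = 1 := by
    rw [← Complex.exp_add, add_neg_cancel, Complex.exp_zero]
  rw [e1, e2]
  have e4 : (((-y : ℝ) : ℂ)) ^ 2 = (y : ℂ) ^ 2 := by push_cast; ring
  have e5 : -(((-y : ℝ) : ℂ)) = (y : ℂ) := by push_cast; ring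
  have e6 : ((-y : ℝ) : ℂ) = -(y : ℂ) := by push_cast; rfl
  rw [e4, e5]
  generalize Complex.exp (-(Complex.I * alpha ap am * η * ((-y : ℝ) : ℂ) / 2)) = B₁
  generalize lineConv ap am χ (x - η) (-y) = L₁
  rw [e6]
  generalize hypGamma ap am (y + Complex.I * mean ap am) = G at *
  generalize hypGamma ap am (-y + Complex.I * mean ap am) = G' at *
  generalize Complex.exp (Complex.I * alpha ap am * y ^ 2 / 4) = q at *
  generalize Complex.exp (-(Complex.I * alpha ap am * y ^ 2 / 4)) = q' at *
  generalize Complex.exp (-(Complex.I * alpha ap am * η * y / 2)) = B at *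
  generalize Complex.exp (Complex.I * alpha ap am * x * y / 2) = P at *
  generalize Complex.exp (-(Complex.I * alpha ap am * x * y / 2)) = P' at *
  generalize todaW ap am y ^ (1 / 2 : ℂ) = w at *
  have hI := Complex.I_ne_zero
  field_simp
  linear_combination (-(w * √(ap * am) * Complex.I * alpha ap am * y *
    (P * B * G' + P' * B₁ * G))) * e3

end

end RelToda

theorem mainTheorem10 (ap am : ℝ) (hap : 0 < ap) (ham : 0 < am) (η y : ℝ) (hy : 0 < y) :
    (∀ x : ℝ, Tendsto (fun Λ : ℝ => RelToda.conicalF ap am (η + Λ) (x + Λ) y) atTop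
      (𝓝 (RelToda.todaF ap am η x y))) ∧
    Asymptotics.IsBigO atBot (fun x : ℝ => RelToda.todaF ap am η x y)
      (fun x : ℝ => Real.exp (RelToda.alpha ap am * RelToda.mean ap am * x / 4)) ∧
    RelToda.todaUSqrt ap am η y ^ 2 = RelToda.todaU ap am η y ∧
    RelToda.todaUSqrt ap am η (-y) ^ 2 = RelToda.todaU ap am η (-y) ∧
    Tendsto (fun x : ℝ => RelToda.todaF ap am η x y -
        (RelToda.todaUSqrt ap am η y *
            Complex.exp (Complex.I * RelToda.alpha ap am * x * y / 2) +
          RelToda.todaUSqrt ap am η (-y) *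
            Complex.exp (-(Complex.I * RelToda.alpha ap am * x * y / 2))))
      atTop (𝓝 0) := by
  have hW := RelToda.todaW_ne_zero hap ham hy
  exact ⟨fun x => RelToda.tendsto_conicalF_todaF hap ham η x y, RelToda.todaF_isBigO hap ham η y,
    RelToda.todaUSqrt_sq hW, RelToda.todaUSqrt_sq (by rwa [RelToda.todaW_neg]),
    RelToda.todaF_asymptotics hap ham η hy⟩
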